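/- Let $I=\mathbb R$ or $I=(\alpha,\infty)$, and let $\mathcal L=\sum_{k\le m}c_k(x)\,\partial_x^k$ be a linear differential operator on $I$ whose coefficients do not depend on time. Let $G(x,t|\xi,\tau)$ be a Green function (fundamental solution) of $\partial_tV=\mathcal LV$ on $I$, in the following sense: $G=0$ for $t<\tau$; $G$ is smooth in $(x,t,\xi,\tau)\in I\times\mathbb R\times I\times\mathbb R$ away from the pole $(x,t)=(\xi,\tau)$; $\partial_tG=\mathcal L_xG$ for $t>\tau$; $\int G(x,t|\xi,\tau)f(\xi)\,d\xi\to f(x_0)$ as $(x,t)\to(x_0,\tau)$ with $t>\tau$, for every $x_0\in I$, every $\tau$ and every continuous $f$ with compact support in $I$; and $G,\partial_\xi G\to0$ as $x\to\infty$, locally uniformly in $(t,\xi,\tau)$. Let $y:[0,\infty)\to I$ be continuous, and for a continuous density $\Psi:[0,\infty)\to\mathbb R$ put $$\Pi_\Psi(x,t)=\int_0^t\Psi(\tau)\,\frac{\partial G}{\partial\xi}(x,t|\xi,\tau)\Big|_{\xi=y(\tau)}\,d\tau .$$ 1. For every continuous $\Psi$, $V=\Pi_\Psi$ is a classical solution of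 $\partial_tV=\mathcal LV$ in $\{t>0,\ x>y(t)\}$ ($m$ times continuously differentiable in $x$, differentiable in $t$). It is continuous on $\{t\ge0,\ x>y(t)\}$, $V(x,0)=0$ for $x>y(0)$, and $V(x,t)\to0$ as $x\to\infty$ for every $t>0$. 2. Suppose moreover that $\mathcal L$ is a second-order parabolic operator with smooth coefficients, that is $m=2$, $c_0,c_1,c_2\in C^\infty(I)$ and the diffusion coefficient $a=c_2$ is positive on $I$, and that $y$ is locally Lipschitz. Write $b(t)=\dfrac1{2a(y(t))}$, which is the constant $\dfrac1{2a}$ if $a$ is constant. (a) For every continuous $\Psi$ and every $t>0$ the integral defining $\Pi_\Psi(y(t),t)$ converges absolutely, and $$\lim_{x\downarrow y(t)}\Pi_\Psi(x,t)=b(t)\Psi(t)+\int_0^t\Psi(\tau)\,\frac{\partial G}{\partial\xi}(y(t),t|\xi,\tau)\Big|_{\xi=y(\tau)}\,d\tau .$$ (b) For every function $\varphi$ and every continuous $\Psi$, the potential satisfies the boundary condition $\Pi_\Psi(y(t)+0,t)=\varphi(t)$ for all $t>0$ if and only if $\Psi$ solves the Volterra equation of the second kind $$\varphi(t)=b(t)\Psi(t)+\int_0^t\Psi(\tau)\,\frac{\partial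 G}{\partial\xi}(y(t),t|\xi,\tau)\Big|_{\xi=y(\tau)}\,d\tau,\qquad t>0 .$$ (c) For every continuous $\varphi:[0,\infty)\to\mathbb R$ the boundary condition determines the density: there is exactly one continuous $\Psi:[0,\infty)\to\mathbb R$ for which $\Pi_\Psi$ satisfies it. -/

import Mathlib

open Set Filter Topology MeasureTheory
open scoped ContDiff

noncomputable section

/-- The linear differential operator `f ↦ ∑_{k ≤ m} c k (x) f⁽ᵏ⁾(x)` of order at most `m`; its
coefficients depend on the space variable only. -/
def diffOp (m : ℕ) (c : ℕ → ℝ → ℝ) (f : ℝ → ℝ) (x : ℝ) : ℝ :=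
  ∑ k ∈ Finset.range (m + 1), c k x * iteratedDeriv k f x

/-- `G x t ξ τ`, written `G(x,t|ξ,τ)`, is a Green function (fundamental solution) of
`∂V/∂t = 𝓛 V` on the open set `I`, where `𝓛 = diffOp m c`, with pole `(ξ,τ)` and with zero
boundary condition at `x = +∞`. -/
structure IsGreenFunction (I : Set ℝ) (m : ℕ) (c : ℕ → ℝ → ℝ) (G : ℝ → ℝ → ℝ → ℝ → ℝ) :
    Prop where
  /-- `G` is smooth in all its variables away from the pole `x = ξ`, `t = τ`. -/
  smooth : ContDiffOn ℝ ∞ (fun p : ℝ × ℝ × ℝ × ℝ => G p.1 p.2.1 p.2.2.1 p.2.2.2)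
    {p | p.1 ∈ I ∧ p.2.2.1 ∈ I ∧ ¬ (p.1 = p.2.2.1 ∧ p.2.1 = p.2.2.2)}
  /-- `G` vanishes before the time `τ` of the pole. -/
  causal : ∀ x ∈ I, ∀ ξ ∈ I, ∀ t τ : ℝ, t < τ → G x t ξ τ = 0
  /-- `G` solves the equation in `(x,t)` after the time `τ`. -/
  pde : ∀ x ∈ I, ∀ ξ ∈ I, ∀ t τ : ℝ, τ < t →
    deriv (fun t' => G x t' ξ τ) t = diffOp m c (fun x' => G x' t ξ τ) x
  /-- `G(x,t|ξ,τ) → δ(x - ξ)` as `t ↓ τ`. -/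
  delta : ∀ f : ℝ → ℝ, Continuous f → HasCompactSupport f → tsupport f ⊆ I →
    ∀ x₀ ∈ I, ∀ τ : ℝ,
      Tendsto (fun p : ℝ × ℝ => ∫ ξ, G p.1 p.2 ξ τ * f ξ) (𝓝 x₀ ×ˢ 𝓝[>] τ) (𝓝 (f x₀))
  /-- `G` and `∂G/∂ξ` tend to `0` as `x → ∞`, locally uniformly in `(t,ξ,τ)`. -/
  vanish : ∀ K : Set (ℝ × ℝ × ℝ), IsCompact K → (∀ q ∈ K, q.2.1 ∈ I) →
    TendstoUniformlyOn (fun (x : ℝ) (q : ℝ × ℝ × ℝ) => G x q.1 q.2.1 q.2.2) 0 atTop K ∧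
    TendstoUniformlyOn
      (fun (x : ℝ) (q : ℝ × ℝ × ℝ) => deriv (fun ξ => G x q.1 ξ q.2.2) q.2.1) 0 atTop K

/-- The integrand `Ψ(τ) ∂G/∂ξ (x,t|ξ,τ)` at `ξ = y(τ)` of the potential. -/
def potentialIntegrand (G : ℝ → ℝ → ℝ → ℝ → ℝ) (y Ψ : ℝ → ℝ) (x t τ : ℝ) : ℝ :=
  Ψ τ * deriv (fun ξ => G x t ξ τ) (y τ)

/-- The potential `Π(x,t) = ∫₀ᵗ Ψ(τ) ∂G/∂ξ (x,t|ξ,τ)|_{ξ = y(τ)} dτ` with density `Ψ`. -/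
def potential (G : ℝ → ℝ → ℝ → ℝ → ℝ) (y Ψ : ℝ → ℝ) (x t : ℝ) : ℝ :=
  ∫ τ in (0 : ℝ)..t, potentialIntegrand G y Ψ x t τ

/-- `V x t` is a classical solution of `∂V/∂t = 𝓛 V` on `{t > 0, x > y(t)}`, continuous up to
`t = 0`, with `V(x,0) = 0` for `x > y(0)` and `V(x,t) → 0` as `x → ∞`. -/
structure SolvesHomogeneousProblem (m : ℕ) (c : ℕ → ℝ → ℝ) (y : ℝ → ℝ) (V : ℝ → ℝ → ℝ) :
    Prop where
  continuousOn : ContinuousOn (fun p : ℝ × ℝ => V p.1 p.2) {p | 0 ≤ p.2 ∧ y p.2 < p.1}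
  contDiffAt : ∀ t > 0, ∀ x > y t, ContDiffAt ℝ m (fun x' => V x' t) x
  pde : ∀ t > 0, ∀ x > y t, HasDerivAt (fun t' => V x t') (diffOp m c (fun x' => V x' t) x) t
  initial : ∀ x > y 0, V x 0 = 0
  vanish : ∀ t > 0, Tendsto (fun x => V x t) atTop (𝓝 0)

/-- The boundary condition `V(y(t) + 0, t) = φ(t)` for all `t > 0`. -/
def HasBoundaryValue (y φ : ℝ → ℝ) (V : ℝ → ℝ → ℝ) : Prop :=
  ∀ t > 0, Tendsto (fun x => V x t) (𝓝[>] (y t)) (𝓝 (φ t))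

/-- `diffOp m c` is a second-order parabolic operator on `I` with smooth coefficients: it is
`a ∂²/∂x² + c₁ ∂/∂x + c₀` with diffusion coefficient `a = c 2 > 0`. -/
def IsSecondOrderParabolic (I : Set ℝ) (m : ℕ) (c : ℕ → ℝ → ℝ) : Prop :=
  m = 2 ∧ (∀ k ≤ 2, ContDiffOn ℝ ∞ (c k) I) ∧ ∀ x ∈ I, 0 < c 2 x

/-- The Volterra equation of the second kind
`φ(t) = b Ψ(t) + ∫₀ᵗ Ψ(τ) ∂G/∂ξ (y(t),t|ξ,τ)|_{ξ = y(τ)} dτ`, `t > 0`, with `b = 1 / (2 a)`,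
where `a = a(y(t))` is the diffusion coefficient at the boundary. -/
def SolvesVolterra (a : ℝ → ℝ) (G : ℝ → ℝ → ℝ → ℝ → ℝ) (y φ Ψ : ℝ → ℝ) : Prop :=
  ∀ t > 0, φ t = 1 / (2 * a (y t)) * Ψ t +
    ∫ τ in (0 : ℝ)..t, Ψ τ * deriv (fun ξ => G (y t) t ξ τ) (y τ)

end

/-!
# The double layer potential of a Green function on a moving boundary

For `x > y t` the points `(x, t)` and `(y τ, τ)` never coincide, so that the integrand of the
potential is smooth there. As `G` vanishes before the pole, the upper limit of integration may be
moved past `t`; differentiation under the integral sign then shows that the potential inherits the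
equation from `∂G/∂ξ`, which satisfies it because the coefficients do not depend on `ξ`
(`IsGreenFunction.solvesHomogeneousProblem`).

At the boundary the size of `∂G/∂ξ` near the pole has to be known, although nothing is assumed
there except that `G` is an approximate identity as `t ↓ τ`. The comparison function is the
parametrix `P`, the heat kernel in the Liouville coordinate `Z' = c₂^{-1/2}` multiplied by gauge
factors, with the zeroth-order term `q` of the Liouville normal form frozen at `ξ`. It satisfies
`∂ₜP = 𝓛P + (q(ξ) - q(x)) P`, and the factor `q(ξ) - q(x)` makes the `ξ`-derivative of the error
of order `(t - τ)^{-1/2}`. For a test function `g` the function `u(x,t) = ∫ (G - P) g' dξ` has zero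
initial values, because `G` and `P` have the same ones. An integration by parts bounds its lateral
values and its source by a multiple of `∫ |g|`, and the maximum principle (`abs_le_of_parabolic`)
extends the bound to `u = -∫ ∂(G - P)/∂ξ g dξ`. As `g` is arbitrary, `∂(G - P)/∂ξ` is bounded
(`exists_bound_greenXi_sub_parametrixXi`).

For a Lipschitz boundary, `∂G/∂ξ` therefore differs by `O((t - τ)^{-1/2})` from the double layer
kernel of the heat equation for a boundary at rest, divided by `c₂ (y t)`
(`exists_bound_greenXi_near_boundary`). The latter has an explicit primitive in `τ` and concentrates
with mass `1 / 2` at `τ = t`, whereas dominated convergence applies to the difference. This is the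
jump relation `tendsto_potential_boundary`, and the boundary condition becomes a Volterra equation
of the second kind. Its kernel has at most a singularity `(t - τ)^{-1/2}`, so that the Volterra
operator is a contraction in exponentially weighted norms
(`IsWeaklySingular.exists_weight`); the Neumann series gives existence and the contraction gives
uniqueness.
-/


/-! ### Directional derivatives and integrals depending on a parameter -/

section Tools

/-- Tube lemma: near `p₀` the translates `p + K` of a compact set stay in `Ω` and `f` is bounded
on them. -/
theorem exists_bound_translates {E : Type*} [NormedAddCommGroup E] {f : E → ℝ} {Ω : Set E}
    (hf : ContinuousOn f Ω) (hΩ : IsOpen Ω) {K : Set E} (hK : IsCompact K) {p₀ : E}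
    (hp : ∀ q ∈ K, p₀ + q ∈ Ω) :
    ∃ C, ∀ᶠ p in 𝓝 p₀, ∀ q ∈ K, p + q ∈ Ω ∧ |f (p + q)| ≤ C := by
  have hc : ContinuousOn (fun q => |f (p₀ + q)|) K :=
    (hf.comp (by fun_prop) hp).abs
  obtain ⟨C, hC⟩ := (hK.image_of_continuousOn hc).bddAbove
  refine ⟨C + 1, hK.eventually_forall_of_forall_eventually fun q hq => ?_⟩
  have hadd : Tendsto (fun z : E × E => z.1 + z.2) (𝓝 (p₀, q)) (𝓝 (p₀ + q)) :=
    (continuous_fst.add continuous_snd).tendsto _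
  have hfc : ContinuousAt (fun z => |f z|) (p₀ + q) :=
    (hf.continuousAt (hΩ.mem_nhds (hp q hq))).abs
  have hlt : |f (p₀ + q)| < C + 1 := by
    have : |f (p₀ + q)| ≤ C := hC (mem_image_of_mem _ hq)
    linarith
  filter_upwards [hadd (hΩ.mem_nhds (hp q hq)), hadd (hfc.eventually (gt_mem_nhds hlt))]
    with z h1 h2 using ⟨h1, le_of_lt h2⟩

theorem continuousOn_mul_translate {E : Type*} [NormedAddCommGroup E] {f : E → ℝ} {Ω : Set E}
    {γ : ℝ → E} {ψ : ℝ → ℝ} {a b : ℝ} (hf : ContinuousOn f Ω)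
    (hγ : ContinuousOn γ (Icc a b)) (hψ : ContinuousOn ψ (Icc a b)) {p : E}
    (hp : ∀ τ ∈ Icc a b, p + γ τ ∈ Ω) : ContinuousOn (fun τ => ψ τ * f (p + γ τ)) (Icc a b) :=
  hψ.mul (hf.comp (continuousOn_const.add hγ) hp)

theorem continuousAt_integral_translate {E : Type*} [NormedAddCommGroup E] {f : E → ℝ}
    {Ω : Set E} {γ : ℝ → E} {ψ : ℝ → ℝ} {a b : ℝ} (hab : a ≤ b)
    (hf : ContinuousOn f Ω) (hΩ : IsOpen Ω) (hγ : ContinuousOn γ (Icc a b))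
    (hψ : ContinuousOn ψ (Icc a b)) {p₀ : E}
    (hp : ∀ τ ∈ Icc a b, p₀ + γ τ ∈ Ω) :
    ContinuousAt (fun p => ∫ τ in a..b, ψ τ * f (p + γ τ)) p₀ := by
  obtain ⟨C, hC⟩ := exists_bound_translates hf hΩ (isCompact_Icc.image_of_continuousOn hγ)
    (p₀ := p₀) (by rintro _ ⟨τ, hτ, rfl⟩; exact hp τ hτ)
  obtain ⟨D, hD⟩ := isCompact_Icc.exists_bound_of_continuousOn hψ
  have hsub : uIoc a b ⊆ Icc a b := by rw [uIoc_of_le hab]; exact Ioc_subset_Icc_self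
  refine intervalIntegral.continuousAt_of_dominated_interval (bound := fun _ => D * C) ?_ ?_
    intervalIntegrable_const ?_
  · filter_upwards [hC] with p hp'
    exact ((continuousOn_mul_translate hf hγ hψ fun τ hτ =>
      (hp' _ (mem_image_of_mem _ hτ)).1).mono hsub).aestronglyMeasurable measurableSet_uIoc
  · filter_upwards [hC] with p hp'
    refine Eventually.of_forall fun τ hτ => ?_
    rw [norm_mul]
    have h1 := hD τ (hsub hτ)
    exact mul_le_mul h1 (hp' _ (mem_image_of_mem _ (hsub hτ))).2 (norm_nonneg _)
      ((norm_nonneg _).trans h1)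
  · refine Eventually.of_forall fun τ hτ => ?_
    refine ContinuousAt.mul continuousAt_const ?_
    exact ContinuousAt.comp (f := fun p => p + γ τ)
      (hf.continuousAt (hΩ.mem_nhds (hp τ (hsub hτ)))) (by fun_prop)

variable {E : Type*} [NormedAddCommGroup E] [NormedSpace ℝ E]

/-- The directional derivative `∂_v f` of `f : E → ℝ`, as a function on `E`. -/
noncomputable def dirDeriv (v : E) (f : E → ℝ) (p : E) : ℝ := fderiv ℝ f p v

theorem ContDiffOn.dirDeriv {f : E → ℝ} {Ω : Set E} (hf : ContDiffOn ℝ ∞ f Ω) (hΩ : IsOpen Ω)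
    (v : E) : ContDiffOn ℝ ∞ (dirDeriv v f) Ω :=
  (hf.fderiv_of_isOpen hΩ (by simp)).clm_apply contDiffOn_const

theorem ContDiffOn.dirDeriv_iterate {f : E → ℝ} {Ω : Set E} (hf : ContDiffOn ℝ ∞ f Ω)
    (hΩ : IsOpen Ω) (v : E) (k : ℕ) : ContDiffOn ℝ ∞ ((_root_.dirDeriv v)^[k] f) Ω := by
  induction k with
  | zero => simpa using hf
  | succ k ih => rw [Function.iterate_succ_apply']; exact ih.dirDeriv hΩ v

theorem ContDiffOn.hasFDerivAt_of_mem {f : E → ℝ} {Ω : Set E} (hf : ContDiffOn ℝ ∞ f Ω)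
    (hΩ : IsOpen Ω) {p : E} (hp : p ∈ Ω) : HasFDerivAt f (fderiv ℝ f p) p :=
  ((hf.contDiffAt (hΩ.mem_nhds hp)).differentiableAt (by simp)).hasFDerivAt

theorem hasDerivAt_comp_dirDeriv {f : E → ℝ} {Ω : Set E} (hf : ContDiffOn ℝ ∞ f Ω)
    (hΩ : IsOpen Ω) {v : E} {ℓ : ℝ → E} {x : ℝ} (hℓ : HasDerivAt ℓ v x) (hx : ℓ x ∈ Ω) :
    HasDerivAt (fun x => f (ℓ x)) (dirDeriv v f (ℓ x)) x :=
  (hf.hasFDerivAt_of_mem hΩ hx).comp_hasDerivAt x hℓ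

theorem Filter.EventuallyEq.dirDeriv_eq {f g : E → ℝ} {p : E} (h : f =ᶠ[𝓝 p] g) (v : E) :
    dirDeriv v f p = dirDeriv v g p := by
  rw [dirDeriv, dirDeriv, h.fderiv_eq]

theorem dirDeriv_comm {f : E → ℝ} {Ω : Set E} (hf : ContDiffOn ℝ ∞ f Ω) (hΩ : IsOpen Ω)
    (v w : E) {p : E} (hp : p ∈ Ω) :
    dirDeriv v (dirDeriv w f) p = dirDeriv w (dirDeriv v f) p := by
  have hs : IsSymmSndFDerivAt ℝ f p :=
    (hf.contDiffAt (hΩ.mem_nhds hp)).isSymmSndFDerivAt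
      (by simpa using WithTop.coe_le_coe.2 (le_top : (2 : ℕ∞) ≤ ⊤))
  have hd : DifferentiableAt ℝ (fderiv ℝ f) p :=
    ((hf.fderiv_of_isOpen hΩ (m := ∞) (by simp)).contDiffAt (hΩ.mem_nhds hp)).differentiableAt
      (by simp)
  have key : ∀ a b : E, dirDeriv a (dirDeriv b f) p = fderiv ℝ (fderiv ℝ f) p a b := by
    intro a b
    have h := hd.hasFDerivAt.clm_apply (hasFDerivAt_const b p)
    have h' : fderiv ℝ (dirDeriv b f) p = _ := h.fderiv
    rw [dirDeriv, h']
    simp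
  rw [key, key, hs.eq]

theorem dirDeriv_iterate_comm {f : E → ℝ} {Ω : Set E} (hf : ContDiffOn ℝ ∞ f Ω) (hΩ : IsOpen Ω)
    (v w : E) (k : ℕ) {p : E} (hp : p ∈ Ω) :
    dirDeriv v ((dirDeriv w)^[k] f) p = (dirDeriv w)^[k] (dirDeriv v f) p := by
  induction k generalizing p with
  | zero => rfl
  | succ k ih =>
    rw [Function.iterate_succ_apply', Function.iterate_succ_apply',
      dirDeriv_comm (hf.dirDeriv_iterate hΩ w k) hΩ v w hp]
    refine Filter.EventuallyEq.dirDeriv_eq ?_ w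
    filter_upwards [hΩ.mem_nhds hp] with q hq using ih hq

/-- A chain of functions each of which is the derivative of the one before consists of the
iterated derivatives of the first. -/
theorem iteratedDeriv_eq_of_hasDerivAt {J : ℕ → ℝ → ℝ} {U : Set ℝ} (hU : IsOpen U)
    (hJ : ∀ k, ∀ x ∈ U, HasDerivAt (J k) (J (k + 1) x) x) (k : ℕ) :
    ∀ x ∈ U, iteratedDeriv k (J 0) x = J k x := by
  induction k with
  | zero => intro x _; simp
  | succ k ih =>
    intro x hx
    rw [iteratedDeriv_succ]
    have : iteratedDeriv k (J 0) =ᶠ[𝓝 x] J k := by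
      filter_upwards [hU.mem_nhds hx] with z hz using ih z hz
    rw [this.deriv_eq, (hJ k x hx).deriv]

theorem contDiffOn_of_hasDerivAt_chain {J : ℕ → ℝ → ℝ} {U : Set ℝ} (hU : IsOpen U)
    (hJ : ∀ k, ∀ x ∈ U, HasDerivAt (J k) (J (k + 1) x) x) (n : ℕ) :
    ContDiffOn ℝ n (J 0) U := by
  induction n generalizing J with
  | zero => exact contDiffOn_zero.2 fun x hx => (hJ 0 x hx).continuousAt.continuousWithinAt
  | succ n ih =>
    have h := ih (J := fun k => J (k + 1)) (fun k => hJ (k + 1))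
    rw [Nat.cast_succ, contDiffOn_succ_iff_deriv_of_isOpen hU]
    refine ⟨fun x hx => (hJ 0 x hx).differentiableAt.differentiableWithinAt, by simp, ?_⟩
    exact h.congr fun x hx => (hJ 0 x hx).deriv

variable {f : E → ℝ} {Ω : Set E} {γ : ℝ → E} {ψ : ℝ → ℝ} {a b : ℝ}

/-- Differentiation along a line `ℓ` with direction `v` under the integral sign. -/
theorem hasDerivAt_integral_translate (hab : a ≤ b) (hf : ContDiffOn ℝ ∞ f Ω) (hΩ : IsOpen Ω)
    (hγ : ContinuousOn γ (Icc a b)) (hψ : ContinuousOn ψ (Icc a b)) {ℓ : ℝ → E} {v : E}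
    (hℓ : ∀ x, HasDerivAt ℓ v x) {x₀ : ℝ} (hp : ∀ τ ∈ Icc a b, ℓ x₀ + γ τ ∈ Ω) :
    HasDerivAt (fun x => ∫ τ in a..b, ψ τ * f (ℓ x + γ τ))
      (∫ τ in a..b, ψ τ * dirDeriv v f (ℓ x₀ + γ τ)) x₀ := by
  have hf' : ContinuousOn (dirDeriv v f) Ω := (hf.dirDeriv hΩ v).continuousOn
  obtain ⟨C, hC⟩ := exists_bound_translates hf' hΩ (isCompact_Icc.image_of_continuousOn hγ)
    (p₀ := ℓ x₀) (by rintro _ ⟨τ, hτ, rfl⟩; exact hp τ hτ)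
  obtain ⟨D, hD⟩ := isCompact_Icc.exists_bound_of_continuousOn hψ
  have hsub : uIoc a b ⊆ Icc a b := by rw [uIoc_of_le hab]; exact Ioc_subset_Icc_self
  have hN := (hℓ x₀).continuousAt.eventually hC
  refine (intervalIntegral.hasDerivAt_integral_of_dominated_loc_of_deriv_le
    (F := fun x τ => ψ τ * f (ℓ x + γ τ)) (F' := fun x τ => ψ τ * dirDeriv v f (ℓ x + γ τ))
    (bound := fun _ => D * C) hN ?_ ?_ ?_ ?_ intervalIntegrable_const ?_).2
  · filter_upwards [hN] with x hx
    exact ((continuousOn_mul_translate hf.continuousOn hγ hψ fun τ hτ =>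
      (hx _ (mem_image_of_mem _ hτ)).1).mono hsub).aestronglyMeasurable measurableSet_uIoc
  · exact ContinuousOn.intervalIntegrable_of_Icc hab
      (continuousOn_mul_translate hf.continuousOn hγ hψ hp)
  · exact ((continuousOn_mul_translate hf' hγ hψ hp).mono hsub).aestronglyMeasurable
      measurableSet_uIoc
  · refine Eventually.of_forall fun τ hτ x hx => ?_
    rw [norm_mul]
    have h1 := hD τ (hsub hτ)
    exact mul_le_mul h1 (hx _ (mem_image_of_mem _ (hsub hτ))).2 (norm_nonneg _)
      ((norm_nonneg _).trans h1)
  · refine Eventually.of_forall fun τ hτ x hx => ?_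
    exact (hasDerivAt_comp_dirDeriv hf hΩ ((hℓ x).add_const (γ τ))
      (hx _ (mem_image_of_mem _ (hsub hτ))).1).const_mul (ψ τ)

end Tools

/-! ### The Green function away from its pole -/

section Green

/-- The Green function as a function on `ℝ⁴`, with variables in the order `(x, t, ξ, τ)`. -/
def green (G : ℝ → ℝ → ℝ → ℝ → ℝ) (p : ℝ × ℝ × ℝ × ℝ) : ℝ := G p.1 p.2.1 p.2.2.1 p.2.2.2

/-- The points `(x, t, ξ, τ)` with `x, ξ ∈ I` and `(x, t) ≠ (ξ, τ)`. -/
def offPole (I : Set ℝ) : Set (ℝ × ℝ × ℝ × ℝ) :=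
  {p | p.1 ∈ I ∧ p.2.2.1 ∈ I ∧ ¬ (p.1 = p.2.2.1 ∧ p.2.1 = p.2.2.2)}

/-- The unit vector of the variable `x`. -/
def dirX : ℝ × ℝ × ℝ × ℝ := (1, 0, 0, 0)
/-- The unit vector of the variable `t`. -/
def dirT : ℝ × ℝ × ℝ × ℝ := (0, 1, 0, 0)
/-- The unit vector of the variable `ξ`. -/
def dirXi : ℝ × ℝ × ℝ × ℝ := (0, 0, 1, 0)

theorem hasDerivAt_lineX (t ξ τ x : ℝ) : HasDerivAt (fun x : ℝ => (x, t, ξ, τ)) dirX x :=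
  (hasDerivAt_id x).prodMk (hasDerivAt_const x (t, ξ, τ))

theorem hasDerivAt_lineT (x ξ τ t : ℝ) : HasDerivAt (fun t : ℝ => (x, t, ξ, τ)) dirT t :=
  (hasDerivAt_const t x).prodMk ((hasDerivAt_id t).prodMk (hasDerivAt_const t (ξ, τ)))

theorem hasDerivAt_lineXi (x t τ ξ : ℝ) : HasDerivAt (fun ξ : ℝ => (x, t, ξ, τ)) dirXi ξ :=
  (hasDerivAt_const ξ x).prodMk ((hasDerivAt_const ξ t).prodMk
    ((hasDerivAt_id ξ).prodMk (hasDerivAt_const ξ τ)))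

/-- The derivative `∂G/∂ξ`, as a function on `ℝ⁴`. -/
noncomputable def greenXi (G : ℝ → ℝ → ℝ → ℝ → ℝ) : ℝ × ℝ × ℝ × ℝ → ℝ := dirDeriv dirXi (green G)

variable {I : Set ℝ} {m : ℕ} {c : ℕ → ℝ → ℝ} {G : ℝ → ℝ → ℝ → ℝ → ℝ}

theorem isOpen_offPole (hI : IsOpen I) : IsOpen (offPole I) := by
  have h1 : IsOpen {p : ℝ × ℝ × ℝ × ℝ | p.1 ∈ I} := hI.preimage (by fun_prop)
  have h2 : IsOpen {p : ℝ × ℝ × ℝ × ℝ | p.2.2.1 ∈ I} := hI.preimage (by fun_prop)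
  have h3 : IsClosed {p : ℝ × ℝ × ℝ × ℝ | p.1 = p.2.2.1} := isClosed_eq (by fun_prop) (by fun_prop)
  have h4 : IsClosed {p : ℝ × ℝ × ℝ × ℝ | p.2.1 = p.2.2.2} :=
    isClosed_eq (by fun_prop) (by fun_prop)
  exact h1.inter (h2.inter (h3.inter h4).isOpen_compl)

theorem IsGreenFunction.contDiffOn_green (hG : IsGreenFunction I m c G) :
    ContDiffOn ℝ ∞ (green G) (offPole I) := hG.smooth

theorem IsGreenFunction.contDiffOn_greenXi (hG : IsGreenFunction I m c G) (hI : IsOpen I) :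
    ContDiffOn ℝ ∞ (greenXi G) (offPole I) :=
  hG.contDiffOn_green.dirDeriv (isOpen_offPole hI) _

theorem IsGreenFunction.hasDerivAt_xi (hG : IsGreenFunction I m c G) (hI : IsOpen I)
    {x t ξ τ : ℝ} (hp : (x, t, ξ, τ) ∈ offPole I) :
    HasDerivAt (fun ξ => G x t ξ τ) (greenXi G (x, t, ξ, τ)) ξ :=
  hasDerivAt_comp_dirDeriv hG.contDiffOn_green (isOpen_offPole hI) (hasDerivAt_lineXi x t τ ξ) hp

/-- `k`-th derivatives in `x` of a smooth function on `ℝ⁴`. -/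
theorem iteratedDeriv_lineX {f : ℝ × ℝ × ℝ × ℝ → ℝ} {Ω : Set (ℝ × ℝ × ℝ × ℝ)}
    (hf : ContDiffOn ℝ ∞ f Ω) (hΩ : IsOpen Ω) {x t ξ τ : ℝ} (hp : (x, t, ξ, τ) ∈ Ω) (k : ℕ) :
    iteratedDeriv k (fun x => f (x, t, ξ, τ)) x = (dirDeriv dirX)^[k] f (x, t, ξ, τ) := by
  refine iteratedDeriv_eq_of_hasDerivAt
    (J := fun k x => (dirDeriv dirX)^[k] f (x, t, ξ, τ)) (U := {x | (x, t, ξ, τ) ∈ Ω})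
    (hΩ.preimage (by fun_prop)) ?_ k x hp
  intro k x hx
  rw [Function.iterate_succ_apply']
  exact hasDerivAt_comp_dirDeriv (hf.dirDeriv_iterate hΩ dirX k) hΩ (hasDerivAt_lineX t ξ τ x) hx

theorem dirDeriv_iterate_eventuallyEq_zero {E : Type*} [NormedAddCommGroup E] [NormedSpace ℝ E]
    {f : E → ℝ} {p : E} (h : f =ᶠ[𝓝 p] fun _ => 0) (v : E) (k : ℕ) :
    (dirDeriv v)^[k] f =ᶠ[𝓝 p] fun _ => 0 := by
  induction k with
  | zero => exact h
  | succ k ih =>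
    rw [Function.iterate_succ_apply']
    filter_upwards [ih.eventually_nhds] with q hq
    rw [Filter.EventuallyEq.dirDeriv_eq hq, dirDeriv]
    simp

theorem IsGreenFunction.green_eventuallyEq_zero (hG : IsGreenFunction I m c G) (hI : IsOpen I)
    {p : ℝ × ℝ × ℝ × ℝ} (hp : p ∈ offPole I) (ht : p.2.1 < p.2.2.2) :
    green G =ᶠ[𝓝 p] fun _ => 0 := by
  have h1 : IsOpen {p : ℝ × ℝ × ℝ × ℝ | p.2.1 < p.2.2.2} := isOpen_lt (by fun_prop) (by fun_prop)
  filter_upwards [(isOpen_offPole hI).mem_nhds hp, h1.mem_nhds ht] with q hq1 hq2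
  exact hG.causal _ hq1.1 _ hq1.2.1 _ _ hq2

theorem IsGreenFunction.greenXi_eq_zero (hG : IsGreenFunction I m c G) (hI : IsOpen I)
    {p : ℝ × ℝ × ℝ × ℝ} (hp : p ∈ offPole I) (ht : p.2.1 < p.2.2.2) : greenXi G p = 0 := by
  rw [greenXi, (hG.green_eventuallyEq_zero hI hp ht).dirDeriv_eq, dirDeriv]
  simp

theorem IsGreenFunction.dirDeriv_dirT_green (hG : IsGreenFunction I m c G) (hI : IsOpen I)
    {p : ℝ × ℝ × ℝ × ℝ} (hp : p ∈ offPole I) (ht : p.2.1 ≠ p.2.2.2) :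
    dirDeriv dirT (green G) p =
      ∑ k ∈ Finset.range (m + 1), c k p.1 * (dirDeriv dirX)^[k] (green G) p := by
  obtain ⟨x, t, ξ, τ⟩ := p
  rcases lt_or_gt_of_ne ht with h | h
  · have h0 := hG.green_eventuallyEq_zero hI hp h
    have h1 : dirDeriv dirT (green G) (x, t, ξ, τ) = 0 :=
      (dirDeriv_iterate_eventuallyEq_zero h0 dirT 1).eq_of_nhds
    rw [h1, Finset.sum_eq_zero]
    intro k _
    rw [(dirDeriv_iterate_eventuallyEq_zero h0 dirX k).eq_of_nhds, mul_zero]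
  · have h1 := hG.pde x hp.1 ξ hp.2.1 t τ h
    have h2 : HasDerivAt (fun t' => G x t' ξ τ) (dirDeriv dirT (green G) (x, t, ξ, τ)) t :=
      hasDerivAt_comp_dirDeriv hG.contDiffOn_green (isOpen_offPole hI) (hasDerivAt_lineT x ξ τ t) hp
    rw [h2.deriv] at h1
    rw [h1, diffOp]
    refine Finset.sum_congr rfl fun k _ => ?_
    congr 1
    exact iteratedDeriv_lineX hG.contDiffOn_green (isOpen_offPole hI) hp k

/-- `∂G/∂ξ` solves the same equation, because the coefficients depend on `x` only. -/
theorem IsGreenFunction.dirDeriv_dirT_greenXi (hG : IsGreenFunction I m c G) (hI : IsOpen I)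
    {p : ℝ × ℝ × ℝ × ℝ} (hp : p ∈ offPole I) (ht : p.2.1 ≠ p.2.2.2) :
    dirDeriv dirT (greenXi G) p =
      ∑ k ∈ Finset.range (m + 1), c k p.1 * (dirDeriv dirX)^[k] (greenXi G) p := by
  have hΩ := isOpen_offPole hI
  have hg := hG.contDiffOn_green
  obtain ⟨x, t, ξ, τ⟩ := p
  have e : ∀ {f : ℝ × ℝ × ℝ × ℝ → ℝ}, ContDiffOn ℝ ∞ f (offPole I) →
      HasDerivAt (fun ξ => f (x, t, ξ, τ)) (dirDeriv dirXi f (x, t, ξ, τ)) ξ :=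
    fun hf => hasDerivAt_comp_dirDeriv hf hΩ (hasDerivAt_lineXi x t τ ξ) hp
  have h1 := e (hg.dirDeriv hΩ dirT)
  have h2 := HasDerivAt.fun_sum fun k (_ : k ∈ Finset.range (m + 1)) =>
    (e (hg.dirDeriv_iterate hΩ dirX k)).const_mul (c k x)
  have h3 : (fun ξ => dirDeriv dirT (green G) (x, t, ξ, τ)) =ᶠ[𝓝 ξ] fun ξ =>
      ∑ k ∈ Finset.range (m + 1), c k x * (dirDeriv dirX)^[k] (green G) (x, t, ξ, τ) := by
    have hc : ContinuousAt (fun ξ : ℝ => (x, t, ξ, τ)) ξ := by fun_prop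
    filter_upwards [hc (hΩ.mem_nhds hp)] with z hz
    exact hG.dirDeriv_dirT_green hI hz ht
  have h4 := h1.unique (h2.congr_of_eventuallyEq h3)
  rw [greenXi, dirDeriv_comm hg hΩ dirT dirXi hp, h4]
  refine Finset.sum_congr rfl fun k _ => ?_
  rw [dirDeriv_iterate_comm hg hΩ dirXi dirX k hp]

/-! ### The potential solves the homogeneous problem -/

variable {y Ψ : ℝ → ℝ}

theorem mem_offPole_of_lt (hIup : IsUpperSet I) (hyI : ∀ t ≥ 0, y t ∈ I) {x t τ : ℝ}
    (ht : 0 ≤ t) (hτ : 0 ≤ τ) (hx : y t < x) : (x, t, y τ, τ) ∈ offPole I := by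
  refine ⟨hIup hx.le (hyI t ht), hyI τ hτ, ?_⟩
  rintro ⟨h1, h2⟩
  simp only at h1 h2
  subst h2
  exact hx.ne' h1

theorem line_add_curve (x t ξ τ : ℝ) :
    ((x, t, 0, 0) : ℝ × ℝ × ℝ × ℝ) + (0, 0, ξ, τ) = (x, t, ξ, τ) := by simp

theorem continuousOn_curve (hy : ContinuousOn y (Ici 0)) (T : ℝ) :
    ContinuousOn (fun τ => ((0, 0, y τ, τ) : ℝ × ℝ × ℝ × ℝ)) (Icc 0 T) :=
  continuousOn_const.prodMk (continuousOn_const.prodMk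
    ((hy.mono Icc_subset_Ici_self).prodMk continuousOn_id))

/-- Since `G` vanishes before the pole, the upper limit of integration in the potential may be
replaced by any later time. -/
theorem IsGreenFunction.potential_eq (hG : IsGreenFunction I m c G) (hI : IsOpen I)
    (hIup : IsUpperSet I) (hy : ContinuousOn y (Ici 0)) (hyI : ∀ t ≥ 0, y t ∈ I)
    (hΨ : ContinuousOn Ψ (Ici 0)) {x t T : ℝ} (ht : 0 ≤ t) (hT : t ≤ T) (hx : y t < x) :
    potential G y Ψ x t =
      ∫ τ in (0 : ℝ)..T, Ψ τ * greenXi G ((x, t, 0, 0) + (0, 0, y τ, τ)) := by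
  have hcont : ContinuousOn (fun τ => Ψ τ * greenXi G ((x, t, 0, 0) + (0, 0, y τ, τ)))
      (Icc 0 T) :=
    continuousOn_mul_translate (hG.contDiffOn_greenXi hI).continuousOn (continuousOn_curve hy T)
      (hΨ.mono Icc_subset_Ici_self) (fun τ hτ => by
        rw [line_add_curve]; exact mem_offPole_of_lt hIup hyI ht hτ.1 hx)
  have h0T : 0 ≤ T := ht.trans hT
  have hint : ∀ a ∈ Icc 0 T, ∀ b ∈ Icc 0 T, IntervalIntegrable
      (fun τ => Ψ τ * greenXi G ((x, t, 0, 0) + (0, 0, y τ, τ))) volume a b := fun a ha b hb =>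
    (hcont.mono (uIcc_subset_Icc ha hb)).intervalIntegrable
  have hz : ∫ τ in t..T, Ψ τ * greenXi G ((x, t, 0, 0) + (0, 0, y τ, τ)) = 0 := by
    refine intervalIntegral.integral_zero_ae (Eventually.of_forall fun τ hτ => ?_)
    rw [uIoc_of_le hT] at hτ
    rw [line_add_curve, hG.greenXi_eq_zero hI
      (mem_offPole_of_lt hIup hyI ht (ht.trans hτ.1.le) hx) hτ.1, mul_zero]
  rw [← intervalIntegral.integral_add_adjacent_intervals (hint 0 ⟨le_rfl, h0T⟩ t ⟨ht, hT⟩)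
    (hint t ⟨ht, hT⟩ T ⟨h0T, le_rfl⟩), hz, add_zero, potential]
  refine intervalIntegral.integral_congr fun τ hτ => ?_
  rw [uIcc_of_le ht] at hτ
  simp only [potentialIntegrand]
  rw [line_add_curve,
    (hG.hasDerivAt_xi hI (mem_offPole_of_lt hIup hyI ht hτ.1 hx)).deriv]

theorem IsGreenFunction.continuousOn_potentialIntegrand (hG : IsGreenFunction I m c G)
    (hI : IsOpen I) (hIup : IsUpperSet I) (hy : ContinuousOn y (Ici 0)) (hyI : ∀ t ≥ 0, y t ∈ I)
    (hΨ : ContinuousOn Ψ (Ici 0)) {x t : ℝ} (ht : 0 ≤ t) (hx : y t < x) :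
    ContinuousOn (potentialIntegrand G y Ψ x t) (Icc 0 t) := by
  have hcont : ContinuousOn (fun τ => Ψ τ * greenXi G ((x, t, 0, 0) + (0, 0, y τ, τ)))
      (Icc 0 t) :=
    continuousOn_mul_translate (hG.contDiffOn_greenXi hI).continuousOn (continuousOn_curve hy t)
      (hΨ.mono Icc_subset_Ici_self) (fun τ hτ => by
        rw [line_add_curve]; exact mem_offPole_of_lt hIup hyI ht hτ.1 hx)
  refine hcont.congr fun τ hτ => ?_
  simp only [potentialIntegrand]
  rw [line_add_curve,
    (hG.hasDerivAt_xi hI (mem_offPole_of_lt hIup hyI ht hτ.1 hx)).deriv]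

theorem IsGreenFunction.tendsto_potential_atTop (hG : IsGreenFunction I m c G) (hI : IsOpen I)
    (hIup : IsUpperSet I) (hy : ContinuousOn y (Ici 0)) (hyI : ∀ t ≥ 0, y t ∈ I)
    (hΨ : ContinuousOn Ψ (Ici 0)) {t : ℝ} (ht : 0 < t) :
    Tendsto (fun x => potential G y Ψ x t) atTop (𝓝 0) := by
  have hγ : ContinuousOn (fun τ => (t, y τ, τ)) (Icc 0 t) :=
    continuousOn_const.prodMk ((hy.mono Icc_subset_Ici_self).prodMk continuousOn_id)
  have hK := hG.vanish ((fun τ => (t, y τ, τ)) '' Icc 0 t) (isCompact_Icc.image_of_continuousOn hγ)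
    (by rintro _ ⟨τ, hτ, rfl⟩; exact hyI τ hτ.1)
  obtain ⟨D, hD⟩ := isCompact_Icc.exists_bound_of_continuousOn
    (hΨ.mono (Icc_subset_Ici_self : Icc 0 t ⊆ Ici 0))
  have hsub : uIoc 0 t ⊆ Icc 0 t := by rw [uIoc_of_le ht.le]; exact Ioc_subset_Icc_self
  have hlim := intervalIntegral.tendsto_integral_filter_of_dominated_convergence
    (μ := volume) (a := 0) (b := t) (l := atTop) (F := fun x => potentialIntegrand G y Ψ x t)
    (f := fun _ => 0) (fun _ => D * 1) ?_ ?_ intervalIntegrable_const ?_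
  · simpa [potential] using hlim
  · filter_upwards [eventually_gt_atTop (y t)] with x hx
    exact ((hG.continuousOn_potentialIntegrand hI hIup hy hyI hΨ ht.le hx).mono
      hsub).aestronglyMeasurable measurableSet_uIoc
  · have h1 := Metric.tendstoUniformlyOn_iff.1 hK.2 1 one_pos
    filter_upwards [h1] with x hx
    refine Eventually.of_forall fun τ hτ => ?_
    have h2 := hx _ (mem_image_of_mem _ (hsub hτ))
    simp only [Pi.zero_apply, dist_zero_left] at h2
    have h3 := hD τ (hsub hτ)
    rw [potentialIntegrand, norm_mul]
    exact mul_le_mul h3 h2.le (norm_nonneg _) ((norm_nonneg _).trans h3)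
  · refine Eventually.of_forall fun τ hτ => ?_
    have h1 := (hK.2.tendsto_at (mem_image_of_mem _ (hsub hτ))).const_mul (Ψ τ)
    simpa [potentialIntegrand] using h1

/-- Differentiation under the integral sign, where the extended upper limit of integration removes
the boundary term from the time derivative. -/
theorem IsGreenFunction.solvesHomogeneousProblem (hG : IsGreenFunction I m c G) (hI : IsOpen I)
    (hIup : IsUpperSet I) (hy : ContinuousOn y (Ici 0)) (hyI : ∀ t ≥ 0, y t ∈ I)
    (hΨ : ContinuousOn Ψ (Ici 0)) :
    SolvesHomogeneousProblem m c y (potential G y Ψ) := by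
  have hΩ := isOpen_offPole hI
  have hg := hG.contDiffOn_greenXi hI
  have hγ := continuousOn_curve hy
  have hΨ' : ∀ T, ContinuousOn Ψ (Icc 0 T) := fun T => hΨ.mono Icc_subset_Ici_self
  have hmem : ∀ {x t : ℝ}, 0 ≤ t → y t < x → ∀ T, ∀ τ ∈ Icc (0 : ℝ) T,
      ((x, t, 0, 0) : ℝ × ℝ × ℝ × ℝ) + (0, 0, y τ, τ) ∈ offPole I := fun ht hx T τ hτ => by
    rw [line_add_curve]; exact mem_offPole_of_lt hIup hyI ht hτ.1 hx
  -- the `x`-derivatives of the potential at time `t`, with the integral extended to time `t + 1`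
  let J : ℝ → ℕ → ℝ → ℝ := fun t k x => ∫ τ in (0 : ℝ)..(t + 1),
    Ψ τ * (dirDeriv dirX)^[k] (greenXi G) ((x, t, 0, 0) + (0, 0, y τ, τ))
  have hJ : ∀ t, 0 ≤ t → ∀ k, ∀ x ∈ Ioi (y t), HasDerivAt (J t k) (J t (k + 1) x) x := by
    intro t ht k x hx
    simp only [J, Function.iterate_succ_apply']
    exact hasDerivAt_integral_translate (by linarith) (hg.dirDeriv_iterate hΩ dirX k) hΩ
      (hγ _) (hΨ' _) (hasDerivAt_lineX t 0 0) (hmem ht hx _)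
  have hVJ : ∀ t, 0 ≤ t → ∀ x > y t, potential G y Ψ x t = J t 0 x := fun t ht x hx =>
    hG.potential_eq hI hIup hy hyI hΨ ht (by linarith) hx
  have hev : ∀ t, 0 ≤ t → ∀ x > y t, (fun x' => potential G y Ψ x' t) =ᶠ[𝓝 x] J t 0 := by
    intro t ht x hx
    filter_upwards [isOpen_Ioi.mem_nhds hx] with z hz using hVJ t ht z hz
  refine ⟨?_, ?_, ?_, ?_, ?_⟩
  · rintro ⟨x, t⟩ ⟨ht, hx⟩
    simp only at ht hx
    have hc := continuousAt_integral_translate (by linarith) hg.continuousOn hΩ (hγ (t + 1))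
      (hΨ' _) (hmem ht hx _)
    have hc' : ContinuousAt (fun p : ℝ × ℝ => ∫ τ in (0 : ℝ)..(t + 1),
        Ψ τ * greenXi G ((p.1, p.2, 0, 0) + (0, 0, y τ, τ))) (x, t) :=
      ContinuousAt.comp (f := fun p : ℝ × ℝ => ((p.1, p.2, 0, 0) : ℝ × ℝ × ℝ × ℝ))
        (x := (x, t)) hc (by fun_prop)
    refine hc'.continuousWithinAt.congr_of_eventuallyEq_of_mem ?_ ⟨ht, hx⟩
    have h1 : ∀ᶠ p : ℝ × ℝ in 𝓝 (x, t), p.2 < t + 1 :=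
      (isOpen_lt continuous_snd continuous_const).mem_nhds (by simp)
    filter_upwards [self_mem_nhdsWithin, nhdsWithin_le_nhds h1] with p hp hp'
    exact hG.potential_eq hI hIup hy hyI hΨ hp.1 hp'.le hp.2
  · intro t ht x hx
    have h := (contDiffOn_of_hasDerivAt_chain isOpen_Ioi (hJ t (le_of_lt ht)) m).contDiffAt
      (isOpen_Ioi.mem_nhds hx)
    exact h.congr_of_eventuallyEq (hev t (le_of_lt ht) x hx)
  · intro t ht x hx
    have ht0 : 0 ≤ t := le_of_lt ht
    have hd := hasDerivAt_integral_translate (a := 0) (b := t + 1) (by linarith) hg hΩ (hγ _)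
      (hΨ' _) (hasDerivAt_lineT x 0 0) (hmem ht0 hx (t + 1))
    have hev' : (fun t' => potential G y Ψ x t') =ᶠ[𝓝 t] fun t' => ∫ τ in (0 : ℝ)..(t + 1),
        Ψ τ * greenXi G ((x, t', 0, 0) + (0, 0, y τ, τ)) := by
      have hyt : ContinuousAt y t := hy.continuousAt (Ici_mem_nhds ht)
      filter_upwards [hyt.eventually_lt continuousAt_const hx, Ioi_mem_nhds ht,
        Iio_mem_nhds (show t < t + 1 by linarith)] with t' h1 h2 h3
      exact hG.potential_eq hI hIup hy hyI hΨ (le_of_lt h2) (le_of_lt h3) h1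
    have hd' := hd.congr_of_eventuallyEq hev'
    refine hd'.congr_deriv (Eq.symm ?_)
    rw [diffOp]
    have hk : ∀ k, iteratedDeriv k (fun x' => potential G y Ψ x' t) x = J t k x := fun k => by
      rw [(hev t ht0 x hx).iteratedDeriv_eq k]
      exact iteratedDeriv_eq_of_hasDerivAt isOpen_Ioi (hJ t ht0) k x hx
    have hsum : ∑ k ∈ Finset.range (m + 1), c k x * J t k x = ∫ τ in (0 : ℝ)..(t + 1),
        ∑ k ∈ Finset.range (m + 1), c k x *
          (Ψ τ * (dirDeriv dirX)^[k] (greenXi G) ((x, t, 0, 0) + (0, 0, y τ, τ))) := by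
      rw [intervalIntegral.integral_finsetSum]
      · exact Finset.sum_congr rfl fun k _ => (intervalIntegral.integral_const_mul _ _).symm
      · intro k _
        refine IntervalIntegrable.const_mul
          (ContinuousOn.intervalIntegrable_of_Icc (by linarith) ?_) _
        exact continuousOn_mul_translate (hg.dirDeriv_iterate hΩ dirX k).continuousOn (hγ _)
          (hΨ' _) (hmem ht0 hx _)
    simp only [hk]
    rw [hsum]
    -- the equation for `∂G/∂ξ` is available except at the single time `τ = t`
    refine intervalIntegral.integral_congr_ae ?_
    filter_upwards [compl_mem_ae_iff.2 (measure_singleton t)] with τ hτt hτ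
    have hτt' : t ≠ τ := fun h => hτt h.symm
    rw [uIoc_of_le (by linarith)] at hτ
    rw [line_add_curve, hG.dirDeriv_dirT_greenXi hI
      (mem_offPole_of_lt hIup hyI ht0 hτ.1.le hx) hτt', Finset.mul_sum]
    exact Finset.sum_congr rfl fun k _ => by ring
  · intro x _
    simp [potential]
  · intro t ht
    exact hG.tendsto_potential_atTop hI hIup hy hyI hΨ ht

end Green

/-! ### The parabolic maximum principle with a source singular at the initial time -/

section MaximumPrinciple

theorem IsLocalMax.second_deriv_nonpos {f f' : ℝ → ℝ} {f'' x : ℝ} (h : IsLocalMax f x)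
    (hf : ∀ᶠ z in 𝓝 x, HasDerivAt f (f' z) z) (hf' : HasDerivAt f' f'' x) : f'' ≤ 0 := by
  by_contra! hpos
  have hx : deriv f x = 0 := h.deriv_eq_zero
  have he : deriv f =ᶠ[𝓝 x] f' := hf.mono fun z hz => hz.deriv
  have hdd : deriv (deriv f) x = f'' := by rw [he.deriv_eq, hf'.deriv]
  have hmin : IsLocalMin f x :=
    isLocalMin_of_deriv_deriv_pos (by rw [hdd]; exact hpos) hx hf.self_of_nhds.continuousAt
  have hconst : f =ᶠ[𝓝 x] fun _ => f x := by
    filter_upwards [h, hmin] with z h1 h2 using le_antisymm h1 h2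
  have hzero : deriv f =ᶠ[𝓝 x] fun _ => 0 := by
    filter_upwards [hconst.eventually_nhds] with z hz
    rw [Filter.EventuallyEq.deriv_eq hz, deriv_const]
  rw [hzero.deriv_eq, deriv_const] at hdd
  exact hpos.ne hdd

theorem HasDerivAt.nonneg_of_left_max {f : ℝ → ℝ} {f' t τ : ℝ} (hf : HasDerivAt f f' t)
    (hτ : τ < t) (hmax : ∀ s ∈ Ioo τ t, f s ≤ f t) : 0 ≤ f' := by
  have h1 := (hasDerivWithinAt_iff_tendsto_slope' (self_notMem_Iio)).1
    (hf.hasDerivWithinAt (s := Iio t))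
  refine ge_of_tendsto h1 ?_
  filter_upwards [Ioo_mem_nhdsLT hτ] with s hs
  rw [slope_def_field]
  exact div_nonneg_of_nonpos (by linarith [hmax s hs]) (by linarith [hs.2])

/-- One-sided estimate: a subsolution with zero initial values, lateral values at most `M` and
source at most `K / √(t - τ)` is at most `exp (Λ (t - τ)) (M + 2 K √(t - τ))`. -/
theorem parabolic_le_of_lateral_le {a c₁ c₀ : ℝ → ℝ} {u ux uxx F : ℝ → ℝ → ℝ}
    {xl xr τ T M K Λ : ℝ} (ha : ∀ x ∈ Ioo xl xr, 0 ≤ a x) (hc : ∀ x ∈ Ioo xl xr, c₀ x ≤ Λ)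
    (hM : 0 ≤ M) (hK : 0 ≤ K) (hΛ : 0 ≤ Λ)
    (hcont : ContinuousOn (fun p : ℝ × ℝ => u p.1 p.2) (Icc xl xr ×ˢ Ioc τ T))
    (hinit : ∀ x ∈ Icc xl xr,
      Tendsto (fun p : ℝ × ℝ => u p.1 p.2) (𝓝[Icc xl xr] x ×ˢ 𝓝[>] τ) (𝓝 0))
    (hlat : ∀ t ∈ Ioc τ T, u xl t ≤ M ∧ u xr t ≤ M)
    (hux : ∀ t ∈ Ioc τ T, ∀ x ∈ Ioo xl xr, HasDerivAt (fun x => u x t) (ux x t) x)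
    (huxx : ∀ t ∈ Ioc τ T, ∀ x ∈ Ioo xl xr, HasDerivAt (fun x => ux x t) (uxx x t) x)
    (hut : ∀ t ∈ Ioc τ T, ∀ x ∈ Ioo xl xr, HasDerivAt (fun t => u x t)
      (a x * uxx x t + c₁ x * ux x t + c₀ x * u x t + F x t) t)
    (hF : ∀ t ∈ Ioc τ T, ∀ x ∈ Ioo xl xr, F x t ≤ K / √(t - τ)) :
    ∀ t ∈ Ioc τ T, ∀ x ∈ Icc xl xr,
      u x t ≤ Real.exp (Λ * (t - τ)) * (M + 2 * K * √(t - τ)) := by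
  have key : ∀ ε > 0, ∀ t ∈ Ioc τ T, ∀ x ∈ Icc xl xr,
      Real.exp (-(Λ * (t - τ))) * u x t - (M + 2 * K * √(t - τ) + ε * (1 + (t - τ))) < 0 := by
    intro ε hε t₂ ht₂ x₂ hx₂
    by_contra! hneg
    let U : ℝ × ℝ → ℝ := fun p => if τ < p.2 then u p.1 p.2 else 0
    have hUc : ContinuousOn U (Icc xl xr ×ˢ Icc τ T) := by
      rintro ⟨x, t⟩ ⟨hx, ht⟩
      simp only at hx ht
      rcases eq_or_lt_of_le ht.1 with h | h
      · subst h
        have hU0 : U (x, τ) = 0 := by simp [U]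
        rw [ContinuousWithinAt, hU0, nhdsWithin_prod_eq, ← Ioc_insert_left ht.2, insert_eq,
          nhdsWithin_union, nhdsWithin_singleton, sup_comm, Filter.prod_sup, tendsto_sup]
        constructor
        · have h1 : Tendsto (fun p : ℝ × ℝ => u p.1 p.2) (𝓝[Icc xl xr] x ×ˢ 𝓝[Ioc τ T] τ) (𝓝 0) :=
            (hinit x hx).mono_left (Filter.prod_mono le_rfl (nhdsWithin_mono _ Ioc_subset_Ioi_self))
          refine h1.congr' ?_
          have : ∀ᶠ p in 𝓝[Icc xl xr] x ×ˢ 𝓝[Ioc τ T] τ, p.2 ∈ Ioc τ T :=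
            tendsto_snd.eventually (eventually_mem_nhdsWithin)
          filter_upwards [this] with p hp
          simp [U, hp.1]
        · refine tendsto_const_nhds.congr' ?_
          have : ∀ᶠ p : ℝ × ℝ in 𝓝[Icc xl xr] x ×ˢ pure τ, p.2 = τ :=
            tendsto_snd.eventually (by simp : ∀ᶠ z in pure τ, z = τ)
          filter_upwards [this] with p hp
          simp [U, hp]
      · have h1 : ContinuousWithinAt U (Icc xl xr ×ˢ Ioc τ T) (x, t) :=
          (hcont (x, t) ⟨hx, h, ht.2⟩).congr (fun p hp => by simp [U, hp.2.1]) (by simp [U, h])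
        refine h1.mono_of_mem_nhdsWithin ?_
        have h2 : {p : ℝ × ℝ | τ < p.2} ∈ 𝓝 (x, t) :=
          (isOpen_lt continuous_const continuous_snd).mem_nhds h
        filter_upwards [self_mem_nhdsWithin, nhdsWithin_le_nhds h2] with p hp hp2
        exact ⟨hp.1, hp2, hp.2.2⟩
    let w : ℝ × ℝ → ℝ := fun p => Real.exp (-(Λ * (p.2 - τ))) * U p -
      (M + 2 * K * √(p.2 - τ) + ε * (1 + (p.2 - τ)))
    have hwc : ContinuousOn w (Icc xl xr ×ˢ Icc τ T) :=
      ((by fun_prop : Continuous fun p : ℝ × ℝ => Real.exp (-(Λ * (p.2 - τ)))).continuousOn.mul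
        hUc).sub (by fun_prop)
    have hw : ∀ x t, τ < t → w (x, t) = Real.exp (-(Λ * (t - τ))) * u x t -
        (M + 2 * K * √(t - τ) + ε * (1 + (t - τ))) := fun x t ht => by simp [w, U, ht]
    obtain ⟨⟨x₁, t₁⟩, ⟨hx₁, ht₁⟩, hmax⟩ := (isCompact_Icc.prod isCompact_Icc).exists_isMaxOn
      ⟨(x₂, t₂), hx₂, ht₂.1.le, ht₂.2⟩ hwc
    simp only at hx₁ ht₁
    have hw1 : 0 ≤ w (x₁, t₁) :=
      hneg.trans ((hw x₂ t₂ ht₂.1).symm.le.trans (hmax ⟨hx₂, ht₂.1.le, ht₂.2⟩))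
    -- the maximum is not attained at the initial time
    have hτ₁ : τ < t₁ := by
      rcases eq_or_lt_of_le ht₁.1 with h | h
      · subst h
        simp [w, U] at hw1
        linarith
      · exact h
    have ht₁' : t₁ ∈ Ioc τ T := ⟨hτ₁, ht₁.2⟩
    have hs : 0 < t₁ - τ := by linarith
    rw [hw _ _ hτ₁] at hw1
    have hE : 0 < Real.exp (-(Λ * (t₁ - τ))) := Real.exp_pos _
    have hE1 : Real.exp (-(Λ * (t₁ - τ))) ≤ 1 :=
      Real.exp_le_one_iff.2 (neg_nonpos.2 (mul_nonneg hΛ hs.le))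
    have hKs : 0 ≤ 2 * K * √(t₁ - τ) := by positivity
    have hεs : 0 < ε * (1 + (t₁ - τ)) := by positivity
    have hu0 : 0 < u x₁ t₁ := pos_of_mul_pos_right (by linarith :
      0 < Real.exp (-(Λ * (t₁ - τ))) * u x₁ t₁) hE.le
    have huM : M < u x₁ t₁ := by nlinarith
    -- nor on the lateral boundary
    have hx₁' : x₁ ∈ Ioo xl xr := by
      refine ⟨lt_of_le_of_ne hx₁.1 ?_, lt_of_le_of_ne hx₁.2 ?_⟩
      · rintro rfl; linarith [(hlat t₁ ht₁').1]
      · rintro rfl; linarith [(hlat t₁ ht₁').2]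
    have hxmax : IsLocalMax (fun x => u x t₁) x₁ := by
      filter_upwards [Ioo_mem_nhds hx₁'.1 hx₁'.2] with x hx
      have h := hmax (a := (x, t₁)) ⟨Ioo_subset_Icc_self hx, ht₁⟩
      simp only [mem_ofPred_eq] at h
      rw [hw _ _ hτ₁, hw _ _ hτ₁] at h
      exact le_of_mul_le_mul_left (by linarith) hE
    have h1 : ux x₁ t₁ = 0 := hxmax.hasDerivAt_eq_zero (hux t₁ ht₁' x₁ hx₁')
    have h2 : uxx x₁ t₁ ≤ 0 := by
      refine hxmax.second_deriv_nonpos (f' := fun x => ux x t₁) ?_ (huxx t₁ ht₁' x₁ hx₁')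
      filter_upwards [Ioo_mem_nhds hx₁'.1 hx₁'.2] with x hx using hux t₁ ht₁' x hx
    have hsub : HasDerivAt (fun t => t - τ) 1 t₁ := (hasDerivAt_id t₁).sub_const τ
    have hexp : HasDerivAt (fun t => Real.exp (-(Λ * (t - τ))))
        (Real.exp (-(Λ * (t₁ - τ))) * -(Λ * 1)) t₁ := ((hsub.const_mul Λ).neg).exp
    have hsq : HasDerivAt (fun t => √(t - τ)) (1 / (2 * √(t₁ - τ))) t₁ := hsub.sqrt hs.ne'
    have hd := (hexp.mul (hut t₁ ht₁' x₁ hx₁')).sub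
      (((hsq.const_mul (2 * K)).const_add M).add ((hsub.const_add 1).const_mul ε))
    have h3 := hd.nonneg_of_left_max hτ₁ (fun s hs => by
      have h := hmax (a := (x₁, s)) ⟨hx₁, hs.1.le, hs.2.le.trans ht₁.2⟩
      simp only [mem_ofPred_eq] at h
      rw [hw _ _ hτ₁, hw _ _ hs.1] at h
      exact h)
    have hFE : Real.exp (-(Λ * (t₁ - τ))) * F x₁ t₁ ≤ K / √(t₁ - τ) :=
      (mul_le_mul_of_nonneg_left (hF t₁ ht₁' x₁ hx₁') hE.le).trans
        (mul_le_of_le_one_left (by positivity) hE1)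
    have h4 : Real.exp (-(Λ * (t₁ - τ))) * (a x₁ * uxx x₁ t₁) ≤ 0 :=
      mul_nonpos_of_nonneg_of_nonpos hE.le (mul_nonpos_of_nonneg_of_nonpos (ha x₁ hx₁') h2)
    have h5 : Real.exp (-(Λ * (t₁ - τ))) * ((c₀ x₁ - Λ) * u x₁ t₁) ≤ 0 :=
      mul_nonpos_of_nonneg_of_nonpos hE.le
        (mul_nonpos_of_nonpos_of_nonneg (by linarith [hc x₁ hx₁']) hu0.le)
    have h6 : 2 * K * (1 / (2 * √(t₁ - τ))) = K / √(t₁ - τ) := by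
      have := (Real.sqrt_pos.2 hs).ne'
      field_simp
    rw [h1, h6] at h3
    linarith
  intro t ht x hx
  have hs : 0 < t - τ := by linarith [ht.1]
  have hle : Real.exp (-(Λ * (t - τ))) * u x t ≤ M + 2 * K * √(t - τ) := by
    refine le_of_forall_pos_le_add fun ε hε => ?_
    have h := key (ε / (1 + (t - τ))) (by positivity) t ht x hx
    rw [div_mul_cancel₀ _ (by positivity)] at h
    linarith
  have hE := Real.exp_pos (Λ * (t - τ))
  rw [Real.exp_neg] at hle
  rwa [inv_mul_le_iff₀ hE] at hle

/-- Two-sided estimate for a solution with zero initial values. -/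
theorem abs_le_of_parabolic {a c₁ c₀ : ℝ → ℝ} {u ux uxx F : ℝ → ℝ → ℝ}
    {xl xr τ T M K Λ : ℝ} (ha : ∀ x ∈ Ioo xl xr, 0 ≤ a x) (hc : ∀ x ∈ Ioo xl xr, c₀ x ≤ Λ)
    (hM : 0 ≤ M) (hK : 0 ≤ K) (hΛ : 0 ≤ Λ)
    (hcont : ContinuousOn (fun p : ℝ × ℝ => u p.1 p.2) (Icc xl xr ×ˢ Ioc τ T))
    (hinit : ∀ x ∈ Icc xl xr,
      Tendsto (fun p : ℝ × ℝ => u p.1 p.2) (𝓝[Icc xl xr] x ×ˢ 𝓝[>] τ) (𝓝 0))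
    (hlat : ∀ t ∈ Ioc τ T, |u xl t| ≤ M ∧ |u xr t| ≤ M)
    (hux : ∀ t ∈ Ioc τ T, ∀ x ∈ Ioo xl xr, HasDerivAt (fun x => u x t) (ux x t) x)
    (huxx : ∀ t ∈ Ioc τ T, ∀ x ∈ Ioo xl xr, HasDerivAt (fun x => ux x t) (uxx x t) x)
    (hut : ∀ t ∈ Ioc τ T, ∀ x ∈ Ioo xl xr, HasDerivAt (fun t => u x t)
      (a x * uxx x t + c₁ x * ux x t + c₀ x * u x t + F x t) t)
    (hF : ∀ t ∈ Ioc τ T, ∀ x ∈ Ioo xl xr, |F x t| ≤ K / √(t - τ)) :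
    ∀ t ∈ Ioc τ T, ∀ x ∈ Icc xl xr,
      |u x t| ≤ Real.exp (Λ * (t - τ)) * (M + 2 * K * √(t - τ)) := by
  intro t ht x hx
  refine abs_le'.2 ⟨?_, ?_⟩
  · exact parabolic_le_of_lateral_le ha hc hM hK hΛ hcont hinit
      (fun t ht => ⟨(le_abs_self _).trans (hlat t ht).1, (le_abs_self _).trans (hlat t ht).2⟩)
      hux huxx hut (fun t ht x hx => (le_abs_self _).trans (hF t ht x hx)) t ht x hx
  · refine parabolic_le_of_lateral_le (u := fun x t => -u x t) (ux := fun x t => -ux x t)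
      (uxx := fun x t => -uxx x t) (F := fun x t => -F x t) (c₁ := c₁) ha hc hM hK hΛ hcont.neg
      (fun x hx => by simpa using (hinit x hx).neg)
      (fun t ht => ⟨(neg_le_abs _).trans (hlat t ht).1, (neg_le_abs _).trans (hlat t ht).2⟩)
      (fun t ht x hx => (hux t ht x hx).neg) (fun t ht x hx => (huxx t ht x hx).neg)
      (fun t ht x hx => ((hut t ht x hx).neg).congr_deriv (by ring))
      (fun t ht x hx => (neg_le_abs _).trans (hF t ht x hx)) t ht x hx

end MaximumPrinciple

/-! ### The one-dimensional heat kernel -/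

section HeatKernel

/-- The heat kernel `(4πs)^{-1/2} exp (-w² / (4s))` of `∂_s = ∂_w²`. -/
noncomputable def heatKernel (s w : ℝ) : ℝ := (√(4 * Real.pi * s))⁻¹ * Real.exp (-w ^ 2 / (4 * s))

theorem heatKernel_pos {s : ℝ} (hs : 0 < s) (w : ℝ) : 0 < heatKernel s w := by
  unfold heatKernel; positivity

theorem hasDerivAt_heatKernel (s w : ℝ) :
    HasDerivAt (heatKernel s) (heatKernel s w * (-w / (2 * s))) w := by
  have h : HasDerivAt (fun w : ℝ => -w ^ 2 / (4 * s)) (-(2 * w) / (4 * s)) w := by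
    simpa using ((hasDerivAt_pow 2 w).neg).div_const (4 * s)
  refine (h.exp.const_mul (√(4 * Real.pi * s))⁻¹).congr_deriv ?_
  rw [heatKernel, show -(2 * w) / (4 * s) = -w / (2 * s) by
    rw [show 4 * s = 2 * (2 * s) by ring, neg_div, neg_div, mul_div_mul_left _ _ two_ne_zero]]
  ring

theorem hasDerivAt_heatKernel_time {s : ℝ} (hs : 0 < s) (w : ℝ) :
    HasDerivAt (fun s => heatKernel s w)
      (heatKernel s w * (w ^ 2 / (4 * s ^ 2) - 1 / (2 * s))) s := by
  have hp : 0 < 4 * Real.pi * s := by positivity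
  have h1 : HasDerivAt (fun s : ℝ => 4 * Real.pi * s) (4 * Real.pi) s := by
    simpa using (hasDerivAt_id s).const_mul (4 * Real.pi)
  have h2 := (h1.sqrt hp.ne').inv (Real.sqrt_pos.2 hp).ne'
  have h3 : HasDerivAt (fun s : ℝ => -w ^ 2 / (4 * s)) (w ^ 2 / (4 * s ^ 2)) s := by
    have h4 : HasDerivAt (fun s : ℝ => 4 * s) 4 s := by
      simpa using (hasDerivAt_id s).const_mul 4
    refine ((hasDerivAt_const s (-w ^ 2)).div h4 (by positivity)).congr_deriv ?_
    field_simp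
    ring
  refine (h2.mul h3.exp).congr_deriv ?_
  have hq := Real.sq_sqrt hp.le
  have hq' := (Real.sqrt_pos.2 hp).ne'
  have : -(4 * Real.pi / (2 * √(4 * Real.pi * s))) / √(4 * Real.pi * s) ^ 2 =
      (√(4 * Real.pi * s))⁻¹ * (-(1 / (2 * s))) := by
    rw [hq]; field_simp
  rw [this, heatKernel, Pi.inv_apply]
  ring

theorem contDiffOn_heatKernel :
    ContDiffOn ℝ ∞ (fun q : ℝ × ℝ => heatKernel q.1 q.2) {q | 0 < q.1} := by
  unfold heatKernel
  have h1 : ContDiffOn ℝ ∞ (fun q : ℝ × ℝ => 4 * Real.pi * q.1) {q | 0 < q.1} := by fun_prop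
  refine ContDiffOn.mul ((h1.sqrt fun q hq => ?_).inv fun q hq => ?_) (ContDiffOn.exp ?_)
  · have : 0 < q.1 := hq
    positivity
  · have : 0 < q.1 := hq
    positivity
  · refine ContDiffOn.div (by fun_prop) (by fun_prop) fun q hq => ?_
    have : 0 < q.1 := hq
    positivity

theorem heatKernel_scale {s : ℝ} (hs : 0 < s) (w : ℝ) :
    heatKernel 1 (w / √s) * (1 / √s) = heatKernel s w := by
  unfold heatKernel
  rw [Real.sqrt_mul (by positivity) s, mul_one, mul_one, neg_div, div_pow, Real.sq_sqrt hs.le,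
    mul_inv, div_div, mul_comm s 4, neg_div]
  ring

/-- The Gaussian absorbs a factor `w² / s`, because `v e^{-v} ≤ 1`. -/
theorem sq_div_mul_heatKernel_le {s : ℝ} (hs : 0 < s) (w : ℝ) :
    w ^ 2 / s * heatKernel s w ≤ 4 / √s := by
  have h1 : w ^ 2 / (4 * s) * Real.exp (-w ^ 2 / (4 * s)) ≤ 1 := by
    have h := Real.add_one_le_exp (w ^ 2 / (4 * s))
    rw [neg_div, Real.exp_neg, ← div_eq_mul_inv, div_le_one (Real.exp_pos _)]
    linarith
  have h2 : (√(4 * Real.pi * s))⁻¹ ≤ 1 / √s := by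
    rw [one_div]
    refine inv_anti₀ (Real.sqrt_pos.2 hs) (Real.sqrt_le_sqrt ?_)
    nlinarith [Real.pi_gt_three]
  have e : w ^ 2 / s * heatKernel s w =
      4 * ((√(4 * Real.pi * s))⁻¹ * (w ^ 2 / (4 * s) * Real.exp (-w ^ 2 / (4 * s)))) := by
    unfold heatKernel
    field_simp
  rw [e]
  calc 4 * ((√(4 * Real.pi * s))⁻¹ * (w ^ 2 / (4 * s) * Real.exp (-w ^ 2 / (4 * s))))
      ≤ 4 * (1 / √s * 1) := by gcongr
    _ = 4 / √s := by ring

theorem heatKernel_le {s : ℝ} (hs : 0 < s) (w : ℝ) : heatKernel s w ≤ 1 / √s := by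
  have h2 : (√(4 * Real.pi * s))⁻¹ ≤ 1 / √s := by
    rw [one_div]
    refine inv_anti₀ (Real.sqrt_pos.2 hs) (Real.sqrt_le_sqrt ?_)
    nlinarith [Real.pi_gt_three]
  have h1 : Real.exp (-w ^ 2 / (4 * s)) ≤ 1 := by
    rw [Real.exp_le_one_iff, neg_div]
    have : 0 ≤ w ^ 2 / (4 * s) := by positivity
    linarith
  calc heatKernel s w ≤ 1 / √s * 1 := by unfold heatKernel; gcongr
    _ = _ := mul_one _

/-- The primitive `∫₀ʷ (4π)^{-1/2} e^{-v²/4} dv` of the heat kernel at time `1`. -/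
noncomputable def heatPrimitive (w : ℝ) : ℝ := ∫ v in (0 : ℝ)..w, heatKernel 1 v

theorem continuous_heatKernel_one : Continuous (heatKernel 1) :=
  continuous_iff_continuousAt.2 fun w => (hasDerivAt_heatKernel 1 w).continuousAt

theorem hasDerivAt_heatPrimitive (w : ℝ) : HasDerivAt heatPrimitive (heatKernel 1 w) w :=
  (continuous_heatKernel_one.integral_hasStrictDerivAt 0 w).hasDerivAt

theorem heatKernel_one_eq (v : ℝ) :
    heatKernel 1 v = (√(4 * Real.pi))⁻¹ * Real.exp (-(1 / 4) * v ^ 2) := by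
  rw [heatKernel, mul_one, mul_one]
  congr 2
  ring

theorem integrable_heatKernel_one : Integrable (heatKernel 1) := by
  have : heatKernel 1 = fun v => (√(4 * Real.pi))⁻¹ * Real.exp (-(1 / 4) * v ^ 2) :=
    funext heatKernel_one_eq
  rw [this]
  exact (integrable_exp_neg_mul_sq (by norm_num)).const_mul _

theorem tendsto_heatPrimitive_atTop : Tendsto heatPrimitive atTop (𝓝 (1 / 2)) := by
  have h := intervalIntegral_tendsto_integral_Ioi 0
    integrable_heatKernel_one.integrableOn tendsto_id
  have e : ∫ v in Ioi (0 : ℝ), heatKernel 1 v = 1 / 2 := by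
    simp_rw [heatKernel_one_eq]
    rw [integral_const_mul, integral_gaussian_Ioi, div_div_eq_mul_div, div_one, mul_comm Real.pi]
    have : √(4 * Real.pi) ≠ 0 := by positivity
    field_simp
  rw [e] at h
  exact h

theorem heatPrimitive_neg (w : ℝ) : heatPrimitive (-w) = -heatPrimitive w := by
  have h := intervalIntegral.integral_comp_neg (a := 0) (b := w) (heatKernel 1)
  have e : ∀ v, heatKernel 1 (-v) = heatKernel 1 v := fun v => by simp [heatKernel]
  simp only [e, neg_zero] at h
  rw [heatPrimitive, heatPrimitive, intervalIntegral.integral_symm, h]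

theorem tendsto_heatPrimitive_atBot : Tendsto heatPrimitive atBot (𝓝 (-(1 / 2))) := by
  have h := (tendsto_heatPrimitive_atTop.comp tendsto_neg_atBot_atTop).neg
  refine h.congr fun w => ?_
  simp [heatPrimitive_neg]

theorem abs_heatPrimitive_le (w : ℝ) : |heatPrimitive w| ≤ 1 / 2 := by
  have hm : Monotone heatPrimitive := monotone_of_deriv_nonneg
    (fun w => (hasDerivAt_heatPrimitive w).differentiableAt)
    (fun w => by rw [(hasDerivAt_heatPrimitive w).deriv]; exact (heatKernel_pos one_pos w).le)
  exact abs_le.2 ⟨hm.le_of_tendsto tendsto_heatPrimitive_atBot w,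
    hm.ge_of_tendsto tendsto_heatPrimitive_atTop w⟩

end HeatKernel

/-! ### Liouville normal form and the parametrix -/

section Parametrix

/-- Data reducing `c₂ ∂ₓ² + c₁ ∂ₓ + c₀` on `I` to its Liouville normal form `∂_z² + q`: the
coordinate `z = Z x` with `Z' = σ = c₂^{-1/2}`, the gauge factor `exp β` with `β' = γ`, which
removes the first-order term, and the potential `q` as a function of `x`. -/
structure IsLiouvilleData (I : Set ℝ) (c : ℕ → ℝ → ℝ) (Z σ β γ q : ℝ → ℝ) : Prop where
  contDiffOn_σ : ContDiffOn ℝ ∞ σ I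
  contDiffOn_γ : ContDiffOn ℝ ∞ γ I
  contDiffOn_q : ContDiffOn ℝ ∞ q I
  hasDerivAt_Z : ∀ x ∈ I, HasDerivAt Z (σ x) x
  hasDerivAt_β : ∀ x ∈ I, HasDerivAt β (γ x) x
  σ_pos : ∀ x ∈ I, 0 < σ x
  mul_σ_sq : ∀ x ∈ I, c 2 x * σ x ^ 2 = 1
  /-- The first-order term of the transformed operator vanishes. -/
  transport : ∀ x ∈ I, c 2 x * deriv σ x + 2 * c 2 x * σ x * γ x + c 1 x * σ x = 0
  /-- `q` is the zeroth-order term of the transformed operator. -/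
  potential : ∀ x ∈ I, q x = c 2 x * (deriv γ x + γ x ^ 2) + c 1 x * γ x + c 0 x

variable {I : Set ℝ} {m : ℕ} {c : ℕ → ℝ → ℝ} {Z σ β γ q : ℝ → ℝ}

theorem IsUpperSet.uIcc_subset {I : Set ℝ} (hI : IsUpperSet I) {a b : ℝ} (ha : a ∈ I) (hb : b ∈ I) :
    uIcc a b ⊆ I := fun x hx => by
  rcases le_total a b with h | h
  · rw [uIcc_of_le h] at hx; exact hI hx.1 ha
  · rw [uIcc_of_ge h] at hx; exact hI hx.1 hb

theorem exists_primitive (hI : IsOpen I) (hIup : IsUpperSet I) {f : ℝ → ℝ} (hf : ContinuousOn f I) :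
    ∃ F : ℝ → ℝ, ∀ x ∈ I, HasDerivAt F (f x) x := by
  rcases I.eq_empty_or_nonempty with h | ⟨x₀, hx₀⟩
  · exact ⟨0, by simp [h]⟩
  · refine ⟨fun x => ∫ v in x₀..x, f v, fun x hx => ?_⟩
    exact intervalIntegral.integral_hasDerivAt_right
      (hf.mono (hIup.uIcc_subset hx₀ hx)).intervalIntegrable
      (hf.stronglyMeasurableAtFilter hI x hx) (hf.continuousAt (hI.mem_nhds hx))

theorem contDiffOn_of_hasDerivAt {F f : ℝ → ℝ} (hI : IsOpen I) (hF : ∀ x ∈ I, HasDerivAt F (f x) x)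
    (hf : ContDiffOn ℝ ∞ f I) : ContDiffOn ℝ ∞ F I :=
  (contDiffOn_infty_iff_deriv_of_isOpen hI).2
    ⟨fun x hx => (hF x hx).differentiableAt.differentiableWithinAt,
      hf.congr fun x hx => (hF x hx).deriv⟩

theorem ContDiffOn.hasDerivAt_deriv {f : ℝ → ℝ} (hf : ContDiffOn ℝ ∞ f I) (hI : IsOpen I) {x : ℝ}
    (hx : x ∈ I) : HasDerivAt f (deriv f x) x :=
  ((hf.contDiffAt (hI.mem_nhds hx)).differentiableAt (by simp)).hasDerivAt

theorem exists_isLiouvilleData (hI : IsOpen I) (hIup : IsUpperSet I)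
    (hc : ∀ k ≤ 2, ContDiffOn ℝ ∞ (c k) I) (hpos : ∀ x ∈ I, 0 < c 2 x) :
    ∃ Z σ β γ q : ℝ → ℝ, IsLiouvilleData I c Z σ β γ q := by
  have hσ : ContDiffOn ℝ ∞ (fun x => (√(c 2 x))⁻¹) I :=
    ((hc 2 le_rfl).sqrt fun x hx => (hpos x hx).ne').inv
      fun x hx => (Real.sqrt_pos.2 (hpos x hx)).ne'
  have hderiv : ∀ {f : ℝ → ℝ}, ContDiffOn ℝ ∞ f I → ContDiffOn ℝ ∞ (deriv f) I :=
    fun hf => ((contDiffOn_infty_iff_deriv_of_isOpen hI).1 hf).2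
  set σ : ℝ → ℝ := fun x => (√(c 2 x))⁻¹ with hσdef
  have hσpos : ∀ x ∈ I, 0 < σ x := fun x hx => inv_pos.2 (Real.sqrt_pos.2 (hpos x hx))
  let γ : ℝ → ℝ := fun x => -(deriv σ x / (2 * σ x)) - c 1 x / (2 * c 2 x)
  have hγ : ContDiffOn ℝ ∞ γ I :=
    (((hderiv hσ).div (contDiffOn_const.mul hσ)
      fun x hx => (mul_pos two_pos (hσpos x hx)).ne').neg).sub
      ((hc 1 (by norm_num)).div (contDiffOn_const.mul (hc 2 le_rfl))
        fun x hx => (mul_pos two_pos (hpos x hx)).ne')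
  obtain ⟨Z, hZ⟩ := exists_primitive hI hIup hσ.continuousOn
  obtain ⟨β, hβ⟩ := exists_primitive hI hIup hγ.continuousOn
  refine ⟨Z, σ, β, γ, fun x => c 2 x * (deriv γ x + γ x ^ 2) + c 1 x * γ x + c 0 x,
    hσ, hγ, ?_, hZ, hβ, hσpos, ?_, ?_, fun _ _ => rfl⟩
  · exact (((hc 2 le_rfl).mul ((hderiv hγ).add (hγ.pow 2))).add
      ((hc 1 (by norm_num)).mul hγ)).add (hc 0 (by norm_num))
  · intro x hx
    simp only [hσdef]
    rw [inv_pow, Real.sq_sqrt (hpos x hx).le, mul_inv_cancel₀ (hpos x hx).ne']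
  · intro x hx
    have h1 := (hσpos x hx).ne'
    have h2 := (hpos x hx).ne'
    simp only [γ]
    field_simp
    ring

/-- The factor of the parametrix that is smooth across the pole, as a function of
`(x, ξ, s)`. -/
noncomputable def gaugeFactor (β q : ℝ → ℝ) (x ξ s : ℝ) : ℝ := Real.exp (β x - β ξ + s * q ξ)

/-- The parametrix: the heat kernel in the Liouville coordinate, transformed back, with the
potential `q` frozen at `ξ`. As a function on `ℝ⁴` with variables `(x, t, ξ, τ)`. -/
noncomputable def parametrix (Z σ β q : ℝ → ℝ) (p : ℝ × ℝ × ℝ × ℝ) : ℝ :=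
  heatKernel (p.2.1 - p.2.2.2) (Z p.1 - Z p.2.2.1) * σ p.2.2.1 *
    gaugeFactor β q p.1 p.2.2.1 (p.2.1 - p.2.2.2)

/-- The `ξ`-derivative of the parametrix, see `IsLiouvilleData.hasDerivAt_parametrix_xi`. -/
noncomputable def parametrixXi (Z σ γ β q : ℝ → ℝ) (x t ξ τ : ℝ) : ℝ :=
  heatKernel (t - τ) (Z x - Z ξ) * ((Z x - Z ξ) / (2 * (t - τ))) *
      (σ ξ ^ 2 * gaugeFactor β q x ξ (t - τ)) +
    heatKernel (t - τ) (Z x - Z ξ) *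
      ((deriv σ ξ + σ ξ * (-γ ξ + (t - τ) * deriv q ξ)) * gaugeFactor β q x ξ (t - τ))

/-- The points `(x, t, ξ, τ)` with `x, ξ ∈ I` and `t > τ`. -/
def afterPole (I : Set ℝ) : Set (ℝ × ℝ × ℝ × ℝ) := {p | p.1 ∈ I ∧ p.2.2.1 ∈ I ∧ p.2.2.2 < p.2.1}

theorem isOpen_afterPole (hI : IsOpen I) : IsOpen (afterPole I) :=
  (hI.preimage (by fun_prop : Continuous fun p : ℝ × ℝ × ℝ × ℝ => p.1)).inter
    ((hI.preimage (by fun_prop : Continuous fun p : ℝ × ℝ × ℝ × ℝ => p.2.2.1)).inter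
      (isOpen_lt (by fun_prop : Continuous fun p : ℝ × ℝ × ℝ × ℝ => p.2.2.2) (by fun_prop)))

theorem afterPole_subset_offPole : afterPole I ⊆ offPole I :=
  fun _ hp => ⟨hp.1, hp.2.1, fun h => hp.2.2.ne' h.2⟩

theorem IsLiouvilleData.contDiffOn_Z (h : IsLiouvilleData I c Z σ β γ q) (hI : IsOpen I) :
    ContDiffOn ℝ ∞ Z I := contDiffOn_of_hasDerivAt hI h.hasDerivAt_Z h.contDiffOn_σ

theorem IsLiouvilleData.contDiffOn_β (h : IsLiouvilleData I c Z σ β γ q) (hI : IsOpen I) :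
    ContDiffOn ℝ ∞ β I := contDiffOn_of_hasDerivAt hI h.hasDerivAt_β h.contDiffOn_γ

theorem IsLiouvilleData.contDiffOn_parametrix (h : IsLiouvilleData I c Z σ β γ q) (hI : IsOpen I) :
    ContDiffOn ℝ ∞ (parametrix Z σ β q) (afterPole I) := by
  have hx : ∀ {f : ℝ → ℝ}, ContDiffOn ℝ ∞ f I →
      ContDiffOn ℝ ∞ (fun p : ℝ × ℝ × ℝ × ℝ => f p.1) (afterPole I) :=
    fun hf => hf.comp contDiffOn_fst fun p hp => hp.1
  have hξ : ∀ {f : ℝ → ℝ}, ContDiffOn ℝ ∞ f I →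
      ContDiffOn ℝ ∞ (fun p : ℝ × ℝ × ℝ × ℝ => f p.2.2.1) (afterPole I) :=
    fun hf => hf.comp (by fun_prop) fun p hp => hp.2.1
  have hs : ContDiffOn ℝ ∞ (fun p : ℝ × ℝ × ℝ × ℝ => p.2.1 - p.2.2.2) (afterPole I) := by
    fun_prop
  have hZ := h.contDiffOn_Z hI
  have hβ := h.contDiffOn_β hI
  refine ContDiffOn.mul (ContDiffOn.mul ?_ (hξ h.contDiffOn_σ)) ?_
  · exact contDiffOn_heatKernel.comp (hs.prodMk ((hx hZ).sub (hξ hZ)))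
      fun p hp => sub_pos.2 hp.2.2
  · exact (((hx hβ).sub (hξ hβ)).add (hs.mul (hξ h.contDiffOn_q))).exp

theorem hasDerivAt_gauge_fst {x : ℝ} (hβ : HasDerivAt β (γ x) x) (ξ s : ℝ) :
    HasDerivAt (fun x => gaugeFactor β q x ξ s) (gaugeFactor β q x ξ s * γ x) x :=
  ((hβ.sub_const (β ξ)).add_const (s * q ξ)).exp

theorem IsLiouvilleData.hasDerivAt_parametrix_x (h : IsLiouvilleData I c Z σ β γ q)
    {x t ξ τ : ℝ} (hx : x ∈ I) :
    HasDerivAt (fun x => parametrix Z σ β q (x, t, ξ, τ)) (parametrix Z σ β q (x, t, ξ, τ) *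
      (-((Z x - Z ξ) * σ x / (2 * (t - τ))) + γ x)) x := by
  have h1 := (hasDerivAt_heatKernel (t - τ) (Z x - Z ξ)).comp x
    ((h.hasDerivAt_Z x hx).sub_const (Z ξ))
  refine ((h1.mul_const (σ ξ)).mul
    (hasDerivAt_gauge_fst (q := q) (h.hasDerivAt_β x hx) ξ (t - τ))).congr_deriv ?_
  simp only [parametrix, Function.comp]
  ring

theorem hasDerivAt_parametrix_t {x t ξ τ : ℝ} (ht : τ < t) :
    HasDerivAt (fun t => parametrix Z σ β q (x, t, ξ, τ)) (parametrix Z σ β q (x, t, ξ, τ) *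
      ((Z x - Z ξ) ^ 2 / (4 * (t - τ) ^ 2) - 1 / (2 * (t - τ)) + q ξ)) t := by
  have hs : HasDerivAt (fun t => t - τ) 1 t := (hasDerivAt_id t).sub_const τ
  have h1 := (hasDerivAt_heatKernel_time (sub_pos.2 ht) (Z x - Z ξ)).comp t hs
  have h2 : HasDerivAt (fun t => gaugeFactor β q x ξ (t - τ))
      (gaugeFactor β q x ξ (t - τ) * (1 * q ξ)) t :=
    ((hs.mul_const (q ξ)).const_add (β x - β ξ)).exp
  refine ((h1.mul_const (σ ξ)).mul h2).congr_deriv ?_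
  simp only [parametrix, Function.comp]
  ring

theorem IsLiouvilleData.hasDerivAt_parametrix_xi (h : IsLiouvilleData I c Z σ β γ q)
    (hI : IsOpen I) {x t ξ τ : ℝ} (hξ : ξ ∈ I) :
    HasDerivAt (fun ξ => parametrix Z σ β q (x, t, ξ, τ)) (parametrixXi Z σ γ β q x t ξ τ) ξ := by
  have h1 := (hasDerivAt_heatKernel (t - τ) (Z x - Z ξ)).comp ξ
    ((h.hasDerivAt_Z ξ hξ).const_sub (Z x))
  have h2 : HasDerivAt (fun ξ => gaugeFactor β q x ξ (t - τ))
      (gaugeFactor β q x ξ (t - τ) * (-γ ξ + (t - τ) * deriv q ξ)) ξ :=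
    (((h.hasDerivAt_β ξ hξ).const_sub (β x)).add
      ((h.contDiffOn_q.hasDerivAt_deriv hI hξ).const_mul (t - τ))).exp
  refine ((h1.mul (h.contDiffOn_σ.hasDerivAt_deriv hI hξ)).mul h2).congr_deriv ?_
  simp only [parametrixXi, Pi.mul_apply, Function.comp_apply]
  ring

/-- The parametrix solves the equation up to an error that vanishes at `x = ξ`. -/
theorem IsLiouvilleData.dirDeriv_dirT_parametrix (h : IsLiouvilleData I c Z σ β γ q)
    (hI : IsOpen I) {p : ℝ × ℝ × ℝ × ℝ} (hp : p ∈ afterPole I) :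
    dirDeriv dirT (parametrix Z σ β q) p =
      ∑ k ∈ Finset.range 3, c k p.1 * (dirDeriv dirX)^[k] (parametrix Z σ β q) p +
        parametrix Z σ β q p * (q p.2.2.1 - q p.1) := by
  have hP := h.contDiffOn_parametrix hI
  have hΩ := isOpen_afterPole hI
  have hX : ∀ p ∈ afterPole I, dirDeriv dirX (parametrix Z σ β q) p = parametrix Z σ β q p *
      (-((Z p.1 - Z p.2.2.1) * σ p.1 / (2 * (p.2.1 - p.2.2.2))) + γ p.1) := fun p hp =>
    (hasDerivAt_comp_dirDeriv hP hΩ (hasDerivAt_lineX p.2.1 p.2.2.1 p.2.2.2 p.1) hp).unique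
      (h.hasDerivAt_parametrix_x hp.1)
  obtain ⟨x, t, ξ, τ⟩ := p
  obtain ⟨hx, hξ, ht⟩ := hp
  simp only at hx hξ ht
  have hp : (x, t, ξ, τ) ∈ afterPole I := ⟨hx, hξ, ht⟩
  have h1 : dirDeriv dirT (parametrix Z σ β q) (x, t, ξ, τ) = _ :=
    (hasDerivAt_comp_dirDeriv hP hΩ (hasDerivAt_lineT x ξ τ t) hp).unique
      (hasDerivAt_parametrix_t ht)
  have h2 : dirDeriv dirX (dirDeriv dirX (parametrix Z σ β q)) (x, t, ξ, τ) =
      parametrix Z σ β q (x, t, ξ, τ) * ((-((Z x - Z ξ) * σ x / (2 * (t - τ))) + γ x) ^ 2 +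
        (-((σ x * σ x + (Z x - Z ξ) * deriv σ x) / (2 * (t - τ))) + deriv γ x)) := by
    have e1 := hasDerivAt_comp_dirDeriv (hP.dirDeriv hΩ dirX) hΩ (hasDerivAt_lineX t ξ τ x) hp
    have e2 := (h.hasDerivAt_parametrix_x (t := t) (ξ := ξ) (τ := τ) hx).mul
      ((((((h.hasDerivAt_Z x hx).sub_const (Z ξ)).mul
        (h.contDiffOn_σ.hasDerivAt_deriv hI hx)).div_const (2 * (t - τ))).neg).add
        (h.contDiffOn_γ.hasDerivAt_deriv hI hx))
    have hc : ContinuousAt (fun x : ℝ => (x, t, ξ, τ)) x := by fun_prop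
    rw [e1.unique (e2.congr_of_eventuallyEq ?_)]
    · simp only [Pi.mul_apply, Pi.add_apply, Pi.neg_apply]
      ring
    · filter_upwards [hc (hΩ.mem_nhds hp)] with z hz
      exact hX _ hz
  have hq := h.potential x hx
  have hσ := h.mul_σ_sq x hx
  have htr := h.transport x hx
  rw [h1, Finset.sum_range_succ, Finset.sum_range_succ, Finset.sum_range_one]
  simp only [Function.iterate_succ, Function.iterate_zero, Function.comp, id]
  rw [h2, hX _ hp]
  simp only
  generalize parametrix Z σ β q (x, t, ξ, τ) = P
  have key : (Z x - Z ξ) ^ 2 / (4 * (t - τ) ^ 2) - 1 / (2 * (t - τ)) + q ξ =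
      c 0 x + c 1 x * (-((Z x - Z ξ) * σ x / (2 * (t - τ))) + γ x) +
      c 2 x * ((-((Z x - Z ξ) * σ x / (2 * (t - τ))) + γ x) ^ 2 +
        (-((σ x * σ x + (Z x - Z ξ) * deriv σ x) / (2 * (t - τ))) + deriv γ x)) +
      (q ξ - q x) := by
    rw [hq]
    generalize t - τ = s
    linear_combination (-(Z x - Z ξ) ^ 2 / (4 * s ^ 2) + 1 / (2 * s)) * hσ +
      ((Z x - Z ξ) / (2 * s)) * htr
  rw [key]
  ring

end Parametrix

/-! ### The parametrix as an approximate identity, and its bounds near the pole -/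

section ParametrixBounds

variable {I : Set ℝ} {c : ℕ → ℝ → ℝ} {Z σ β γ q : ℝ → ℝ}

theorem heatPrimitive_hasDerivAt_coord {s x ξ σξ : ℝ} (hs : 0 < s) (hZ : HasDerivAt Z σξ ξ) :
    HasDerivAt (fun ξ => -heatPrimitive ((Z x - Z ξ) / √s)) (heatKernel s (Z x - Z ξ) * σξ) ξ := by
  have h := ((hasDerivAt_heatPrimitive ((Z x - Z ξ) / √s)).comp ξ
    ((hZ.const_sub (Z x)).div_const (√s))).neg
  refine h.congr_deriv ?_
  rw [← heatKernel_scale hs]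
  ring

/-- Integration by parts moves the singular heat kernel into its bounded primitive. -/
theorem IsLiouvilleData.integral_parametrix_mul (h : IsLiouvilleData I c Z σ β γ q)
    (hI : IsOpen I) {xl xr : ℝ} (hlr : xl ≤ xr) (hJ : Icc xl xr ⊆ I) {f : ℝ → ℝ}
    (hf : ContDiff ℝ 1 f) (hfl : f xl = 0) (hfr : f xr = 0) {x t τ : ℝ} (ht : τ < t) :
    ∫ ξ in xl..xr, parametrix Z σ β q (x, t, ξ, τ) * f ξ =
      ∫ ξ in xl..xr, gaugeFactor β q x ξ (t - τ) *
        (deriv f ξ + f ξ * (-γ ξ + (t - τ) * deriv q ξ)) *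
          heatPrimitive ((Z x - Z ξ) / √(t - τ)) := by
  have hs : 0 < t - τ := sub_pos.2 ht
  have hJ' : uIcc xl xr ⊆ I := by rwa [uIcc_of_le hlr]
  have hu : ∀ ξ ∈ uIcc xl xr, HasDerivAt (fun ξ => gaugeFactor β q x ξ (t - τ) * f ξ)
      (gaugeFactor β q x ξ (t - τ) * (deriv f ξ + f ξ * (-γ ξ + (t - τ) * deriv q ξ))) ξ := by
    intro ξ hξ
    have h2 : HasDerivAt (fun ξ => gaugeFactor β q x ξ (t - τ))
        (gaugeFactor β q x ξ (t - τ) * (-γ ξ + (t - τ) * deriv q ξ)) ξ :=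
      (((h.hasDerivAt_β ξ (hJ' hξ)).const_sub (β x)).add
        ((h.contDiffOn_q.hasDerivAt_deriv hI (hJ' hξ)).const_mul (t - τ))).exp
    refine (h2.mul ((hf.differentiable (by simp)) ξ).hasDerivAt).congr_deriv ?_
    ring
  have hv : ∀ ξ ∈ uIcc xl xr, HasDerivAt (fun ξ => -heatPrimitive ((Z x - Z ξ) / √(t - τ)))
      (heatKernel (t - τ) (Z x - Z ξ) * σ ξ) ξ := fun ξ hξ =>
    heatPrimitive_hasDerivAt_coord hs (h.hasDerivAt_Z ξ (hJ' hξ))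
  have hβ := (h.contDiffOn_β hI).continuousOn.mono hJ'
  have hZ := (h.contDiffOn_Z hI).continuousOn.mono hJ'
  have hq := h.contDiffOn_q.continuousOn.mono hJ'
  have hq' := (((contDiffOn_infty_iff_deriv_of_isOpen hI).1 h.contDiffOn_q).2).continuousOn.mono hJ'
  have hγ := h.contDiffOn_γ.continuousOn.mono hJ'
  have hσ := h.contDiffOn_σ.continuousOn.mono hJ'
  have hfc : Continuous (deriv f) := hf.continuous_deriv le_rfl
  have hg : ContinuousOn (fun ξ => gaugeFactor β q x ξ (t - τ)) (uIcc xl xr) := by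
    unfold gaugeFactor; fun_prop
  have hk : Continuous (heatKernel (t - τ)) :=
    continuous_iff_continuousAt.2 fun w => (hasDerivAt_heatKernel (t - τ) w).continuousAt
  have hfc0 := hf.continuous
  have hibp := intervalIntegral.integral_mul_deriv_eq_deriv_mul hu hv
    (ContinuousOn.intervalIntegrable (by fun_prop))
    (ContinuousOn.intervalIntegrable
      ((hk.comp_continuousOn (continuousOn_const.sub hZ)).mul hσ))
  rw [hfl, hfr] at hibp
  simp only [mul_zero, zero_mul, neg_zero, sub_zero, zero_sub, mul_neg,
    intervalIntegral.integral_neg, neg_neg] at hibp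
  rw [← hibp]
  refine intervalIntegral.integral_congr fun ξ _ => ?_
  simp only [parametrix]
  ring

/-- The parametrix is an approximate identity as `t ↓ τ`. -/
theorem IsLiouvilleData.tendsto_integral_parametrix (h : IsLiouvilleData I c Z σ β γ q)
    (hI : IsOpen I) {xl xr : ℝ} (hlr : xl < xr) (hJ : Icc xl xr ⊆ I) {f : ℝ → ℝ}
    (hf : ContDiff ℝ 1 f) (hfl : f xl = 0) (hfr : f xr = 0) (τ : ℝ) {x₁ : ℝ}
    (hx₁ : x₁ ∈ Icc xl xr) :
    Tendsto (fun p : ℝ × ℝ => ∫ ξ in xl..xr, parametrix Z σ β q (p.1, p.2, ξ, τ) * f ξ)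
      (𝓝[Icc xl xr] x₁ ×ˢ 𝓝[>] τ) (𝓝 (f x₁)) := by
  set l : Filter (ℝ × ℝ) := 𝓝[Icc xl xr] x₁ ×ˢ 𝓝[>] τ with hl
  have hxI : ∀ᶠ p in l, p.1 ∈ Icc xl xr := tendsto_fst.eventually eventually_mem_nhdsWithin
  have htτ : ∀ᶠ p in l, p.2 ∈ Ioo τ (τ + 1) :=
    tendsto_snd.eventually (Ioo_mem_nhdsGT (by linarith))
  have hx : Tendsto (fun p : ℝ × ℝ => p.1) l (𝓝[Icc xl xr] x₁) := tendsto_fst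
  have hx' : Tendsto (fun p : ℝ × ℝ => p.1) l (𝓝 x₁) := hx.mono_right nhdsWithin_le_nhds
  have ht : Tendsto (fun p : ℝ × ℝ => p.2 - τ) l (𝓝[>] 0) := by
    refine tendsto_nhdsWithin_iff.2 ⟨?_, htτ.mono fun p hp => sub_pos.2 hp.1⟩
    have h1 : Tendsto (fun p : ℝ × ℝ => p.2) l (𝓝 τ) :=
      tendsto_snd.mono_right nhdsWithin_le_nhds
    simpa using h1.sub_const τ
  have ht' : Tendsto (fun p : ℝ × ℝ => p.2 - τ) l (𝓝 0) := ht.mono_right nhdsWithin_le_nhds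
  have hsq : Tendsto (fun p : ℝ × ℝ => (√(p.2 - τ))⁻¹) l atTop := by
    refine tendsto_inv_nhdsGT_zero.comp (tendsto_nhdsWithin_iff.2 ⟨?_, ?_⟩)
    · have := (Real.continuous_sqrt.tendsto 0).comp ht'
      simpa [Function.comp_def] using this
    · exact htτ.mono fun p hp => Real.sqrt_pos.2 (sub_pos.2 hp.1)
  have hβc := (h.contDiffOn_β hI).continuousOn
  have hZc := (h.contDiffOn_Z hI).continuousOn
  have hqc := h.contDiffOn_q.continuousOn
  have hq'c := (((contDiffOn_infty_iff_deriv_of_isOpen hI).1 h.contDiffOn_q).2).continuousOn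
  have hγc := h.contDiffOn_γ.continuousOn
  have hfc : Continuous (deriv f) := hf.continuous_deriv le_rfl
  have hf0 := hf.continuous
  have hβx : Tendsto (fun p : ℝ × ℝ => β p.1) l (𝓝 (β x₁)) :=
    ((hβc.continuousAt (hI.mem_nhds (hJ hx₁))).tendsto).comp hx'
  have hZx : Tendsto (fun p : ℝ × ℝ => Z p.1) l (𝓝 (Z x₁)) :=
    ((hZc.continuousAt (hI.mem_nhds (hJ hx₁))).tendsto).comp hx'
  -- the smooth factor, with the singular one removed
  let Φ : ℝ × ℝ × ℝ → ℝ := fun z => gaugeFactor β q z.1 z.2.1 z.2.2 *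
    (deriv f z.2.1 + f z.2.1 * (-γ z.2.1 + z.2.2 * deriv q z.2.1))
  have hΦc : ContinuousOn Φ (I ×ˢ I ×ˢ univ) := by
    have e1 : ∀ {g : ℝ → ℝ}, ContinuousOn g I →
        ContinuousOn (fun z : ℝ × ℝ × ℝ => g z.1) (I ×ˢ I ×ˢ univ) :=
      fun hg => hg.comp continuousOn_fst fun z hz => hz.1
    have e2 : ∀ {g : ℝ → ℝ}, ContinuousOn g I →
        ContinuousOn (fun z : ℝ × ℝ × ℝ => g z.2.1) (I ×ˢ I ×ˢ univ) :=
      fun hg => hg.comp (by fun_prop) fun z hz => hz.2.1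
    have a1 := e1 hβc
    have a2 := e2 hβc
    have a3 := e2 hqc
    have a4 := e2 hq'c
    have a5 := e2 hγc
    have a6 : Continuous fun z : ℝ × ℝ × ℝ => z.2.2 := by fun_prop
    have a7 : Continuous fun z : ℝ × ℝ × ℝ => z.2.1 := by fun_prop
    exact ((a1.sub a2).add (a6.continuousOn.mul a3)).rexp.mul
      ((hfc.comp a7).continuousOn.add
        ((hf0.comp a7).continuousOn.mul (a5.neg.add (a6.continuousOn.mul a4))))
  obtain ⟨C, hC⟩ := ((isCompact_Icc (a := xl) (b := xr)).prod
    ((isCompact_Icc (a := xl) (b := xr)).prod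
      (isCompact_Icc (a := (0 : ℝ)) (b := 1)))).exists_bound_of_continuousOn
    (hΦc.mono (prod_mono hJ (prod_mono hJ (subset_univ _))))
  -- strict monotonicity of the coordinate
  have hmono : StrictMonoOn Z (Icc xl xr) := by
    refine strictMonoOn_of_deriv_pos (convex_Icc _ _) (hZc.mono hJ) fun x hx => ?_
    have hxI := hJ (interior_subset hx)
    rw [(h.hasDerivAt_Z x hxI).deriv]
    exact h.σ_pos x hxI
  have hsub : uIoc xl xr ⊆ Icc xl xr := by rw [uIoc_of_le hlr.le]; exact Ioc_subset_Icc_self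
  have hΦξ : ∀ x ∈ Icc xl xr, ∀ s, ContinuousOn (fun ξ => Φ (x, ξ, s)) (Icc xl xr) :=
    fun x hx s => hΦc.comp (by fun_prop) fun ξ hξ => ⟨hJ hx, hJ hξ, mem_univ _⟩
  have hmain : Tendsto (fun p : ℝ × ℝ => ∫ ξ in xl..xr, Φ (p.1, ξ, p.2 - τ) *
      heatPrimitive ((Z p.1 - Z ξ) / √(p.2 - τ))) l
      (𝓝 (∫ ξ in xl..xr, Φ (x₁, ξ, 0) * (if ξ < x₁ then 1 / 2 else -(1 / 2)))) := by
    refine intervalIntegral.tendsto_integral_filter_of_dominated_convergence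
      (fun _ => C * (1 / 2)) ?_ ?_ intervalIntegrable_const ?_
    · filter_upwards [hxI] with p hp
      refine ContinuousOn.aestronglyMeasurable ?_ measurableSet_uIoc
      have hc1 : Continuous heatPrimitive :=
        continuous_iff_continuousAt.2 fun w => (hasDerivAt_heatPrimitive w).continuousAt
      refine ((hΦξ p.1 hp _).mono hsub).mul (hc1.comp_continuousOn ?_)
      exact (continuousOn_const.sub (hZc.mono (hsub.trans hJ))).div_const _
    · filter_upwards [hxI, htτ] with p hp hp2
      refine Eventually.of_forall fun ξ hξ => ?_
      rw [norm_mul]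
      have h1 := hC (p.1, ξ, p.2 - τ) ⟨hp, hsub hξ, by simp only; linarith [hp2.1],
        by simp only; linarith [hp2.2]⟩
      exact mul_le_mul h1 (abs_heatPrimitive_le _) (norm_nonneg _) ((norm_nonneg _).trans h1)
    · filter_upwards [compl_mem_ae_iff.2 (measure_singleton x₁)] with ξ hne hξ
      have hξI := hsub hξ
      have h1 : Tendsto (fun p : ℝ × ℝ => Φ (p.1, ξ, p.2 - τ)) l (𝓝 (Φ (x₁, ξ, 0))) := by
        refine Tendsto.comp (hΦc (x₁, ξ, 0) ⟨hJ hx₁, hJ hξI, mem_univ _⟩)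
          (tendsto_nhdsWithin_iff.2 ⟨?_, ?_⟩)
        · exact hx'.prodMk_nhds (tendsto_const_nhds.prodMk_nhds ht')
        · exact hxI.mono fun p hp => ⟨hJ hp, hJ hξI, mem_univ _⟩
      refine h1.mul ?_
      have hw : Tendsto (fun p : ℝ × ℝ => Z p.1 - Z ξ) l (𝓝 (Z x₁ - Z ξ)) := hZx.sub_const _
      simp only [div_eq_mul_inv]
      rcases lt_or_gt_of_ne (show ξ ≠ x₁ from hne) with hlt | hgt
      · rw [if_pos hlt, ← div_eq_mul_inv]
        refine tendsto_heatPrimitive_atTop.comp (hw.pos_mul_atTop ?_ hsq)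
        exact sub_pos.2 (hmono hξI hx₁ hlt)
      · rw [if_neg hgt.not_gt, ← div_eq_mul_inv]
        refine tendsto_heatPrimitive_atBot.comp (hw.neg_mul_atTop ?_ hsq)
        exact sub_neg.2 (hmono hx₁ hξI hgt)
  -- the limit integral is evaluated by the fundamental theorem of calculus on both sides of `x₁`
  have hFTC : ∀ a ∈ Icc xl xr, ∀ b ∈ Icc xl xr, ∫ ξ in a..b, Φ (x₁, ξ, 0) =
      Real.exp (β x₁ - β b) * f b - Real.exp (β x₁ - β a) * f a := by
    intro a ha b hb
    have hss : uIcc a b ⊆ Icc xl xr := uIcc_subset_Icc ha hb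
    refine intervalIntegral.integral_eq_sub_of_hasDerivAt
      (f := fun ξ => Real.exp (β x₁ - β ξ) * f ξ) (fun ξ hξ => ?_)
      (((hΦξ x₁ hx₁ 0).mono hss).intervalIntegrable)
    refine ((((h.hasDerivAt_β ξ (hJ (hss hξ))).const_sub (β x₁)).exp).mul
      ((hf.differentiable (by simp)) ξ).hasDerivAt).congr_deriv ?_
    simp only [Φ, gaugeFactor, zero_mul, add_zero]
    ring
  have hval : ∫ ξ in xl..xr, Φ (x₁, ξ, 0) * (if ξ < x₁ then 1 / 2 else -(1 / 2)) = f x₁ := by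
    have hxl : xl ∈ Icc xl xr := left_mem_Icc.2 hlr.le
    have hxr : xr ∈ Icc xl xr := right_mem_Icc.2 hlr.le
    have hint : ∀ a ∈ Icc xl xr, ∀ b ∈ Icc xl xr, IntervalIntegrable
        (fun ξ => Φ (x₁, ξ, 0)) volume a b := fun a ha b hb =>
      ((hΦξ x₁ hx₁ 0).mono (uIcc_subset_Icc ha hb)).intervalIntegrable
    have e1 : EqOn (fun ξ => Φ (x₁, ξ, 0) * (1 / 2))
        (fun ξ => Φ (x₁, ξ, 0) * (if ξ < x₁ then 1 / 2 else -(1 / 2))) (uIoo xl x₁) := by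
      intro ξ hξ
      rw [uIoo_of_le hx₁.1] at hξ
      simp only [if_pos hξ.2]
    have e2 : EqOn (fun ξ => Φ (x₁, ξ, 0) * (-(1 / 2)))
        (fun ξ => Φ (x₁, ξ, 0) * (if ξ < x₁ then 1 / 2 else -(1 / 2))) (uIoo x₁ xr) := by
      intro ξ hξ
      rw [uIoo_of_le hx₁.2] at hξ
      simp only [if_neg hξ.1.not_gt]
    have i1 := ((hint xl hxl x₁ hx₁).mul_const (1 / 2)).congr_uIoo e1
    have i2 := ((hint x₁ hx₁ xr hxr).mul_const (-(1 / 2))).congr_uIoo e2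
    rw [← intervalIntegral.integral_add_adjacent_intervals i1 i2,
      ← intervalIntegral.integral_congr_uIoo e1, ← intervalIntegral.integral_congr_uIoo e2,
      intervalIntegral.integral_mul_const, intervalIntegral.integral_mul_const,
      hFTC xl hxl x₁ hx₁, hFTC x₁ hx₁ xr hxr, hfl, hfr, sub_self, Real.exp_zero]
    ring
  rw [hval] at hmain
  refine hmain.congr' ?_
  filter_upwards [hxI, htτ] with p hp hp2
  exact (h.integral_parametrix_mul hI hlr.le hJ hf hfl hfr hp2.1).symm

end ParametrixBounds

section GradientBound

variable {I : Set ℝ} {c : ℕ → ℝ → ℝ} {Z σ β γ q : ℝ → ℝ}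

/-- Bounds for the parametrix on a compact interval, in terms of the distance `|Z x - Z ξ|` in
the Liouville coordinate, which is comparable with `|x - ξ|`. The last one isolates the leading
term of the `ξ`-derivative. -/
theorem IsLiouvilleData.exists_bounds (h : IsLiouvilleData I c Z σ β γ q) (hI : IsOpen I)
    {xl xr : ℝ} (hJ : Icc xl xr ⊆ I) :
    ∃ C, 0 < C ∧ ∀ x ∈ Icc xl xr, ∀ ξ ∈ Icc xl xr,
      |x - ξ| ≤ C * |Z x - Z ξ| ∧ |Z x - Z ξ| ≤ C ∧ |Z x - Z ξ| ≤ C * |x - ξ| ∧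
      |q ξ - q x| ≤ C * |Z x - Z ξ| ∧ |deriv q ξ| ≤ C ∧
      ∀ t τ, τ < t → t - τ ≤ 2 →
        |parametrix Z σ β q (x, t, ξ, τ)| ≤ C * heatKernel (t - τ) (Z x - Z ξ) ∧
        |parametrixXi Z σ γ β q x t ξ τ| ≤
          C * (heatKernel (t - τ) (Z x - Z ξ) * (|Z x - Z ξ| / (t - τ) + 1)) ∧
        |parametrixXi Z σ γ β q x t ξ τ - heatKernel (t - τ) (Z x - Z ξ) *
          ((Z x - Z ξ) / (2 * (t - τ))) * (σ ξ ^ 2 * gaugeFactor β q x ξ (t - τ))| ≤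
          C * heatKernel (t - τ) (Z x - Z ξ) := by
  have hσ := h.contDiffOn_σ.continuousOn.mono hJ
  have hσ' := (((contDiffOn_infty_iff_deriv_of_isOpen hI).1 h.contDiffOn_σ).2).continuousOn.mono hJ
  have hq := h.contDiffOn_q.continuousOn.mono hJ
  have hq' := (((contDiffOn_infty_iff_deriv_of_isOpen hI).1 h.contDiffOn_q).2).continuousOn.mono hJ
  have hγ := h.contDiffOn_γ.continuousOn.mono hJ
  have hβ := (h.contDiffOn_β hI).continuousOn.mono hJ
  have hZ := (h.contDiffOn_Z hI).continuousOn.mono hJ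
  have hσi : ContinuousOn (fun x => (σ x)⁻¹) (Icc xl xr) :=
    hσ.inv₀ fun x hx => (h.σ_pos x (hJ hx)).ne'
  obtain ⟨B, hB⟩ := isCompact_Icc.exists_bound_of_continuousOn
    ((((((((hσ.abs.add hσ'.abs).add hq.abs).add hq'.abs).add hγ.abs).add hβ.abs).add
      hZ.abs).add hσi.abs).add (continuousOn_const (c := (1 : ℝ))))
  have hB' : ∀ x ∈ Icc xl xr, |σ x| ≤ B ∧ |deriv σ x| ≤ B ∧ |q x| ≤ B ∧ |deriv q x| ≤ B ∧
      |γ x| ≤ B ∧ |β x| ≤ B ∧ |Z x| ≤ B ∧ (σ x)⁻¹ ≤ B ∧ 1 ≤ B := by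
    intro x hx
    have h1 := (le_abs_self _).trans (hB x hx)
    simp only [Pi.add_apply] at h1
    have a1 := abs_nonneg (σ x)
    have a2 := abs_nonneg (deriv σ x)
    have a3 := abs_nonneg (q x)
    have a4 := abs_nonneg (deriv q x)
    have a5 := abs_nonneg (γ x)
    have a6 := abs_nonneg (β x)
    have a7 := abs_nonneg (Z x)
    have a8 := abs_nonneg (σ x)⁻¹
    have a9 := le_abs_self (σ x)⁻¹
    refine ⟨?_, ?_, ?_, ?_, ?_, ?_, ?_, ?_, ?_⟩ <;> linarith
  rcases isEmpty_or_nonempty (Icc xl xr) with hemp | ⟨⟨x₀, hx₀⟩⟩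
  · exact ⟨1, one_pos, fun x hx => (hemp.false ⟨x, hx⟩).elim⟩
  have hB1 : 1 ≤ B := (hB' x₀ hx₀).2.2.2.2.2.2.2.2
  have hB0 : 0 < B := by linarith
  have hZlow : ∀ x ∈ Icc xl xr, ∀ ξ ∈ Icc xl xr, |x - ξ| ≤ B * |Z x - Z ξ| := by
    have key : ∀ x ∈ Icc xl xr, ∀ ξ ∈ Icc xl xr, x ≤ ξ → B⁻¹ * (ξ - x) ≤ Z ξ - Z x := by
      refine (convex_Icc xl xr).mul_sub_le_image_sub_of_le_deriv hZ ?_ ?_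
      · exact fun x hx => (h.hasDerivAt_Z x
          (hJ (interior_subset hx))).differentiableAt.differentiableWithinAt
      · intro x hx
        have hx' := interior_subset hx
        rw [(h.hasDerivAt_Z x (hJ hx')).deriv]
        exact inv_le_of_inv_le₀ (h.σ_pos x (hJ hx')) (hB' x hx').2.2.2.2.2.2.2.1
    have key2 : ∀ x ∈ Icc xl xr, ∀ ξ ∈ Icc xl xr, x ≤ ξ → |x - ξ| ≤ B * |Z x - Z ξ| := by
      intro x hx ξ hξ hle
      have h1 := key x hx ξ hξ hle
      rw [inv_mul_le_iff₀ hB0] at h1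
      rw [abs_sub_comm, abs_of_nonneg (sub_nonneg.2 hle), abs_sub_comm]
      exact h1.trans (mul_le_mul_of_nonneg_left (le_abs_self _) hB0.le)
    intro x hx ξ hξ
    rcases le_total x ξ with hle | hle
    · exact key2 x hx ξ hξ hle
    · rw [abs_sub_comm, abs_sub_comm (Z x)]; exact key2 ξ hξ x hx hle
  have hlip : ∀ {f f' : ℝ → ℝ}, (∀ x ∈ I, HasDerivAt f (f' x) x) →
      (∀ x ∈ Icc xl xr, |f' x| ≤ B) → ∀ x ∈ Icc xl xr, ∀ ξ ∈ Icc xl xr,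
        |f x - f ξ| ≤ B * |x - ξ| := fun hf hf' x hx ξ hξ =>
    (convex_Icc xl xr).norm_image_sub_le_of_norm_hasDerivWithin_le
      (fun z hz => (hf z (hJ hz)).hasDerivWithinAt) hf' hξ hx
  have hZup := hlip h.hasDerivAt_Z fun x hx => (hB' x hx).1
  have hqup := hlip (fun x hx => h.contDiffOn_q.hasDerivAt_deriv hI hx)
    fun x hx => (hB' x hx).2.2.2.1
  set E := Real.exp (4 * B) with hE
  have hE1 : 1 ≤ E := Real.one_le_exp (by linarith)
  have hE0 : 0 < E := Real.exp_pos _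
  refine ⟨(4 * B ^ 2) * E, by positivity, fun x hx ξ hξ => ?_⟩
  have hBC : B ≤ (4 * B ^ 2) * E := by nlinarith [mul_le_mul hB1 hE1 zero_le_one hB0.le]
  have hBC2 : B ^ 2 ≤ (4 * B ^ 2) * E := by nlinarith [sq_nonneg B]
  have hw0 := abs_nonneg (Z x - Z ξ)
  obtain ⟨b1, b2, b3, b4, b5, b6, b7, -, -⟩ := hB' ξ hξ
  have hσξ := (h.σ_pos ξ (hJ hξ)).le
  refine ⟨(hZlow x hx ξ hξ).trans (mul_le_mul_of_nonneg_right hBC hw0), ?_, ?_, ?_,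
    b4.trans hBC, ?_⟩
  · have h1 := abs_sub (Z x) (Z ξ)
    have h2 := (hB' x hx).2.2.2.2.2.2.1
    nlinarith
  · exact (hZup x hx ξ hξ).trans (mul_le_mul_of_nonneg_right hBC (abs_nonneg _))
  · rw [abs_sub_comm]
    calc |q x - q ξ| ≤ B * |x - ξ| := hqup x hx ξ hξ
      _ ≤ B * (B * |Z x - Z ξ|) := mul_le_mul_of_nonneg_left (hZlow x hx ξ hξ) hB0.le
      _ = B ^ 2 * |Z x - Z ξ| := by ring
      _ ≤ _ := mul_le_mul_of_nonneg_right hBC2 hw0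
  · intro t τ ht hs2
    have hs : 0 < t - τ := sub_pos.2 ht
    have hN := heatKernel_pos hs (Z x - Z ξ)
    have hg0 : 0 < gaugeFactor β q x ξ (t - τ) := Real.exp_pos _
    have hg : gaugeFactor β q x ξ (t - τ) ≤ E := by
      refine Real.exp_le_exp.2 ?_
      have h1 := (abs_le.1 (hB' x hx).2.2.2.2.2.1).2
      have h2 := (abs_le.1 b6).1
      have h3 : (t - τ) * q ξ ≤ 2 * B := by
        have := (abs_le.1 b3).2
        nlinarith
      linarith
    simp only [parametrix, parametrixXi]
    generalize heatKernel (t - τ) (Z x - Z ξ) = N at *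
    generalize gaugeFactor β q x ξ (t - τ) = g at *
    refine ⟨?_, ?_⟩
    · rw [abs_mul, abs_mul, abs_of_pos hN, abs_of_pos hg0]
      calc N * |σ ξ| * g ≤ N * B * E := by gcongr
        _ = N * (B * E) := by ring
        _ ≤ N * ((4 * B ^ 2) * E) := by
          refine mul_le_mul_of_nonneg_left (mul_le_mul_of_nonneg_right ?_ hE0.le) hN.le
          nlinarith
        _ = _ := by ring
    · have e1 : |N * ((Z x - Z ξ) / (2 * (t - τ))) * (σ ξ ^ 2 * g)| ≤
          N * (|Z x - Z ξ| / (t - τ)) * (B ^ 2 * E) := by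
        rw [abs_mul, abs_mul, abs_mul, abs_of_pos hN, abs_of_pos hg0, abs_div, abs_pow,
          abs_of_pos (by positivity : 0 < 2 * (t - τ))]
        gcongr
        linarith
      have e2 : |N * ((deriv σ ξ + σ ξ * (-γ ξ + (t - τ) * deriv q ξ)) * g)| ≤
          N * (4 * B ^ 2 * E) := by
        rw [abs_mul, abs_mul, abs_of_pos hN, abs_of_pos hg0]
        have e3 : |deriv σ ξ + σ ξ * (-γ ξ + (t - τ) * deriv q ξ)| ≤ 4 * B ^ 2 := by
          have e4 : |(-γ ξ + (t - τ) * deriv q ξ)| ≤ B + 2 * B := by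
            refine (abs_add_le _ _).trans (add_le_add (by rwa [abs_neg]) ?_)
            rw [abs_mul, abs_of_pos hs]
            exact mul_le_mul hs2 b4 (abs_nonneg _) zero_le_two
          calc _ ≤ |deriv σ ξ| + |σ ξ| * |(-γ ξ + (t - τ) * deriv q ξ)| := by
                rw [← abs_mul]; exact abs_add_le _ _
            _ ≤ B + B * (B + 2 * B) := by gcongr
            _ ≤ 4 * B ^ 2 := by nlinarith
        gcongr
      refine ⟨(abs_add_le _ _).trans ((add_le_add e1 e2).trans ?_), by
        rw [add_sub_cancel_left]; exact e2.trans_eq (by ring)⟩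
      have e5 : N * (|Z x - Z ξ| / (t - τ)) * (B ^ 2 * E) ≤
          N * (|Z x - Z ξ| / (t - τ)) * (4 * B ^ 2 * E) := by
        refine mul_le_mul_of_nonneg_left ?_ (by positivity)
        nlinarith
      calc _ ≤ N * (|Z x - Z ξ| / (t - τ)) * (4 * B ^ 2 * E) + N * (4 * B ^ 2 * E) := by
            linarith
        _ = _ := by ring

/-- The `ξ`-derivative of the parametrix error is of order `s^{-1/2}`: the factor `q ξ - q x`
compensates the singularity of the `ξ`-derivative of the parametrix. -/
theorem IsLiouvilleData.exists_bound_error (h : IsLiouvilleData I c Z σ β γ q) (hI : IsOpen I)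
    {xl xr : ℝ} (hJ : Icc xl xr ⊆ I) :
    ∃ K, 0 ≤ K ∧ ∀ x ∈ Icc xl xr, ∀ ξ ∈ Icc xl xr, ∀ t τ, τ < t → t - τ ≤ 2 →
      |parametrixXi Z σ γ β q x t ξ τ * (q ξ - q x) +
        parametrix Z σ β q (x, t, ξ, τ) * deriv q ξ| ≤ K / √(t - τ) := by
  obtain ⟨C, hC, hb⟩ := h.exists_bounds hI hJ
  refine ⟨4 * C ^ 2 + C ^ 3 + C ^ 2, by positivity, fun x hx ξ hξ t τ ht hs2 => ?_⟩
  obtain ⟨-, b2, -, b3, b4, b5⟩ := hb x hx ξ hξ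
  obtain ⟨b6, b7, -⟩ := b5 t τ ht hs2
  have hs : 0 < t - τ := sub_pos.2 ht
  have hN := heatKernel_pos hs (Z x - Z ξ)
  have hsq := sq_div_mul_heatKernel_le hs (Z x - Z ξ)
  have hle := heatKernel_le hs (Z x - Z ξ)
  generalize heatKernel (t - τ) (Z x - Z ξ) = N at *
  rw [← sq_abs] at hsq
  have hw0 := abs_nonneg (Z x - Z ξ)
  generalize |Z x - Z ξ| = w at *
  calc _ ≤ |parametrixXi Z σ γ β q x t ξ τ| * |q ξ - q x| +
        |parametrix Z σ β q (x, t, ξ, τ)| * |deriv q ξ| := by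
        rw [← abs_mul, ← abs_mul]; exact abs_add_le _ _
    _ ≤ C * (N * (w / (t - τ) + 1)) * (C * w) + C * N * C := by gcongr
    _ = C ^ 2 * (w ^ 2 / (t - τ) * N) + C ^ 2 * N * w + C ^ 2 * N := by ring
    _ ≤ C ^ 2 * (4 / √(t - τ)) + C ^ 2 * (1 / √(t - τ)) * C + C ^ 2 * (1 / √(t - τ)) := by gcongr
    _ = _ := by ring

/-- Away from the pole the `ξ`-derivative of the parametrix is bounded. -/
theorem IsLiouvilleData.exists_bound_lateral (h : IsLiouvilleData I c Z σ β γ q) (hI : IsOpen I)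
    {xl xr r : ℝ} (hJ : Icc xl xr ⊆ I) (hr : 0 < r) :
    ∃ M, ∀ x ∈ Icc xl xr, ∀ ξ ∈ Icc xl xr, r ≤ |x - ξ| → ∀ t τ, τ < t → t - τ ≤ 2 →
      |parametrixXi Z σ γ β q x t ξ τ| ≤ M := by
  obtain ⟨C, hC, hb⟩ := h.exists_bounds hI hJ
  refine ⟨C * (64 * (C / r) ^ 4 * (C + 2)), fun x hx ξ hξ hxr t τ ht hs2 => ?_⟩
  obtain ⟨b1, b2, -, -, -, b5⟩ := hb x hx ξ hξ
  obtain ⟨-, b7, -⟩ := b5 t τ ht hs2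
  have hs : 0 < t - τ := sub_pos.2 ht
  have hw : r / C ≤ |Z x - Z ξ| := by
    rw [div_le_iff₀ hC, mul_comm]; exact hxr.trans b1
  have hrC : 0 < r / C := by positivity
  have hw0 : 0 < |Z x - Z ξ| := hrC.trans_le hw
  refine b7.trans (mul_le_mul_of_nonneg_left ?_ hC.le)
  -- `e^{-v} ≤ 2 / v²` with `v = w² / (4s)`
  have hN : heatKernel (t - τ) (Z x - Z ξ) ≤ 1 / √(t - τ) * (32 * (t - τ) ^ 2 * (C / r) ^ 4) := by
    unfold heatKernel
    have h2 : (√(4 * Real.pi * (t - τ)))⁻¹ ≤ 1 / √(t - τ) := by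
      rw [one_div]
      refine inv_anti₀ (Real.sqrt_pos.2 hs) (Real.sqrt_le_sqrt ?_)
      nlinarith [Real.pi_gt_three]
    refine mul_le_mul h2 ?_ (Real.exp_pos _).le (by positivity)
    set v := (Z x - Z ξ) ^ 2 / (4 * (t - τ)) with hv
    have hvlow : (r / C) ^ 2 / (4 * (t - τ)) ≤ v := by
      rw [hv, ← sq_abs (Z x - Z ξ)]
      gcongr
    have hvl0 : 0 < (r / C) ^ 2 / (4 * (t - τ)) := by positivity
    have hv0 : 0 < v := hvl0.trans_le hvlow
    have h3 := Real.quadratic_le_exp_of_nonneg hv0.le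
    rw [neg_div, ← hv, Real.exp_neg]
    calc (Real.exp v)⁻¹ ≤ (v ^ 2 / 2)⁻¹ := inv_anti₀ (by positivity) (by linarith)
      _ ≤ (((r / C) ^ 2 / (4 * (t - τ))) ^ 2 / 2)⁻¹ := by gcongr
      _ = _ := by field_simp; norm_num
  have hN0 := (heatKernel_pos hs (Z x - Z ξ)).le
  calc heatKernel (t - τ) (Z x - Z ξ) * (|Z x - Z ξ| / (t - τ) + 1)
      ≤ 1 / √(t - τ) * (32 * (t - τ) ^ 2 * (C / r) ^ 4) * (C / (t - τ) + 1) := by gcongr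
    _ = (32 * (C / r) ^ 4) * ((t - τ) / √(t - τ)) * (C + (t - τ)) := by
      field_simp
    _ ≤ (32 * (C / r) ^ 4) * 2 * (C + 2) := by
      have : (t - τ) / √(t - τ) ≤ 2 := by
        rw [Real.div_sqrt]
        refine (Real.sqrt_le_sqrt hs2).trans ?_
        rw [Real.sqrt_le_left (by norm_num)]
        norm_num
      gcongr
    _ = _ := by ring

end GradientBound

/-! ### The Green function differs from the parametrix by a bounded gradient -/

section Remainder

theorem dirDeriv_sub {E : Type*} [NormedAddCommGroup E] [NormedSpace ℝ E] {f g : E → ℝ} {Ω : Set E}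
    (hf : ContDiffOn ℝ ∞ f Ω) (hg : ContDiffOn ℝ ∞ g Ω) (hΩ : IsOpen Ω) (v : E) {p : E}
    (hp : p ∈ Ω) : dirDeriv v (fun p => f p - g p) p = dirDeriv v f p - dirDeriv v g p := by
  rw [dirDeriv, ((hf.hasFDerivAt_of_mem hΩ hp).fun_sub (hg.hasFDerivAt_of_mem hΩ hp)).fderiv]
  rfl

theorem dirDeriv_iterate_sub {E : Type*} [NormedAddCommGroup E] [NormedSpace ℝ E] {f g : E → ℝ}
    {Ω : Set E} (hf : ContDiffOn ℝ ∞ f Ω) (hg : ContDiffOn ℝ ∞ g Ω) (hΩ : IsOpen Ω) (v : E) (k : ℕ)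
    {p : E} (hp : p ∈ Ω) : (dirDeriv v)^[k] (fun p => f p - g p) p =
      (dirDeriv v)^[k] f p - (dirDeriv v)^[k] g p := by
  induction k generalizing p with
  | zero => rfl
  | succ k ih =>
    rw [Function.iterate_succ_apply', Function.iterate_succ_apply', Function.iterate_succ_apply',
      ← dirDeriv_sub (hf.dirDeriv_iterate hΩ v k) (hg.dirDeriv_iterate hΩ v k) hΩ v hp]
    refine Filter.EventuallyEq.dirDeriv_eq ?_ v
    filter_upwards [hΩ.mem_nhds hp] with z hz using ih hz

/-- A continuous function that is bounded by `C` when tested against smooth functions of compact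
support is pointwise bounded by `C`. -/
theorem abs_le_of_abs_integral_mul_le {h : ℝ → ℝ} {xl xr a b C : ℝ} (ha : xl ≤ a) (hb : b ≤ xr)
    (hc : ContinuousOn h (Icc xl xr))
    (H : ∀ g : ℝ → ℝ, ContDiff ℝ ∞ g → HasCompactSupport g → tsupport g ⊆ Ioo a b →
      |∫ ξ in xl..xr, g ξ * h ξ| ≤ C * ∫ ξ in xl..xr, |g ξ|) {ξ : ℝ} (hξ : ξ ∈ Ioo a b) :
    |h ξ| ≤ C := by
  have key : ∀ h : ℝ → ℝ, ContinuousOn h (Icc xl xr) →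
      (∀ g : ℝ → ℝ, ContDiff ℝ ∞ g → HasCompactSupport g → tsupport g ⊆ Ioo a b →
        |∫ ξ in xl..xr, g ξ * h ξ| ≤ C * ∫ ξ in xl..xr, |g ξ|) → h ξ ≤ C := by
    intro h hc H
    by_contra! hlt
    have hcξ : ContinuousAt h ξ :=
      hc.continuousAt (Icc_mem_nhds (ha.trans_lt hξ.1) (hξ.2.trans_le hb))
    obtain ⟨δ, hδ, hball⟩ := Metric.mem_nhds_iff.1 (inter_mem
      (hcξ.eventually (lt_mem_nhds (show (C + h ξ) / 2 < h ξ by linarith)))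
      (Ioo_mem_nhds hξ.1 hξ.2))
    let f : ContDiffBump ξ := ⟨δ / 4, δ / 2, by linarith, by linarith⟩
    have hts : tsupport f ⊆ Metric.ball ξ δ := by
      rw [f.tsupport_eq]
      exact Metric.closedBall_subset_ball (show δ / 2 < δ by linarith)
    have hlr : xl ≤ xr := ha.trans ((hξ.1.trans hξ.2).le.trans hb)
    have h1 := H f f.contDiff f.hasCompactSupport fun z hz => (hball (hts hz)).2
    have hA : 0 < ∫ ξ in xl..xr, f ξ := by
      rw [intervalIntegral.integral_eq_integral_of_support_subset]
      · exact f.integral_pos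
      · intro z hz
        have := (hball (hts (subset_tsupport _ hz))).2
        exact ⟨ha.trans_lt this.1, this.2.le.trans hb⟩
    have h2 : (C + h ξ) / 2 * ∫ ξ in xl..xr, f ξ ≤ ∫ ξ in xl..xr, f ξ * h ξ := by
      rw [← intervalIntegral.integral_const_mul]
      refine intervalIntegral.integral_mono_on hlr
        ((continuous_const.mul f.continuous).intervalIntegrable _ _)
        (ContinuousOn.intervalIntegrable_of_Icc hlr (f.continuous.continuousOn.mul hc)) ?_
      intro z _
      rw [mul_comm]
      by_cases hz : z ∈ tsupport f
      · exact mul_le_mul_of_nonneg_left (le_of_lt (hball (hts hz)).1) f.nonneg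
      · rw [image_eq_zero_of_notMem_tsupport hz, zero_mul, zero_mul]
    simp only [abs_of_nonneg f.nonneg] at h1
    have h3 := (h2.trans (le_abs_self _)).trans h1
    have h4 := le_of_mul_le_mul_right h3 hA
    linarith
  refine abs_le'.2 ⟨key h hc H, key (fun z => -h z) hc.neg fun g h1 h2 h3 => ?_⟩
  simpa [intervalIntegral.integral_neg] using H g h1 h2 h3

/-- Integration by parts in `ξ` against a test function. -/
theorem integral_deriv_mul_lineXi {f : ℝ × ℝ × ℝ × ℝ → ℝ} {Ω : Set (ℝ × ℝ × ℝ × ℝ)}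
    (hf : ContDiffOn ℝ ∞ f Ω) (hΩ : IsOpen Ω) {g : ℝ → ℝ} (hg : ContDiff ℝ 1 g) {xl xr x t τ : ℝ}
    (hlr : xl ≤ xr) (hgl : g xl = 0) (hgr : g xr = 0)
    (hp : ∀ ξ ∈ Icc xl xr, (x, t, ξ, τ) ∈ Ω) :
    ∫ ξ in xl..xr, deriv g ξ * f (x, t, ξ, τ) =
      -∫ ξ in xl..xr, g ξ * dirDeriv dirXi f (x, t, ξ, τ) := by
  have hc : ContinuousOn (fun ξ => dirDeriv dirXi f (x, t, ξ, τ)) (uIcc xl xr) := by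
    rw [uIcc_of_le hlr]
    exact (hf.dirDeriv hΩ dirXi).continuousOn.comp (by fun_prop) hp
  have h := intervalIntegral.integral_mul_deriv_eq_deriv_mul (u := g) (u' := deriv g)
    (v := fun ξ => f (x, t, ξ, τ)) (v' := fun ξ => dirDeriv dirXi f (x, t, ξ, τ))
    (fun ξ _ => ((hg.differentiable (by simp)) ξ).hasDerivAt)
    (fun ξ hξ => hasDerivAt_comp_dirDeriv hf hΩ (hasDerivAt_lineXi x t τ ξ)
      (hp ξ (by rwa [uIcc_of_le hlr] at hξ)))
    ((hg.continuous_deriv le_rfl).intervalIntegrable _ _) hc.intervalIntegrable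
  rw [h, hgl, hgr]
  ring

theorem abs_integral_deriv_mul_lineXi_le {f : ℝ × ℝ × ℝ × ℝ → ℝ} {Ω : Set (ℝ × ℝ × ℝ × ℝ)}
    (hf : ContDiffOn ℝ ∞ f Ω) (hΩ : IsOpen Ω) {g : ℝ → ℝ} (hg : ContDiff ℝ 1 g) {xl xr x t τ M : ℝ}
    (hlr : xl ≤ xr) (hgl : g xl = 0) (hgr : g xr = 0)
    (hp : ∀ ξ ∈ Icc xl xr, (x, t, ξ, τ) ∈ Ω)
    (hM : ∀ ξ ∈ Icc xl xr, g ξ ≠ 0 → |dirDeriv dirXi f (x, t, ξ, τ)| ≤ M) :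
    |∫ ξ in xl..xr, deriv g ξ * f (x, t, ξ, τ)| ≤ M * ∫ ξ in xl..xr, |g ξ| := by
  rw [integral_deriv_mul_lineXi hf hΩ hg hlr hgl hgr hp, abs_neg,
    ← intervalIntegral.integral_const_mul, ← Real.norm_eq_abs]
  refine intervalIntegral.norm_integral_le_of_norm_le (μ := volume) (g := fun ξ => M * |g ξ|) hlr
    (Eventually.of_forall fun ξ hξ => ?_)
    ((continuous_const.mul hg.continuous.abs).intervalIntegrable _ _)
  rw [norm_mul, mul_comm]
  by_cases h0 : g ξ = 0
  · simp [h0]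
  · exact mul_le_mul_of_nonneg_right (hM ξ (Ioc_subset_Icc_self hξ) h0) (norm_nonneg _)

end Remainder

section GradientBound

variable {I : Set ℝ} {c : ℕ → ℝ → ℝ} {G : ℝ → ℝ → ℝ → ℝ → ℝ} {Z σ β γ q : ℝ → ℝ}

theorem line_add_xi (x t ξ τ : ℝ) :
    ((x, t, 0, τ) : ℝ × ℝ × ℝ × ℝ) + (0, 0, ξ, 0) = (x, t, ξ, τ) := by simp

theorem IsLiouvilleData.dirDeriv_dirXi_parametrix (h : IsLiouvilleData I c Z σ β γ q)
    (hI : IsOpen I) {x t ξ τ : ℝ} (hp : (x, t, ξ, τ) ∈ afterPole I) :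
    dirDeriv dirXi (parametrix Z σ β q) (x, t, ξ, τ) = parametrixXi Z σ γ β q x t ξ τ :=
  (hasDerivAt_comp_dirDeriv (h.contDiffOn_parametrix hI) (isOpen_afterPole hI)
    (hasDerivAt_lineXi x t τ ξ) hp).unique (h.hasDerivAt_parametrix_xi hI hp.2.1)

/-- The difference between the Green function and the parametrix. -/
noncomputable def greenRemainder (G : ℝ → ℝ → ℝ → ℝ → ℝ) (Z σ β q : ℝ → ℝ)
    (p : ℝ × ℝ × ℝ × ℝ) : ℝ := green G p - parametrix Z σ β q p

/-- The defect of the parametrix in the equation. -/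
noncomputable def parametrixError (Z σ β q : ℝ → ℝ) (p : ℝ × ℝ × ℝ × ℝ) : ℝ :=
  parametrix Z σ β q p * (q p.2.2.1 - q p.1)

theorem contDiffOn_greenRemainder (hG : IsGreenFunction I 2 c G)
    (h : IsLiouvilleData I c Z σ β γ q) (hI : IsOpen I) :
    ContDiffOn ℝ ∞ (greenRemainder G Z σ β q) (afterPole I) :=
  (hG.contDiffOn_green.mono afterPole_subset_offPole).sub (h.contDiffOn_parametrix hI)

theorem IsLiouvilleData.contDiffOn_parametrixError (h : IsLiouvilleData I c Z σ β γ q)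
    (hI : IsOpen I) : ContDiffOn ℝ ∞ (parametrixError Z σ β q) (afterPole I) :=
  (h.contDiffOn_parametrix hI).mul
    ((h.contDiffOn_q.comp (by fun_prop) fun _ hp => hp.2.1).sub
      (h.contDiffOn_q.comp contDiffOn_fst fun _ hp => hp.1))

theorem IsLiouvilleData.dirDeriv_dirXi_parametrixError (h : IsLiouvilleData I c Z σ β γ q)
    (hI : IsOpen I) {x t ξ τ : ℝ} (hp : (x, t, ξ, τ) ∈ afterPole I) :
    dirDeriv dirXi (parametrixError Z σ β q) (x, t, ξ, τ) =
      parametrixXi Z σ γ β q x t ξ τ * (q ξ - q x) +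
        parametrix Z σ β q (x, t, ξ, τ) * deriv q ξ :=
  (hasDerivAt_comp_dirDeriv (h.contDiffOn_parametrixError hI) (isOpen_afterPole hI)
    (hasDerivAt_lineXi x t τ ξ) hp).unique
    ((h.hasDerivAt_parametrix_xi hI hp.2.1).mul
      ((h.contDiffOn_q.hasDerivAt_deriv hI hp.2.1).sub_const (q x)))

theorem dirDeriv_dirT_greenRemainder (hG : IsGreenFunction I 2 c G)
    (h : IsLiouvilleData I c Z σ β γ q) (hI : IsOpen I) {p : ℝ × ℝ × ℝ × ℝ}
    (hp : p ∈ afterPole I) :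
    dirDeriv dirT (greenRemainder G Z σ β q) p =
      c 2 p.1 * dirDeriv dirX (dirDeriv dirX (greenRemainder G Z σ β q)) p +
      c 1 p.1 * dirDeriv dirX (greenRemainder G Z σ β q) p +
      c 0 p.1 * greenRemainder G Z σ β q p - parametrixError Z σ β q p := by
  have hΩ := isOpen_afterPole hI
  have hg := hG.contDiffOn_green.mono (afterPole_subset_offPole (I := I))
  have hP := h.contDiffOn_parametrix hI
  have e2 := dirDeriv_iterate_sub hg hP hΩ dirX 2 hp
  have e1 := dirDeriv_iterate_sub hg hP hΩ dirX 1 hp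
  simp only [Function.iterate_succ, Function.iterate_zero, Function.comp, id] at e1 e2
  unfold greenRemainder
  rw [dirDeriv_sub hg hP hΩ dirT hp, e2, e1,
    hG.dirDeriv_dirT_green hI (afterPole_subset_offPole hp) hp.2.2.ne',
    h.dirDeriv_dirT_parametrix hI hp]
  simp only [Finset.sum_range_succ, Finset.sum_range_zero, Function.iterate_succ,
    Function.iterate_zero, Function.comp, id, parametrixError]
  ring

/-- Tested against the derivative of a smooth function, the remainder tends to `0` as `t ↓ τ`,
because the Green function and the parametrix have the same initial values. -/
theorem tendsto_integral_greenRemainder (hG : IsGreenFunction I 2 c G)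
    (h : IsLiouvilleData I c Z σ β γ q) (hI : IsOpen I) {xl xr : ℝ} (hlr : xl < xr)
    (hJ : Icc xl xr ⊆ I) {g : ℝ → ℝ} (hg : ContDiff ℝ ∞ g) (hgc : HasCompactSupport g)
    (hgs : tsupport g ⊆ Ioo xl xr) (τ : ℝ) {x₁ : ℝ} (hx₁ : x₁ ∈ Icc xl xr) :
    Tendsto (fun p : ℝ × ℝ => ∫ ξ in xl..xr,
        deriv g ξ * greenRemainder G Z σ β q ((p.1, p.2, 0, τ) + (0, 0, ξ, 0)))
      (𝓝[Icc xl xr] x₁ ×ˢ 𝓝[>] τ) (𝓝 0) := by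
  have hg1 : ContDiff ℝ 1 (deriv g) := by
    have := contDiff_infty_iff_deriv.1 hg
    exact this.2.of_le (by simp)
  have hts : tsupport (deriv g) ⊆ Ioo xl xr := tsupport_deriv_subset.trans hgs
  have hgl : deriv g xl = 0 := image_eq_zero_of_notMem_tsupport fun hx => (hts hx).1.false
  have hgr : deriv g xr = 0 := image_eq_zero_of_notMem_tsupport fun hx => (hts hx).2.false
  have h1 := h.tendsto_integral_parametrix hI hlr hJ hg1 hgl hgr τ hx₁
  have h2 := (hG.delta (deriv g) hg1.continuous hgc.deriv
    (hts.trans (Ioo_subset_Icc_self.trans hJ)) x₁ (hJ hx₁) τ).mono_left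
    (Filter.prod_mono_left _ (nhdsWithin_le_nhds (s := Icc xl xr)))
  have h3 := h2.sub h1
  rw [sub_self] at h3
  refine h3.congr' ?_
  have hxI : ∀ᶠ p in 𝓝[Icc xl xr] x₁ ×ˢ 𝓝[>] τ, p.1 ∈ Icc xl xr :=
    tendsto_fst.eventually eventually_mem_nhdsWithin
  have htτ : ∀ᶠ p in 𝓝[Icc xl xr] x₁ ×ˢ 𝓝[>] τ, p.2 ∈ Ioi τ :=
    tendsto_snd.eventually eventually_mem_nhdsWithin
  filter_upwards [hxI, htτ] with p hp hp2
  have hmem : ∀ ξ ∈ Icc xl xr, (p.1, p.2, ξ, τ) ∈ afterPole I := fun ξ hξ => ⟨hJ hp, hJ hξ, hp2⟩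
  have hint : ∀ {f : ℝ × ℝ × ℝ × ℝ → ℝ}, ContinuousOn f (afterPole I) →
      IntervalIntegrable (fun ξ => f (p.1, p.2, ξ, τ) * deriv g ξ) volume xl xr := fun hf =>
    ContinuousOn.intervalIntegrable_of_Icc hlr.le
      ((hf.comp (by fun_prop) hmem).mul hg1.continuous.continuousOn)
  have e : ∫ ξ, G p.1 p.2 ξ τ * deriv g ξ =
      ∫ ξ in xl..xr, green G (p.1, p.2, ξ, τ) * deriv g ξ := by
    rw [intervalIntegral.integral_eq_integral_of_support_subset]
    · rfl
    · intro ξ hξ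
      have := hts (subset_tsupport _ (right_ne_zero_of_mul hξ))
      exact Ioo_subset_Ioc_self this
  rw [e, ← intervalIntegral.integral_sub
    (hint (hG.contDiffOn_green.mono afterPole_subset_offPole).continuousOn)
    (hint (h.contDiffOn_parametrix hI).continuousOn)]
  refine intervalIntegral.integral_congr fun ξ _ => ?_
  simp only [line_add_xi, greenRemainder]
  ring

/-- The key estimate: near the pole, `∂G/∂ξ` differs from the `ξ`-derivative of the parametrix
by a bounded function. No equation in the variable `ξ` is used: for a test function `g`,
`u(x,t) = ∫ (G - P) g' dξ` solves the equation with zero initial values, its lateral values and its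
source are controlled by `∫ |g|` after an integration by parts, and the maximum principle
gives `|∫ ∂_ξ(G - P) g dξ| ≤ C ∫ |g|`. -/
theorem exists_bound_greenXi_sub_parametrixXi (hG : IsGreenFunction I 2 c G)
    (h : IsLiouvilleData I c Z σ β γ q) (hI : IsOpen I) (hc₀ : ContinuousOn (c 0) I)
    {ξ₀ : ℝ} (hξ₀ : ξ₀ ∈ I) (t₀ : ℝ) :
    ∃ r > 0, ∃ C, 0 ≤ C ∧ Icc (ξ₀ - 2 * r) (ξ₀ + 2 * r) ⊆ I ∧
      ∀ x ∈ Icc (ξ₀ - 2 * r) (ξ₀ + 2 * r), ∀ ξ ∈ Ioo (ξ₀ - r) (ξ₀ + r),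
      ∀ t ∈ Icc (t₀ - 1) (t₀ + 1), ∀ τ ∈ Icc (t₀ - 1) (t₀ + 1), τ < t →
        |greenXi G (x, t, ξ, τ) - parametrixXi Z σ γ β q x t ξ τ| ≤ C := by
  obtain ⟨ρ, hρ, hball⟩ := Metric.isOpen_iff.1 hI ξ₀ hξ₀
  set r := ρ / 4 with hr
  have hr0 : 0 < r := by positivity
  set xl := ξ₀ - 2 * r with hxl
  set xr := ξ₀ + 2 * r with hxr
  have hlr : xl < xr := by linarith
  have hJ : Icc xl xr ⊆ I := by
    refine subset_trans ?_ hball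
    rw [Real.ball_eq_Ioo]
    exact Icc_subset_Ioo (by linarith) (by linarith)
  have hΩ := isOpen_afterPole hI
  have hH := contDiffOn_greenRemainder hG h hI
  have hR := h.contDiffOn_parametrixError hI
  obtain ⟨K, hK0, hK⟩ := h.exists_bound_error hI hJ
  obtain ⟨M₂, hM₂⟩ := h.exists_bound_lateral hI hJ hr0
  -- bound for `∂G/∂ξ` on the lateral boundary
  obtain ⟨M₁, hM₁⟩ : ∃ M₁, ∀ x ∈ ({xl, xr} : Set ℝ), ∀ t ∈ Icc (t₀ - 1) (t₀ + 1),
      ∀ ξ ∈ Icc (ξ₀ - r) (ξ₀ + r), ∀ τ ∈ Icc (t₀ - 1) (t₀ + 1), |greenXi G (x, t, ξ, τ)| ≤ M₁ := by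
    have hcomp : IsCompact (({xl, xr} : Set ℝ) ×ˢ Icc (t₀ - 1) (t₀ + 1) ×ˢ
        Icc (ξ₀ - r) (ξ₀ + r) ×ˢ Icc (t₀ - 1) (t₀ + 1)) :=
      (Set.toFinite _).isCompact.prod (isCompact_Icc.prod (isCompact_Icc.prod isCompact_Icc))
    obtain ⟨M, hM⟩ := hcomp.exists_bound_of_continuousOn
      ((hG.contDiffOn_greenXi hI).continuousOn.mono (by
        rintro ⟨x, t, ξ, τ⟩ ⟨hx, -, hξ, -⟩
        simp only at hx hξ
        have hx' : x ∈ Icc xl xr := by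
          rcases hx with rfl | rfl
          · exact left_mem_Icc.2 hlr.le
          · exact right_mem_Icc.2 hlr.le
        refine ⟨hJ hx', hJ ⟨by linarith [hξ.1], by linarith [hξ.2]⟩, ?_⟩
        rintro ⟨h1, -⟩
        simp only at h1
        rcases hx with rfl | rfl
        · linarith [hξ.1]
        · linarith [hξ.2]))
    exact ⟨M, fun x hx t ht ξ hξ τ hτ => hM (x, t, ξ, τ) ⟨hx, ht, hξ, hτ⟩⟩
  obtain ⟨Λ', hΛ'⟩ := isCompact_Icc.exists_bound_of_continuousOn (hc₀.mono hJ)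
  set Λ := max Λ' 0 with hΛ
  set M := max (M₁ + M₂) 0 with hM
  have hcpos : ∀ x ∈ Ioo xl xr, 0 ≤ c 2 x := by
    intro x hx
    have h1 := h.mul_σ_sq x (hJ (Ioo_subset_Icc_self hx))
    by_contra! hneg
    nlinarith [sq_nonneg (σ x)]
  have hcΛ : ∀ x ∈ Ioo xl xr, c 0 x ≤ Λ := fun x hx =>
    (le_abs_self _).trans ((hΛ' x (Ioo_subset_Icc_self hx)).trans (le_max_left _ _))
  refine ⟨r, hr0, Real.exp (Λ * 2) * (M + 2 * K * √2), by positivity, hJ, ?_⟩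
  intro x hx ξ hξ t ht τ hτ htτ
  have hmemA : ∀ x ∈ Icc xl xr, ∀ t ∈ Ioc τ (t₀ + 1), ∀ ξ ∈ Icc xl xr,
      (x, t, ξ, τ) ∈ afterPole I := fun x hx t ht ξ hξ => ⟨hJ hx, hJ hξ, ht.1⟩
  have hmem : ∀ x ∈ Icc xl xr, ∀ t ∈ Ioc τ (t₀ + 1), ∀ ξ ∈ Icc xl xr,
      ((x, t, 0, τ) : ℝ × ℝ × ℝ × ℝ) + (0, 0, ξ, 0) ∈ afterPole I := fun x hx t ht ξ hξ => by
    rw [line_add_xi]; exact hmemA x hx t ht ξ hξ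
  have hs2 : ∀ t ∈ Ioc τ (t₀ + 1), t - τ ≤ 2 := fun t ht => by linarith [ht.2, hτ.1]
  have htT : t ∈ Ioc τ (t₀ + 1) := ⟨htτ, ht.2⟩
  have hdXi : ∀ x ∈ Icc xl xr, ∀ t ∈ Ioc τ (t₀ + 1), ∀ ξ ∈ Icc xl xr,
      dirDeriv dirXi (greenRemainder G Z σ β q) (x, t, ξ, τ) =
        greenXi G (x, t, ξ, τ) - parametrixXi Z σ γ β q x t ξ τ := by
    intro x hx t ht ξ hξ
    have hp := hmemA x hx t ht ξ hξ
    rw [← h.dirDeriv_dirXi_parametrix hI hp]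
    exact dirDeriv_sub (hG.contDiffOn_green.mono afterPole_subset_offPole)
      (h.contDiffOn_parametrix hI) hΩ dirXi hp
  have hξJ : ξ ∈ Icc xl xr := ⟨by linarith [hξ.1], by linarith [hξ.2]⟩
  rw [← hdXi x hx t htT ξ hξJ]
  refine abs_le_of_abs_integral_mul_le (xl := xl) (xr := xr)
    (h := fun ξ => dirDeriv dirXi (greenRemainder G Z σ β q) (x, t, ξ, τ))
    (by linarith) (by linarith)
    ((hH.dirDeriv hΩ dirXi).continuousOn.comp (by fun_prop) (hmemA x hx t htT)) ?_ hξ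
  intro g hg hgc hgs
  have hg1 : ContDiff ℝ 1 g := hg.of_le (by simp)
  have hgs' : tsupport g ⊆ Ioo xl xr := hgs.trans (Ioo_subset_Ioo (by linarith) (by linarith))
  have hgl : g xl = 0 := image_eq_zero_of_notMem_tsupport fun hx => (hgs' hx).1.false
  have hgr : g xr = 0 := image_eq_zero_of_notMem_tsupport fun hx => (hgs' hx).2.false
  have hgξ : ∀ ξ, g ξ ≠ 0 → ξ ∈ Ioo (ξ₀ - r) (ξ₀ + r) := fun ξ hξ => hgs (subset_tsupport _ hξ)
  set A := ∫ ξ in xl..xr, |g ξ| with hA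
  have hA0 : 0 ≤ A := intervalIntegral.integral_nonneg hlr.le fun ξ _ => abs_nonneg _
  have hdg : Continuous (deriv g) := hg1.continuous_deriv le_rfl
  have hγ : ContinuousOn (fun ξ => ((0, 0, ξ, 0) : ℝ × ℝ × ℝ × ℝ)) (Icc xl xr) := by fun_prop
  have hψ : ContinuousOn (deriv g) (Icc xl xr) := hdg.continuousOn
  have hint : ∀ {f : ℝ × ℝ × ℝ × ℝ → ℝ}, ContinuousOn f (afterPole I) → ∀ x ∈ Icc xl xr,
      ∀ t ∈ Ioc τ (t₀ + 1), IntervalIntegrable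
        (fun ξ => deriv g ξ * f ((x, t, 0, τ) + (0, 0, ξ, 0))) volume xl xr := fun hf x hx t ht =>
    ContinuousOn.intervalIntegrable_of_Icc hlr.le
      (continuousOn_mul_translate hf hγ hψ (hmem x hx t ht))
  have hmax := abs_le_of_parabolic (a := c 2) (c₁ := c 1) (c₀ := c 0) (xl := xl) (xr := xr)
    (τ := τ) (T := t₀ + 1) (M := M * A) (K := K * A) (Λ := Λ)
    (u := fun x t => ∫ ξ in xl..xr,
      deriv g ξ * greenRemainder G Z σ β q ((x, t, 0, τ) + (0, 0, ξ, 0)))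
    (ux := fun x t => ∫ ξ in xl..xr,
      deriv g ξ * dirDeriv dirX (greenRemainder G Z σ β q) ((x, t, 0, τ) + (0, 0, ξ, 0)))
    (uxx := fun x t => ∫ ξ in xl..xr, deriv g ξ *
      dirDeriv dirX (dirDeriv dirX (greenRemainder G Z σ β q)) ((x, t, 0, τ) + (0, 0, ξ, 0)))
    (F := fun x t => -∫ ξ in xl..xr,
      deriv g ξ * parametrixError Z σ β q ((x, t, 0, τ) + (0, 0, ξ, 0)))
    hcpos hcΛ (by positivity) (by positivity) (le_max_right _ _) ?_ ?_ ?_ ?_ ?_ ?_ ?_ t htT x hx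
  · simp only [line_add_xi] at hmax
    rw [integral_deriv_mul_lineXi hH hΩ hg1 hlr.le hgl hgr (hmemA x hx t htT), abs_neg] at hmax
    refine hmax.trans ?_
    have hΛ0 : 0 ≤ Λ := le_max_right _ _
    have hs := hs2 t htT
    have hsq : √(t - τ) ≤ √2 := Real.sqrt_le_sqrt hs
    calc Real.exp (Λ * (t - τ)) * (M * A + 2 * (K * A) * √(t - τ))
        ≤ Real.exp (Λ * 2) * (M * A + 2 * (K * A) * √2) := by gcongr
      _ = _ := by ring
  · -- continuity
    rintro ⟨x, t⟩ ⟨hx, ht⟩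
    have hc := continuousAt_integral_translate hlr.le hH.continuousOn hΩ hγ hψ (hmem x hx t ht)
    exact (ContinuousAt.comp (f := fun p : ℝ × ℝ => ((p.1, p.2, 0, τ) : ℝ × ℝ × ℝ × ℝ))
      (x := (x, t)) hc (by fun_prop)).continuousWithinAt
  · exact fun x hx => tendsto_integral_greenRemainder hG h hI hlr hJ hg hgc hgs' τ hx
  · -- the lateral boundary
    have hlat : ∀ x ∈ ({xl, xr} : Set ℝ), ∀ t ∈ Ioc τ (t₀ + 1), |∫ ξ in xl..xr,
        deriv g ξ * greenRemainder G Z σ β q ((x, t, 0, τ) + (0, 0, ξ, 0))| ≤ M * A := by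
      intro x hx t ht
      have hx' : x ∈ Icc xl xr := by
        rcases hx with rfl | rfl
        · exact left_mem_Icc.2 hlr.le
        · exact right_mem_Icc.2 hlr.le
      simp only [line_add_xi]
      refine abs_integral_deriv_mul_lineXi_le hH hΩ hg1 hlr.le hgl hgr (hmemA x hx' t ht) ?_
      intro ξ hξ hne
      have hξr := hgξ ξ hne
      rw [hdXi x hx' t ht ξ hξ]
      have h1 := hM₁ x hx t ⟨by linarith [hτ.1, ht.1], ht.2⟩ ξ (Ioo_subset_Icc_self hξr) τ hτ
      have h2 := hM₂ x hx' ξ hξ (by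
        rcases hx with rfl | rfl
        · rw [abs_sub_comm]; exact le_trans (by linarith [hξr.1]) (le_abs_self _)
        · exact le_trans (by linarith [hξr.2]) (le_abs_self _)) t τ ht.1 (hs2 t ht)
      exact (abs_sub _ _).trans ((add_le_add h1 h2).trans (le_max_left _ _))
    exact fun t ht => ⟨hlat xl (by simp) t ht, hlat xr (by simp) t ht⟩
  · intro t ht x hx
    exact hasDerivAt_integral_translate hlr.le hH hΩ hγ hψ (hasDerivAt_lineX t 0 τ)
      (hmem x (Ioo_subset_Icc_self hx) t ht)
  · intro t ht x hx
    exact hasDerivAt_integral_translate hlr.le (hH.dirDeriv hΩ dirX) hΩ hγ hψ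
      (hasDerivAt_lineX t 0 τ) (hmem x (Ioo_subset_Icc_self hx) t ht)
  · intro t ht x hx
    have hx' := Ioo_subset_Icc_self hx
    refine (hasDerivAt_integral_translate hlr.le hH hΩ hγ hψ
      (hasDerivAt_lineT x 0 τ) (hmem x hx' t ht)).congr_deriv ?_
    have i2 := (hint ((hH.dirDeriv hΩ dirX).dirDeriv hΩ dirX).continuousOn x hx' t ht).const_mul
      (c 2 x)
    have i1 := (hint (hH.dirDeriv hΩ dirX).continuousOn x hx' t ht).const_mul (c 1 x)
    have i0 := (hint hH.continuousOn x hx' t ht).const_mul (c 0 x)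
    have iR := hint hR.continuousOn x hx' t ht
    rw [← intervalIntegral.integral_const_mul, ← intervalIntegral.integral_const_mul,
      ← intervalIntegral.integral_const_mul, ← intervalIntegral.integral_add i2 i1,
      ← intervalIntegral.integral_add (i2.add i1) i0, ← sub_eq_add_neg,
      ← intervalIntegral.integral_sub ((i2.add i1).add i0) iR]
    refine intervalIntegral.integral_congr fun ξ hξ => ?_
    rw [uIcc_of_le hlr.le] at hξ
    rw [dirDeriv_dirT_greenRemainder hG h hI (hmem x hx' t ht ξ hξ)]
    simp only [line_add_xi]
    ring
  · intro t ht x hx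
    have hx' := Ioo_subset_Icc_self hx
    simp only [line_add_xi]
    rw [abs_neg]
    refine (abs_integral_deriv_mul_lineXi_le (M := K / √(t - τ)) hR hΩ hg1 hlr.le hgl hgr
      (hmemA x hx' t ht) ?_).trans (by rw [← hA]; apply le_of_eq; ring)
    intro ξ hξ _
    rw [h.dirDeriv_dirXi_parametrixError hI (hmemA x hx' t ht ξ hξ)]
    exact hK x hx' ξ hξ t τ ht.1 (hs2 t ht)

end GradientBound

/-! ### The kernel of the jump relation -/

section Jump

theorem intervalIntegrable_div_sqrt (C : ℝ) {t : ℝ} (ht : 0 ≤ t) :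
    IntervalIntegrable (fun τ => C / √(t - τ)) volume 0 t := by
  have h1 : IntervalIntegrable (fun s : ℝ => s ^ (-(1 / 2) : ℝ)) volume 0 t :=
    intervalIntegral.intervalIntegrable_rpow' (by norm_num)
  have h2 : IntervalIntegrable (fun s : ℝ => C / √s) volume 0 t := by
    refine (h1.const_mul C).congr fun s hs => ?_
    rw [uIoc_of_le ht] at hs
    rw [Real.rpow_neg hs.1.le, Real.sqrt_eq_rpow]
    exact (div_eq_mul_inv _ _).symm
  have h3 := h2.comp_sub_left t
  rw [sub_zero, sub_self] at h3
  exact h3.symm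

/-- The kernel `N_s(d) d / (2s)` of the double layer potential of the heat equation for a
boundary at rest at distance `d`. -/
noncomputable def doubleLayerKernel (s d : ℝ) : ℝ := heatKernel s d * (d / (2 * s))

theorem hasDerivAt_heatPrimitive_time {t τ : ℝ} (h : τ < t) (d : ℝ) :
    HasDerivAt (fun τ => heatPrimitive (d / √(t - τ))) (doubleLayerKernel (t - τ) d) τ := by
  have hs : 0 < t - τ := sub_pos.2 h
  have h1 : HasDerivAt (fun τ => t - τ) (-1) τ := (hasDerivAt_id τ).const_sub t
  have hsq := (Real.sqrt_pos.2 hs).ne'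
  have h2 := (hasDerivAt_heatPrimitive (d / √(t - τ))).comp τ
    ((hasDerivAt_const τ d).div (h1.sqrt hs.ne') hsq)
  refine h2.congr_deriv ?_
  rw [doubleLayerKernel, ← heatKernel_scale hs]
  have e := Real.sq_sqrt hs.le
  rw [e]
  field_simp
  ring

theorem continuousOn_doubleLayerKernel (t d : ℝ) :
    ContinuousOn (fun τ => doubleLayerKernel (t - τ) d) (Iio t) := by
  unfold doubleLayerKernel
  have h1 : ContinuousOn (fun τ => heatKernel (t - τ) d) (Iio t) :=
    contDiffOn_heatKernel.continuousOn.comp (f := fun τ => (t - τ, d)) (by fun_prop)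
      fun τ hτ => by simpa using hτ
  refine h1.mul (ContinuousOn.div (by fun_prop) (by fun_prop) fun τ hτ => ?_)
  have : 0 < t - τ := sub_pos.2 hτ
  positivity

theorem aestronglyMeasurable_of_continuousOn_Ico {f : ℝ → ℝ} {a b : ℝ} (hab : a ≤ b)
    (hf : ContinuousOn f (Ico a b)) : AEStronglyMeasurable f (volume.restrict (uIoc a b)) := by
  rw [uIoc_of_le hab, ← restrict_Ico_eq_restrict_Ioc]
  exact hf.aestronglyMeasurable measurableSet_Ico

theorem intervalIntegrable_of_abs_le_div_sqrt {f : ℝ → ℝ} {t C : ℝ} (ht : 0 ≤ t)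
    (hf : ContinuousOn f (Ico 0 t)) (hC : ∀ τ ∈ Ico 0 t, |f τ| ≤ C / √(t - τ)) :
    IntervalIntegrable f volume 0 t := by
  refine (intervalIntegrable_div_sqrt C ht).mono_fun'
    (aestronglyMeasurable_of_continuousOn_Ico ht hf) ?_
  rw [uIoc_of_le ht, ← restrict_Ico_eq_restrict_Ioc]
  exact (ae_restrict_iff' measurableSet_Ico).2 (Eventually.of_forall hC)

theorem intervalIntegrable_doubleLayerKernel {t d : ℝ} (ht : 0 ≤ t) (hd : 0 < d) :
    IntervalIntegrable (fun τ => doubleLayerKernel (t - τ) d) volume 0 t := by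
  refine intervalIntegrable_of_abs_le_div_sqrt (C := 2 / d) ht
    ((continuousOn_doubleLayerKernel t d).mono fun τ hτ => hτ.2) fun τ hτ => ?_
  have hs : 0 < t - τ := sub_pos.2 hτ.2
  have h1 := sq_div_mul_heatKernel_le hs d
  have h0 := heatKernel_pos hs d
  rw [abs_of_nonneg (by unfold doubleLayerKernel; positivity)]
  calc doubleLayerKernel (t - τ) d = (1 / (2 * d)) * (d ^ 2 / (t - τ) * heatKernel (t - τ) d) := by
        unfold doubleLayerKernel; field_simp
    _ ≤ (1 / (2 * d)) * (4 / √(t - τ)) := by gcongr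
    _ = _ := by field_simp; norm_num

theorem integral_doubleLayerKernel {t d : ℝ} (ht : 0 < t) (hd : 0 < d) :
    ∫ τ in (0 : ℝ)..t, doubleLayerKernel (t - τ) d = 1 / 2 - heatPrimitive (d / √t) := by
  refine intervalIntegral.integral_eq_sub_of_hasDerivAt_of_tendsto ht
    (fun τ hτ => hasDerivAt_heatPrimitive_time hτ.2 d)
    (intervalIntegrable_doubleLayerKernel ht.le hd) ?_ ?_
  · have h := (hasDerivAt_heatPrimitive_time ht d).continuousAt.tendsto
    rw [sub_zero] at h
    exact h.mono_left nhdsWithin_le_nhds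
  · refine tendsto_heatPrimitive_atTop.comp ?_
    have h1 : Tendsto (fun τ => √(t - τ)) (𝓝[<] t) (𝓝[>] 0) := by
      refine tendsto_nhdsWithin_iff.2 ⟨?_, ?_⟩
      · have : ContinuousAt (fun τ => √(t - τ)) t := by fun_prop
        have h2 := this.tendsto
        rw [sub_self, Real.sqrt_zero] at h2
        exact h2.mono_left nhdsWithin_le_nhds
      · filter_upwards [self_mem_nhdsWithin] with τ hτ using Real.sqrt_pos.2 (sub_pos.2 hτ)
    simp only [div_eq_mul_inv]
    exact Tendsto.const_mul_atTop hd (tendsto_inv_nhdsGT_zero.comp h1)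

/-- As `d ↓ 0`, the kernel `doubleLayerKernel (t - τ) d` concentrates with mass `1 / 2` at
`τ = t`. -/
theorem tendsto_integral_mul_doubleLayerKernel {Ψ : ℝ → ℝ} {t : ℝ} (ht : 0 < t)
    (hΨ : ContinuousOn Ψ (Icc 0 t)) :
    Tendsto (fun d => ∫ τ in (0 : ℝ)..t, Ψ τ * doubleLayerKernel (t - τ) d) (𝓝[>] 0)
      (𝓝 (1 / 2 * Ψ t)) := by
  have hkey := tendsto_setIntegral_peak_smul_of_integrableOn_of_tendsto (μ := volume)
    (s := Ico 0 t) (t := Ico 0 t) (x₀ := t) (l := 𝓝[>] (0 : ℝ)) (g := Ψ) (a := Ψ t)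
    (φ := fun d τ => 2 * doubleLayerKernel (t - τ) d) measurableSet_Ico measurableSet_Ico
    subset_rfl self_mem_nhdsWithin (by simp) ?_ ?_ ?_ ?_
    ((hΨ.integrableOn_Icc).mono_set Ico_subset_Icc_self)
    ((hΨ t (right_mem_Icc.2 ht.le)).mono_left (nhdsWithin_mono _ Ico_subset_Icc_self))
  · have h2 := hkey.const_mul (1 / 2)
    refine h2.congr fun d => ?_
    rw [intervalIntegral.integral_of_le ht.le, ← integral_Ico_eq_integral_Ioc,
      ← integral_const_mul]
    refine integral_congr_ae (Eventually.of_forall fun τ => ?_)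
    simp only [smul_eq_mul]
    ring
  · filter_upwards [self_mem_nhdsWithin] with d hd τ hτ
    have hd' : 0 < d := hd
    have hs : 0 < t - τ := sub_pos.2 hτ.2
    have := heatKernel_pos hs d
    unfold doubleLayerKernel
    positivity
  · intro u hu htu
    obtain ⟨δ, hδ, hball⟩ := Metric.isOpen_iff.1 hu t htu
    rw [Metric.tendstoUniformlyOn_iff]
    intro ε hε
    have hlim : Tendsto (fun d : ℝ => 1 / √δ * (d / δ)) (𝓝[>] 0) (𝓝 0) := by
      have : ContinuousAt (fun d : ℝ => 1 / √δ * (d / δ)) 0 := by fun_prop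
      have h2 := this.tendsto
      simp only [zero_div, mul_zero] at h2
      exact h2.mono_left nhdsWithin_le_nhds
    filter_upwards [self_mem_nhdsWithin, hlim.eventually (gt_mem_nhds hε)] with d hd hlt τ hτ
    have hd' : 0 < d := hd
    have hs : 0 < t - τ := sub_pos.2 hτ.1.2
    have hsδ : δ ≤ t - τ := by
      by_contra! hlt'
      refine hτ.2 (hball ?_)
      rw [Metric.mem_ball, Real.dist_eq, abs_sub_comm, abs_of_pos hs]
      exact hlt'
    have h0 := heatKernel_pos hs d
    simp only [Pi.zero_apply, dist_zero_left, Real.norm_eq_abs]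
    rw [abs_of_nonneg (by unfold doubleLayerKernel; positivity)]
    refine lt_of_le_of_lt ?_ hlt
    calc 2 * doubleLayerKernel (t - τ) d = heatKernel (t - τ) d * (d / (t - τ)) := by
          unfold doubleLayerKernel; field_simp
      _ ≤ 1 / √(t - τ) * (d / (t - τ)) := by gcongr; exact heatKernel_le hs d
      _ ≤ _ := by gcongr
  · have hlim : Tendsto (fun d => 2 * (1 / 2 - heatPrimitive (d / √t))) (𝓝[>] 0) (𝓝 1) := by
      have h1 : ContinuousAt (fun d => heatPrimitive (d / √t)) 0 :=
        ContinuousAt.comp (hasDerivAt_heatPrimitive _).continuousAt (by fun_prop)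
      have h2 := h1.tendsto
      have h3 : heatPrimitive 0 = 0 := by simp [heatPrimitive]
      rw [zero_div, h3] at h2
      have h4 := (h2.const_sub (1 / 2)).const_mul 2
      norm_num at h4
      exact h4.mono_left nhdsWithin_le_nhds
    refine hlim.congr' ?_
    filter_upwards [self_mem_nhdsWithin] with d hd
    rw [← integral_doubleLayerKernel ht hd, intervalIntegral.integral_of_le ht.le,
      ← integral_Ico_eq_integral_Ioc, ← integral_const_mul]
  · refine Eventually.of_forall fun d => ?_
    exact (continuousOn_const.mul ((continuousOn_doubleLayerKernel t d).mono
      fun τ hτ => hτ.2)).aestronglyMeasurable measurableSet_Ico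

theorem abs_exp_neg_sub_exp_neg_le {p q m : ℝ} (hp : m ≤ p) (hq : m ≤ q) :
    |Real.exp (-p) - Real.exp (-q)| ≤ |p - q| * Real.exp (-m) := by
  have key : ∀ p q : ℝ, m ≤ p → p ≤ q →
      |Real.exp (-p) - Real.exp (-q)| ≤ |p - q| * Real.exp (-m) := by
    intro p q hp hpq
    have h1 := Real.add_one_le_exp (p - q)
    have h2 : Real.exp (-q) = Real.exp (-p) * Real.exp (p - q) := by
      rw [← Real.exp_add]; congr 1; ring
    have h3 : Real.exp (-p) ≤ Real.exp (-m) := Real.exp_le_exp.2 (by linarith)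
    have h4 : Real.exp (-q) ≤ Real.exp (-p) := Real.exp_le_exp.2 (by linarith)
    rw [abs_of_nonneg (by linarith), abs_sub_comm, abs_of_nonneg (by linarith)]
    calc Real.exp (-p) - Real.exp (-q) = (1 - Real.exp (p - q)) * Real.exp (-p) := by rw [h2]; ring
      _ ≤ (q - p) * Real.exp (-p) :=
        mul_le_mul_of_nonneg_right (by linarith) (Real.exp_pos _).le
      _ ≤ (q - p) * Real.exp (-m) := mul_le_mul_of_nonneg_left h3 (by linarith)
  rcases le_total p q with h | h
  · exact key p q hp h
  · rw [abs_sub_comm, abs_sub_comm p]; exact key q p hq h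

/-- The motion of the boundary (a displacement `e = O(s)`) and the variation of the coefficients
(`A - A₀ = O(|d| + s)`) change the double layer kernel by `O(s^{-1/2})` only. -/
theorem abs_doubleLayerKernel_sub_le {s d e A A₀ L K D : ℝ} (hs : 0 < s) (hs2 : s ≤ 2)
    (hL : 0 ≤ L) (hK : 0 ≤ K) (hdD : |d| ≤ D) (he : |e| ≤ L * s) (hA : |A| ≤ K)
    (hAA : |A - A₀| ≤ K * (|d| + s)) :
    |doubleLayerKernel s (d + e) * A - doubleLayerKernel s d * A₀| ≤
      (L * K + K * Real.exp (L ^ 2 / 2) * (2 * L + L ^ 2 * D) + K * (4 + D)) / √s := by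
  have hd0 := abs_nonneg d
  have hD : 0 ≤ D := hd0.trans hdD
  have hN1 := heatKernel_pos hs (d + e)
  have hN2 := heatKernel_pos hs d
  have hl1 := heatKernel_le hs (d + e)
  have hl2 := heatKernel_le hs d
  have hsq := sq_div_mul_heatKernel_le hs d
  have hrt : 0 ≤ 1 / √s := by positivity
  have T1 : |heatKernel s (d + e) * (e / (2 * s)) * A| ≤ L * K / √s := by
    rw [abs_mul, abs_mul, abs_of_pos hN1, abs_div, abs_of_pos (by positivity : 0 < 2 * s)]
    calc heatKernel s (d + e) * (|e| / (2 * s)) * |A|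
        ≤ 1 / √s * (L * s / (2 * s)) * K := by gcongr
      _ = L * K / √s / 2 := by field_simp
      _ ≤ L * K / √s := half_le_self (by positivity)
  have T3 : |heatKernel s d * (d / (2 * s)) * (A - A₀)| ≤ K * (4 + D) / √s := by
    rw [abs_mul, abs_mul, abs_of_pos hN2, abs_div, abs_of_pos (by positivity : 0 < 2 * s)]
    calc heatKernel s d * (|d| / (2 * s)) * |A - A₀|
        ≤ heatKernel s d * (|d| / (2 * s)) * (K * (|d| + s)) := by gcongr
      _ = K / 2 * (|d| ^ 2 / s * heatKernel s d + heatKernel s d * |d|) := by field_simp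
      _ ≤ K / 2 * (4 / √s + 1 / √s * D) := by rw [sq_abs]; gcongr
      _ = K * (4 + D) / √s / 2 := by ring
      _ ≤ K * (4 + D) / √s := half_le_self (by positivity)
  have T2 : |(heatKernel s (d + e) - heatKernel s d) * (d / (2 * s)) * A| ≤
      K * Real.exp (L ^ 2 / 2) * (2 * L + L ^ 2 * D) / √s := by
    have hL2 : 0 ≤ (L * s) := by positivity
    have he2 : e ^ 2 ≤ (L * s) ^ 2 := sq_le_sq' (by linarith [(abs_le.1 he).1]) (abs_le.1 he).2
    have hm1 : d ^ 2 / (8 * s) - L ^ 2 / 2 ≤ (d + e) ^ 2 / (4 * s) := by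
      have h1 : d ^ 2 - 2 * (L * s) ^ 2 ≤ 2 * (d + e) ^ 2 := by nlinarith [sq_nonneg (d + 2 * e)]
      have h2 : L ^ 2 / 2 ≥ 2 * (L * s) ^ 2 / (8 * s) := by
        have : 2 * (L * s) ^ 2 / (8 * s) = L ^ 2 * s / 4 := by field_simp; ring
        rw [this]; nlinarith [sq_nonneg L]
      calc d ^ 2 / (8 * s) - L ^ 2 / 2 ≤ d ^ 2 / (8 * s) - 2 * (L * s) ^ 2 / (8 * s) := by linarith
        _ = (d ^ 2 - 2 * (L * s) ^ 2) / (8 * s) := by ring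
        _ ≤ 2 * (d + e) ^ 2 / (8 * s) := by gcongr
        _ = _ := by field_simp; ring
    have hm2 : d ^ 2 / (8 * s) - L ^ 2 / 2 ≤ d ^ 2 / (4 * s) := by
      have : d ^ 2 / (8 * s) ≤ d ^ 2 / (4 * s) := by gcongr; norm_num
      nlinarith [sq_nonneg L]
    have hexp := abs_exp_neg_sub_exp_neg_le hm1 hm2
    have hdiff : |(d + e) ^ 2 / (4 * s) - d ^ 2 / (4 * s)| ≤ |d| * L / 2 + L ^ 2 * s / 4 := by
      have e1 : (d + e) ^ 2 / (4 * s) - d ^ 2 / (4 * s) = (2 * d * e + e ^ 2) / (4 * s) := by ring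
      rw [e1, abs_div, abs_of_pos (by positivity : 0 < 4 * s), div_le_iff₀ (by positivity)]
      have e2 : |2 * d * e + e ^ 2| ≤ 2 * |d| * (L * s) + (L * s) ^ 2 := by
        refine (abs_add_le _ _).trans (add_le_add ?_ ?_)
        · rw [abs_mul, abs_mul, abs_two]; gcongr
        · rwa [abs_of_nonneg (sq_nonneg e)]
      exact e2.trans_eq (by ring)
    have hsplit : Real.exp (-(d ^ 2 / (8 * s) - L ^ 2 / 2)) =
        Real.exp (L ^ 2 / 2) * Real.exp (-(d ^ 2 / (8 * s))) := by
      rw [← Real.exp_add]; congr 1; ring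
    rw [hsplit] at hexp
    have hn : (√(4 * Real.pi * s))⁻¹ ≤ 1 / √s := by
      rw [one_div]
      refine inv_anti₀ (Real.sqrt_pos.2 hs) (Real.sqrt_le_sqrt ?_)
      nlinarith [Real.pi_gt_three]
    have hg1 : d ^ 2 / s * Real.exp (-(d ^ 2 / (8 * s))) ≤ 8 := by
      have h := Real.add_one_le_exp (d ^ 2 / (8 * s))
      rw [Real.exp_neg, ← div_eq_mul_inv, div_le_iff₀ (Real.exp_pos _)]
      have : d ^ 2 / s = 8 * (d ^ 2 / (8 * s)) := by field_simp
      linarith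
    have hg2 : Real.exp (-(d ^ 2 / (8 * s))) ≤ 1 := Real.exp_le_one_iff.2 (by
      have : 0 ≤ d ^ 2 / (8 * s) := by positivity
      linarith)
    have hsub : heatKernel s (d + e) - heatKernel s d = (√(4 * Real.pi * s))⁻¹ *
        (Real.exp (-((d + e) ^ 2 / (4 * s))) - Real.exp (-(d ^ 2 / (4 * s)))) := by
      simp only [heatKernel, neg_div]; ring
    have hEpos := Real.exp_pos (L ^ 2 / 2)
    have hgpos := Real.exp_pos (-(d ^ 2 / (8 * s)))
    rw [hsub, abs_mul, abs_mul, abs_mul, abs_div, abs_of_pos (by positivity : 0 < 2 * s),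
      abs_of_pos (by positivity : 0 < (√(4 * Real.pi * s))⁻¹)]
    generalize Real.exp (L ^ 2 / 2) = E at *
    generalize Real.exp (-(d ^ 2 / (8 * s))) = g at *
    calc _ ≤ 1 / √s * ((|d| * L / 2 + L ^ 2 * s / 4) * (E * g)) * (|d| / (2 * s)) * K := by
          gcongr
          exact hexp.trans (mul_le_mul_of_nonneg_right hdiff (by positivity))
      _ = 1 / √s * K * E * (L / 4 * (|d| ^ 2 / s * g) + L ^ 2 / 8 * (|d| * g)) := by
          field_simp; ring
      _ ≤ 1 / √s * K * E * (L / 4 * 8 + L ^ 2 / 8 * (D * 1)) := by rw [sq_abs]; gcongr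
      _ ≤ 1 / √s * K * E * (2 * L + L ^ 2 * D) := by
          refine mul_le_mul_of_nonneg_left ?_ (by positivity)
          linarith [mul_nonneg (sq_nonneg L) hD]
      _ = _ := by ring
  have e : doubleLayerKernel s (d + e) * A - doubleLayerKernel s d * A₀ =
      heatKernel s (d + e) * (e / (2 * s)) * A +
        (heatKernel s (d + e) - heatKernel s d) * (d / (2 * s)) * A +
        heatKernel s d * (d / (2 * s)) * (A - A₀) := by
    unfold doubleLayerKernel; ring
  rw [e, add_div, add_div]
  exact (abs_add_le _ _).trans (add_le_add ((abs_add_le _ _).trans (add_le_add T1 T2)) T3)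

end Jump

/-! ### The jump relation -/

section JumpRelation

variable {I : Set ℝ} {c : ℕ → ℝ → ℝ} {G : ℝ → ℝ → ℝ → ℝ → ℝ} {Z σ β γ q y Ψ : ℝ → ℝ}

/-- Near the boundary curve, `∂G/∂ξ` is the kernel of a boundary at rest up to `O(s^{-1/2})`. -/
theorem exists_bound_greenXi_near_boundary (hG : IsGreenFunction I 2 c G)
    (h : IsLiouvilleData I c Z σ β γ q) (hI : IsOpen I) (hc₀ : ContinuousOn (c 0) I)
    (hy : LocallyLipschitzOn (Ici 0) y) (hyI : ∀ t ≥ 0, y t ∈ I) {t₀ : ℝ} (ht₀ : 0 ≤ t₀) :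
    ∃ δ > 0, ∃ C, 0 ≤ C ∧ ∀ t ≥ 0, |t - t₀| < δ → ∀ τ ≥ 0, |τ - t₀| < δ → τ < t →
      ∀ x ∈ Ico (y t) (y t + δ), x ∈ I ∧ |Z x - Z (y t)| ≤ C ∧
        |greenXi G (x, t, y τ, τ) -
          doubleLayerKernel (t - τ) (Z x - Z (y t)) * (c 2 (y t))⁻¹| ≤ C / √(t - τ) := by
  have hξ₀ := hyI t₀ ht₀
  obtain ⟨r, hr, C₁, hC₁, hJ, hkey⟩ :=
    exists_bound_greenXi_sub_parametrixXi hG h hI hc₀ hξ₀ t₀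
  obtain ⟨C, hC, hb⟩ := h.exists_bounds hI hJ
  obtain ⟨L, u, hu, hLip⟩ := hy ht₀
  -- the smooth factor of the leading term is Lipschitz near the pole
  obtain ⟨K, V, hV, hKV⟩ : ∃ K : NNReal, ∃ V ∈ 𝓝 ((y t₀, y t₀, 0) : ℝ × ℝ × ℝ),
      LipschitzOnWith K (fun z : ℝ × ℝ × ℝ => σ z.2.1 ^ 2 * gaugeFactor β q z.1 z.2.1 z.2.2) V := by
    refine ContDiffAt.exists_lipschitzOnWith (𝕂 := ℝ) ?_
    have hfst : ContDiffAt ℝ 1 (fun z : ℝ × ℝ × ℝ => z.1) (y t₀, y t₀, 0) := contDiffAt_fst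
    have hsnd : ContDiffAt ℝ 1 (fun z : ℝ × ℝ × ℝ => z.2.1) (y t₀, y t₀, 0) := by fun_prop
    have hthd : ContDiffAt ℝ 1 (fun z : ℝ × ℝ × ℝ => z.2.2) (y t₀, y t₀, 0) := by fun_prop
    have hat : ∀ {f : ℝ → ℝ}, ContDiffOn ℝ ∞ f I → ContDiffAt ℝ 1 f (y t₀) := fun hf =>
      (hf.contDiffAt (hI.mem_nhds hξ₀)).of_le (by simp)
    have hβ := hat (h.contDiffOn_β hI)
    refine (((hat h.contDiffOn_σ).comp (y t₀, y t₀, 0) hsnd).pow 2).mul (ContDiffAt.exp ?_)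
    exact ((hβ.comp (y t₀, y t₀, 0) hfst).sub (hβ.comp (y t₀, y t₀, 0) hsnd)).add
      (hthd.mul ((hat h.contDiffOn_q).comp (y t₀, y t₀, 0) hsnd))
  obtain ⟨η, hη, hηV⟩ := Metric.mem_nhds_iff.1 hV
  obtain ⟨δ₁, hδ₁, hδu⟩ := Metric.mem_nhdsWithin_iff.1 hu
  obtain ⟨δ₂, hδ₂, hyc⟩ := Metric.continuousWithinAt_iff.1
    (hy.continuousOn t₀ ht₀) (min (η / 2) (r / 2)) (by positivity)
  -- a common bound for the Lipschitz constants in the Liouville coordinate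
  set L' : ℝ := C * L with hL'
  have hL'0 : 0 ≤ L' := by positivity
  obtain ⟨K', hK'0, hK'1, hK'2⟩ : ∃ K' : ℝ, 0 ≤ K' ∧ K * (C + L + 1) ≤ K' ∧
      |σ (y t₀) ^ 2 * gaugeFactor β q (y t₀) (y t₀) 0| + K * η ≤ K' :=
    ⟨max (K * (C + L + 1)) (|σ (y t₀) ^ 2 * gaugeFactor β q (y t₀) (y t₀) 0| + K * η),
      le_max_of_le_left (by positivity), le_max_left _ _, le_max_right _ _⟩
  set B := L' * K' + K' * Real.exp (L' ^ 2 / 2) * (2 * L' + L' ^ 2 * C) + K' * (4 + C) with hB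
  have hB0 : 0 ≤ B := by positivity
  refine ⟨min (min δ₁ δ₂) (min (min (η / 2) r) 1), by positivity, C₁ * 2 + C + B, by positivity, ?_⟩
  intro t ht htδ τ hτ hτδ hτt x hx
  simp only [lt_min_iff] at htδ hτδ
  have hxδ : x - y t < min (min δ₁ δ₂) (min (min (η / 2) r) 1) := by linarith [hx.2]
  simp only [lt_min_iff] at hxδ
  obtain ⟨⟨t1, t2⟩, ⟨t3, t4⟩, t5⟩ := htδ
  obtain ⟨⟨s1, s2⟩, ⟨s3, s4⟩, s5⟩ := hτδ
  obtain ⟨⟨x1, x2⟩, ⟨x3, x4⟩, x5⟩ := hxδ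
  have hyt := hyc ht t2
  have hyτ := hyc hτ s2
  rw [Real.dist_eq, lt_min_iff] at hyt hyτ
  have hs : 0 < t - τ := sub_pos.2 hτt
  have hyt' := abs_lt.1 hyt.2
  have hyτ' := abs_lt.1 hyτ.2
  have hyt'' := abs_lt.1 hyt.1
  have hyτ'' := abs_lt.1 hyτ.1
  have ht' := abs_lt.1 t5
  have hτ' := abs_lt.1 s5
  have ht'' := abs_lt.1 t3
  have hτ'' := abs_lt.1 s3
  have hxJ : x ∈ Icc (y t₀ - 2 * r) (y t₀ + 2 * r) :=
    ⟨by linarith [hx.1], by linarith [hx.1]⟩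
  have hytJ : y t ∈ Icc (y t₀ - 2 * r) (y t₀ + 2 * r) := ⟨by linarith, by linarith⟩
  have hyτJ : y τ ∈ Icc (y t₀ - 2 * r) (y t₀ + 2 * r) := ⟨by linarith, by linarith⟩
  have hs2 : t - τ ≤ 2 := by linarith
  have hLy : |y t - y τ| ≤ L * (t - τ) := by
    have := hLip.dist_le_mul t (hδu ⟨t1, ht⟩) τ (hδu ⟨s1, hτ⟩)
    rwa [Real.dist_eq, Real.dist_eq, abs_of_pos hs] at this
  -- bounds for the two remainders
  have hrem := hkey x hxJ (y τ) ⟨by linarith, by linarith⟩ t ⟨by linarith, by linarith⟩ τ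
    ⟨by linarith, by linarith⟩ hτt
  obtain ⟨-, -, -, -, -, hpar⟩ := hb x hxJ (y τ) hyτJ
  obtain ⟨-, -, hpar⟩ := hpar t τ hτt hs2
  obtain ⟨hxd, hdC, -, -, -, -⟩ := hb x hxJ (y t) hytJ
  obtain ⟨-, -, hZup, -, -, -⟩ := hb (y t) hytJ (y τ) hyτJ
  set d := Z x - Z (y t) with hd
  have he : |Z (y t) - Z (y τ)| ≤ L' * (t - τ) := by
    refine hZup.trans ?_
    rw [hL', mul_assoc]
    exact mul_le_mul_of_nonneg_left hLy hC.le
  have hde : Z x - Z (y τ) = d + (Z (y t) - Z (y τ)) := by rw [hd]; ring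
  have hVx : ((x, y τ, t - τ) : ℝ × ℝ × ℝ) ∈ Metric.ball (y t₀, y t₀, 0) η := by
    simp only [Metric.mem_ball, Prod.dist_eq, Real.dist_eq, max_lt_iff, sub_zero, abs_lt]
    refine ⟨⟨?_, ?_⟩, ⟨?_, ?_⟩, ?_, ?_⟩ <;> linarith [hx.1]
  have hVt : ((y t, y t, 0) : ℝ × ℝ × ℝ) ∈ Metric.ball (y t₀, y t₀, 0) η := by
    simp only [Metric.mem_ball, Prod.dist_eq, Real.dist_eq, max_lt_iff, sub_zero, abs_lt]
    refine ⟨⟨?_, ?_⟩, ⟨?_, ?_⟩, ?_, ?_⟩ <;> linarith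
  set A := σ (y τ) ^ 2 * gaugeFactor β q x (y τ) (t - τ) with hA
  have hA₀ : σ (y t) ^ 2 * gaugeFactor β q (y t) (y t) 0 = (c 2 (y t))⁻¹ := by
    have := h.mul_σ_sq (y t) (hyI t ht)
    rw [gaugeFactor, sub_self, zero_mul, add_zero, Real.exp_zero, mul_one]
    exact eq_inv_of_mul_eq_one_right this
  have hAA : |A - (c 2 (y t))⁻¹| ≤ K' * (|d| + (t - τ)) := by
    rw [← hA₀]
    have h1 := hKV.dist_le_mul _ (hηV hVx) _ (hηV hVt)
    rw [Real.dist_eq] at h1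
    refine h1.trans ?_
    have h2 : dist ((x, y τ, t - τ) : ℝ × ℝ × ℝ) (y t, y t, 0) ≤ (C + L + 1) * (|d| + (t - τ)) := by
      have hd0 := abs_nonneg d
      have hL0 : (0 : ℝ) ≤ L := L.2
      simp only [Prod.dist_eq, Real.dist_eq, sub_zero, max_le_iff]
      rw [abs_sub_comm (y τ), abs_of_pos hs]
      have p1 := mul_nonneg hC.le hd0
      have p2 := mul_nonneg hC.le hs.le
      have p3 := mul_nonneg hL0 hd0
      have p4 := mul_nonneg hL0 hs.le
      have e : (C + L + 1) * (|d| + (t - τ)) =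
          C * |d| + C * (t - τ) + L * |d| + L * (t - τ) + |d| + (t - τ) := by ring
      rw [e]
      exact ⟨by linarith only [hxd, p1, p2, p3, p4, hd0, hs],
        by linarith only [hLy, p1, p2, p3, p4, hd0, hs], by linarith only [p1, p2, p3, p4, hd0]⟩
    calc (K : ℝ) * dist ((x, y τ, t - τ) : ℝ × ℝ × ℝ) (y t, y t, 0)
        ≤ K * ((C + L + 1) * (|d| + (t - τ))) := by gcongr
      _ = K * (C + L + 1) * (|d| + (t - τ)) := by ring
      _ ≤ _ := by gcongr
  have hAK : |A| ≤ K' := by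
    have h1 := hKV.dist_le_mul _ (hηV hVx) _ (hηV (Metric.mem_ball_self hη))
    rw [Real.dist_eq] at h1
    have h2 := mul_le_mul_of_nonneg_left (le_of_lt (Metric.mem_ball.1 hVx)) K.2
    have h3 := abs_sub_abs_le_abs_sub A (σ (y t₀) ^ 2 * gaugeFactor β q (y t₀) (y t₀) 0)
    simp only at h1
    have h4 : |A - σ (y t₀) ^ 2 * gaugeFactor β q (y t₀) (y t₀) 0| ≤ K * η := h1.trans h2
    linarith
  -- the error splits into the gradient of `G - P`, the lower-order terms of the parametrix, and
  -- the change of its leading term caused by the motion of the boundary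
  have hmain := abs_doubleLayerKernel_sub_le (d := d) (D := C) hs hs2 hL'0 hK'0 hdC he hAK hAA
  rw [← hde] at hmain
  refine ⟨hJ hxJ, by linarith [abs_nonneg d], ?_⟩
  have hN := heatKernel_le hs (Z x - Z (y τ))
  have hsq2 : C₁ ≤ C₁ * 2 / √(t - τ) := by
    have h1 : √(t - τ) ≤ 2 := by
      refine (Real.sqrt_le_sqrt hs2).trans ?_
      rw [Real.sqrt_le_left (by norm_num)]
      norm_num
    rw [le_div_iff₀ (Real.sqrt_pos.2 hs)]
    gcongr
  have e : greenXi G (x, t, y τ, τ) - doubleLayerKernel (t - τ) d * (c 2 (y t))⁻¹ =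
      (greenXi G (x, t, y τ, τ) - parametrixXi Z σ γ β q x t (y τ) τ) +
      (parametrixXi Z σ γ β q x t (y τ) τ - heatKernel (t - τ) (Z x - Z (y τ)) *
          ((Z x - Z (y τ)) / (2 * (t - τ))) * A) +
      (doubleLayerKernel (t - τ) (Z x - Z (y τ)) * A -
        doubleLayerKernel (t - τ) d * (c 2 (y t))⁻¹) := by
    unfold doubleLayerKernel; ring
  rw [e, add_div, add_div]
  refine (abs_add_le _ _).trans (add_le_add ((abs_add_le _ _).trans (add_le_add ?_ ?_)) hmain)
  · exact hrem.trans hsq2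
  · refine hpar.trans ?_
    calc C * heatKernel (t - τ) (Z x - Z (y τ)) ≤ C * (1 / √(t - τ)) := by gcongr
      _ = _ := by ring

end JumpRelation

section BoundaryLimit

variable {I : Set ℝ} {m : ℕ} {c : ℕ → ℝ → ℝ} {G : ℝ → ℝ → ℝ → ℝ → ℝ} {Z σ β γ q y Ψ : ℝ → ℝ}

theorem mem_offPole_of_time_lt (hyI : ∀ t ≥ 0, y t ∈ I) {x t τ : ℝ} (hx : x ∈ I) (hτ : 0 ≤ τ)
    (hτt : τ < t) : (x, t, y τ, τ) ∈ offPole I :=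
  ⟨hx, hyI τ hτ, fun h => hτt.ne' h.2⟩

theorem IsGreenFunction.continuousOn_greenXi_curve (hG : IsGreenFunction I m c G) (hI : IsOpen I)
    (hy : ContinuousOn y (Ici 0)) (hyI : ∀ t ≥ 0, y t ∈ I) {x t : ℝ} (hx : x ∈ I) :
    ContinuousOn (fun τ => greenXi G (x, t, y τ, τ)) (Ico 0 t) :=
  (hG.contDiffOn_greenXi hI).continuousOn.comp
    (continuousOn_const.prodMk (continuousOn_const.prodMk
      ((hy.mono fun _ hτ => hτ.1).prodMk continuousOn_id)))
    fun _ hτ => mem_offPole_of_time_lt hyI hx hτ.1 hτ.2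

theorem IsGreenFunction.potentialIntegrand_eq (hG : IsGreenFunction I m c G) (hI : IsOpen I)
    (hyI : ∀ t ≥ 0, y t ∈ I) {x t τ : ℝ} (hx : x ∈ I) (hτ : 0 ≤ τ) (hτt : τ < t) :
    potentialIntegrand G y Ψ x t τ = Ψ τ * greenXi G (x, t, y τ, τ) := by
  rw [potentialIntegrand, (hG.hasDerivAt_xi hI (mem_offPole_of_time_lt hyI hx hτ hτt)).deriv]

theorem IsGreenFunction.potential_eq_integral (hG : IsGreenFunction I m c G) (hI : IsOpen I)
    (hyI : ∀ t ≥ 0, y t ∈ I) {x t : ℝ} (hx : x ∈ I) (ht : 0 ≤ t) :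
    potential G y Ψ x t = ∫ τ in (0 : ℝ)..t, Ψ τ * greenXi G (x, t, y τ, τ) := by
  refine intervalIntegral.integral_congr_Ioo_of_le ht fun τ hτ => ?_
  exact hG.potentialIntegrand_eq hI hyI hx hτ.1.le hτ.2

/-- At a fixed time the comparison of `∂G/∂ξ` with the kernel of a boundary at rest holds over
the whole range of integration. -/
theorem exists_bound_greenXi_fixed_time (hG : IsGreenFunction I 2 c G)
    (h : IsLiouvilleData I c Z σ β γ q) (hI : IsOpen I) (hIup : IsUpperSet I)
    (hc₀ : ContinuousOn (c 0) I)
    (hy : LocallyLipschitzOn (Ici 0) y) (hyI : ∀ t ≥ 0, y t ∈ I) {t : ℝ} (ht : 0 < t) :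
    ∃ ε > 0, ∃ B, ∀ x ∈ Ico (y t) (y t + ε), ∀ τ ∈ Ico 0 t,
      |greenXi G (x, t, y τ, τ) -
        doubleLayerKernel (t - τ) (Z x - Z (y t)) * (c 2 (y t))⁻¹| ≤ B / √(t - τ) := by
  obtain ⟨δ, hδ, C, hC, hnear⟩ := exists_bound_greenXi_near_boundary hG h hI hc₀ hy hyI ht.le
  have hyt := hyI t ht.le
  have hcomp : IsCompact (Icc (y t) (y t + δ) ×ˢ Icc 0 (t - δ)) :=
    isCompact_Icc.prod isCompact_Icc
  have hcont : ContinuousOn (fun z : ℝ × ℝ => greenXi G (z.1, t, y z.2, z.2))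
      (Icc (y t) (y t + δ) ×ˢ Icc 0 (t - δ)) := by
    refine (hG.contDiffOn_greenXi hI).continuousOn.comp
      (f := fun z : ℝ × ℝ => ((z.1, t, y z.2, z.2) : ℝ × ℝ × ℝ × ℝ)) ?_ ?_
    · exact continuousOn_fst.prodMk (continuousOn_const.prodMk
        ((hy.continuousOn.comp continuousOn_snd fun z hz => hz.2.1).prodMk continuousOn_snd))
    · exact fun z hz => mem_offPole_of_time_lt hyI (hIup hz.1.1 hyt) hz.2.1
        (by linarith [hz.2.2])
  obtain ⟨M, hM⟩ := hcomp.exists_bound_of_continuousOn hcont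
  have hc2 : 0 ≤ |(c 2 (y t))⁻¹| := abs_nonneg _
  refine ⟨δ, hδ, C + (|M| * √t + C / (2 * δ) * |(c 2 (y t))⁻¹|), fun x hx τ hτ => ?_⟩
  have hs : 0 < t - τ := sub_pos.2 hτ.2
  have hsq := Real.sqrt_pos.2 hs
  by_cases hτδ : t - τ < δ
  · have h1 := (hnear t ht.le (by simpa using hδ) τ hτ.1
      (by rw [abs_sub_comm, abs_of_pos hs]; exact hτδ) hτ.2 x hx).2.2
    refine h1.trans (div_le_div_of_nonneg_right ?_ hsq.le)
    have : 0 ≤ |M| * √t + C / (2 * δ) * |(c 2 (y t))⁻¹| := by positivity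
    linarith
  · rw [not_lt] at hτδ
    have h1 := hM (x, τ) ⟨Ico_subset_Icc_self hx, hτ.1, by linarith⟩
    have h2 : |M| ≤ |M| * √t / √(t - τ) := by
      rw [le_div_iff₀ hsq]
      exact mul_le_mul_of_nonneg_left (Real.sqrt_le_sqrt (by linarith [hτ.1])) (abs_nonneg _)
    have hd : |Z x - Z (y t)| ≤ C :=
      -- the bound on the coordinate does not depend on the time of the pole
      (hnear t ht.le (by simpa using hδ) (max 0 (t - δ / 2)) (le_max_left _ _)
        (by
          rw [abs_sub_comm, abs_lt]
          constructor
          · linarith [max_lt ht (show t - δ / 2 < t by linarith)]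
          · linarith [le_max_right 0 (t - δ / 2)])
        (max_lt ht (by linarith)) x hx).2.1
    have h3 : |doubleLayerKernel (t - τ) (Z x - Z (y t)) * (c 2 (y t))⁻¹| ≤
        C / (2 * δ) * |(c 2 (y t))⁻¹| / √(t - τ) := by
      rw [abs_mul, doubleLayerKernel, abs_mul, abs_of_pos (heatKernel_pos hs _), abs_div,
        abs_of_pos (by positivity : 0 < 2 * (t - τ))]
      calc heatKernel (t - τ) (Z x - Z (y t)) * (|Z x - Z (y t)| / (2 * (t - τ))) *
            |(c 2 (y t))⁻¹|
          ≤ 1 / √(t - τ) * (C / (2 * δ)) * |(c 2 (y t))⁻¹| := by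
            gcongr
            exact heatKernel_le hs _
        _ = _ := by ring
    rw [add_div, add_div]
    have h4 : 0 ≤ C / √(t - τ) := by positivity
    have h5 := (h1.trans (le_abs_self M)).trans h2
    have h6 := abs_sub (greenXi G (x, t, y τ, τ))
      (doubleLayerKernel (t - τ) (Z x - Z (y t)) * (c 2 (y t))⁻¹)
    rw [Real.norm_eq_abs] at h5
    simp only at h5
    linarith

/-- The jump relation: the potential has the boundary value `Ψ / (2 c₂)` plus its own value on
the boundary. -/
theorem tendsto_potential_boundary (hG : IsGreenFunction I 2 c G)
    (h : IsLiouvilleData I c Z σ β γ q) (hI : IsOpen I) (hIup : IsUpperSet I)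
    (hc₀ : ContinuousOn (c 0) I)
    (hy : LocallyLipschitzOn (Ici 0) y) (hyI : ∀ t ≥ 0, y t ∈ I) (hΨ : ContinuousOn Ψ (Ici 0))
    {t : ℝ} (ht : 0 < t) :
    IntervalIntegrable (potentialIntegrand G y Ψ (y t) t) volume 0 t ∧
      Tendsto (fun x => potential G y Ψ x t) (𝓝[>] (y t))
        (𝓝 (1 / (2 * c 2 (y t)) * Ψ t + potential G y Ψ (y t) t)) := by
  obtain ⟨ε, hε, B, hB⟩ := exists_bound_greenXi_fixed_time hG h hI hIup hc₀ hy hyI ht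
  have hyt := hyI t ht.le
  have hyc := hy.continuousOn
  have hΨt : ContinuousOn Ψ (Icc 0 t) := hΨ.mono Icc_subset_Ici_self
  obtain ⟨D, hD⟩ := isCompact_Icc.exists_bound_of_continuousOn hΨt
  -- the integrand without its singular part; the subtracted kernel vanishes at `x = y t`, so that
  -- `F (y t)` is the full integrand of the direct value
  let F : ℝ → ℝ → ℝ := fun x τ => Ψ τ * (greenXi G (x, t, y τ, τ) -
    doubleLayerKernel (t - τ) (Z x - Z (y t)) * (c 2 (y t))⁻¹)
  have hFc : ∀ x ∈ I, ContinuousOn (F x) (Ico 0 t) := fun x hx =>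
    (hΨt.mono Ico_subset_Icc_self).mul ((hG.continuousOn_greenXi_curve hI hyc hyI hx).sub
      (((continuousOn_doubleLayerKernel t _).mono fun τ hτ => hτ.2).mul continuousOn_const))
  have hFb : ∀ x ∈ Ico (y t) (y t + ε), ∀ τ ∈ Ico 0 t, |F x τ| ≤ D * B / √(t - τ) := by
    intro x hx τ hτ
    have h1 := hD τ (Ico_subset_Icc_self hτ)
    rw [abs_mul, mul_div_assoc]
    exact mul_le_mul h1 (hB x hx τ hτ) (abs_nonneg _) ((norm_nonneg _).trans h1)
  have hdl0 : ∀ s, doubleLayerKernel s 0 = 0 := fun s => by simp [doubleLayerKernel]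
  have hFy : ∀ τ, F (y t) τ = Ψ τ * greenXi G (y t, t, y τ, τ) := fun τ => by
    simp only [F, sub_self, hdl0, zero_mul, sub_zero]
  have hyε : y t ∈ Ico (y t) (y t + ε) := ⟨le_rfl, by linarith⟩
  have hFint : ∀ x ∈ Ico (y t) (y t + ε), IntervalIntegrable (F x) volume 0 t := fun x hx =>
    intervalIntegrable_of_abs_le_div_sqrt ht.le (hFc x (hIup hx.1 hyt)) (hFb x hx)
  refine ⟨?_, ?_⟩
  · refine (hFint (y t) hyε).congr_uIoo fun τ hτ => ?_
    rw [uIoo_of_le ht.le] at hτ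
    rw [hFy, hG.potentialIntegrand_eq hI hyI hyt hτ.1.le hτ.2]
  have hZc : ContinuousAt Z (y t) := (h.hasDerivAt_Z (y t) hyt).continuousAt
  have hmono : StrictMonoOn Z I := by
    refine strictMonoOn_of_deriv_pos hIup.ordConnected.convex (h.contDiffOn_Z hI).continuousOn
      fun x hx => ?_
    have hxI := interior_subset hx
    rw [(h.hasDerivAt_Z x hxI).deriv]
    exact h.σ_pos x hxI
  have hd : Tendsto (fun x => Z x - Z (y t)) (𝓝 (y t)) (𝓝 0) := by
    simpa using hZc.tendsto.sub_const (Z (y t))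
  have hlim1 : Tendsto (fun x => ∫ τ in (0 : ℝ)..t, F x τ) (𝓝[>] (y t))
      (𝓝 (∫ τ in (0 : ℝ)..t, F (y t) τ)) := by
    have hev : ∀ᶠ x in 𝓝[>] (y t), x ∈ Ico (y t) (y t + ε) := by
      filter_upwards [Ioo_mem_nhdsGT (show y t < y t + ε by linarith)] with x hx
        using Ioo_subset_Ico_self hx
    refine intervalIntegral.tendsto_integral_filter_of_dominated_convergence
      (fun τ => D * B / √(t - τ)) ?_ ?_ (intervalIntegrable_div_sqrt _ ht.le) ?_
    · filter_upwards [hev] with x hx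
      exact aestronglyMeasurable_of_continuousOn_Ico ht.le (hFc x (hIup hx.1 hyt))
    · filter_upwards [hev] with x hx
      filter_upwards [compl_mem_ae_iff.2 (measure_singleton t)] with τ hne hτ
      rw [uIoc_of_le ht.le] at hτ
      exact hFb x hx τ ⟨hτ.1.le, lt_of_le_of_ne hτ.2 hne⟩
    · filter_upwards [compl_mem_ae_iff.2 (measure_singleton t)] with τ hne hτ
      rw [uIoc_of_le ht.le] at hτ
      have hτt : τ < t := lt_of_le_of_ne hτ.2 hne
      have hmem := mem_offPole_of_time_lt hyI hyt hτ.1.le hτt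
      have h1 : ContinuousAt (fun x => greenXi G (x, t, y τ, τ)) (y t) :=
        ContinuousAt.comp (f := fun x : ℝ => ((x, t, y τ, τ) : ℝ × ℝ × ℝ × ℝ))
          ((hG.contDiffOn_greenXi hI).continuousOn.continuousAt
            ((isOpen_offPole hI).mem_nhds hmem)) (by fun_prop)
      have h2 : Continuous (doubleLayerKernel (t - τ)) := by
        unfold doubleLayerKernel
        exact (continuous_iff_continuousAt.2 fun w =>
          (hasDerivAt_heatKernel (t - τ) w).continuousAt).mul (by fun_prop)
      have h3 : ContinuousAt (fun x => F x τ) (y t) :=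
        continuousAt_const.mul (h1.sub
          ((ContinuousAt.comp (f := fun x => Z x - Z (y t)) h2.continuousAt
            (hZc.sub continuousAt_const)).mul continuousAt_const))
      exact h3.tendsto.mono_left nhdsWithin_le_nhds
  have hlim2 : Tendsto (fun x => (∫ τ in (0 : ℝ)..t,
      Ψ τ * doubleLayerKernel (t - τ) (Z x - Z (y t))) * (c 2 (y t))⁻¹) (𝓝[>] (y t))
      (𝓝 (1 / 2 * Ψ t * (c 2 (y t))⁻¹)) := by
    refine ((tendsto_integral_mul_doubleLayerKernel ht hΨt).comp
      (tendsto_nhdsWithin_iff.2 ⟨hd.mono_left nhdsWithin_le_nhds, ?_⟩)).mul_const _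
    filter_upwards [self_mem_nhdsWithin] with x hx
    have hx' : y t < x := hx
    exact sub_pos.2 (hmono hyt (hIup hx'.le hyt) hx')
  have hlim := hlim2.add hlim1
  have hval : 1 / 2 * Ψ t * (c 2 (y t))⁻¹ + ∫ τ in (0 : ℝ)..t, F (y t) τ =
      1 / (2 * c 2 (y t)) * Ψ t + potential G y Ψ (y t) t := by
    rw [hG.potential_eq_integral hI hyI hyt ht.le]
    simp only [hFy]
    rw [one_div, one_div, mul_inv]
    ring
  rw [hval] at hlim
  refine hlim.congr' ?_
  filter_upwards [Ioo_mem_nhdsGT (show y t < y t + ε by linarith)] with x hx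
  have hxI : x ∈ I := hIup hx.1.le hyt
  rw [hG.potential_eq_integral hI hyI hxI ht.le, ← intervalIntegral.integral_mul_const,
    ← intervalIntegral.integral_add]
  · refine intervalIntegral.integral_congr fun τ _ => ?_
    simp only [F]
    ring
  · refine IntervalIntegrable.mul_const ?_ _
    refine (intervalIntegrable_doubleLayerKernel ht.le
      (sub_pos.2 (hmono hyt hxI hx.1))).continuousOn_mul ?_
    rwa [uIcc_of_le ht.le]
  · exact hFint x (Ioo_subset_Ico_self hx)

/-- On the boundary curve `∂G/∂ξ` is a weakly singular kernel. -/
theorem exists_bound_greenXi_on_boundary (hG : IsGreenFunction I 2 c G)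
    (h : IsLiouvilleData I c Z σ β γ q) (hI : IsOpen I)
    (hc₀ : ContinuousOn (c 0) I)
    (hy : LocallyLipschitzOn (Ici 0) y) (hyI : ∀ t ≥ 0, y t ∈ I) (T : ℝ) :
    ∃ C, ∀ t τ, 0 ≤ τ → τ < t → t ≤ T → |greenXi G (y t, t, y τ, τ)| ≤ C / √(t - τ) := by
  set S : Set (ℝ × ℝ) := {z | 0 ≤ z.2 ∧ z.2 ≤ z.1 ∧ z.1 ≤ T} with hS
  have hScomp : IsCompact S := by
    have h₀ : IsClosed {z : ℝ × ℝ | 0 ≤ z.2} := isClosed_le continuous_const continuous_snd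
    have h₁ : IsClosed {z : ℝ × ℝ | z.2 ≤ z.1} := isClosed_le continuous_snd continuous_fst
    have h₂ : IsClosed {z : ℝ × ℝ | z.1 ≤ T} := isClosed_le continuous_fst continuous_const
    have hcl : IsClosed S := h₀.inter (h₁.inter h₂)
    refine (isCompact_Icc.prod isCompact_Icc : IsCompact (Icc 0 T ×ˢ Icc 0 T)).of_isClosed_subset
      hcl fun z hz => ?_
    exact ⟨⟨hz.1.trans hz.2.1, hz.2.2⟩, hz.1, hz.2.1.trans hz.2.2⟩
  have key : ∃ C, ∀ z ∈ S, z.2 < z.1 →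
      |greenXi G (y z.1, z.1, y z.2, z.2)| ≤ C / √(z.1 - z.2) := by
    refine hScomp.induction_on (p := fun A => ∃ C, ∀ z ∈ A, z.2 < z.1 →
      |greenXi G (y z.1, z.1, y z.2, z.2)| ≤ C / √(z.1 - z.2)) ⟨0, by simp⟩ ?_ ?_ ?_
    · rintro A A' hAA' ⟨C, hC⟩
      exact ⟨C, fun z hz => hC z (hAA' hz)⟩
    · rintro A A' ⟨C, hC⟩ ⟨C', hC'⟩
      refine ⟨max C C', fun z hz hlt => ?_⟩
      rcases hz with hz | hz
      · exact (hC z hz hlt).trans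
          (div_le_div_of_nonneg_right (le_max_left _ _) (Real.sqrt_nonneg _))
      · exact (hC' z hz hlt).trans
          (div_le_div_of_nonneg_right (le_max_right _ _) (Real.sqrt_nonneg _))
    · rintro ⟨t, τ⟩ ⟨hτ, hτt, htT⟩
      simp only at hτ hτt htT
      rcases eq_or_lt_of_le hτt with heq | hlt
      · subst heq
        obtain ⟨δ, hδ, C, -, hnear⟩ := exists_bound_greenXi_near_boundary hG h hI hc₀ hy hyI hτ
        refine ⟨S ∩ Metric.ball (τ, τ) δ, inter_mem self_mem_nhdsWithin
          (nhdsWithin_le_nhds (Metric.ball_mem_nhds _ hδ)), C, ?_⟩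
        rintro ⟨t', τ'⟩ ⟨⟨h1, h2, -⟩, h3⟩ hlt
        simp only [Metric.mem_ball, Prod.dist_eq, Real.dist_eq, max_lt_iff] at h1 h2 h3 hlt
        have h4 := (hnear t' (h1.trans h2) h3.1 τ' h1 h3.2 hlt (y t') ⟨le_rfl, by linarith⟩).2.2
        simpa [doubleLayerKernel] using h4
      · have hcw : ContinuousWithinAt (fun z : ℝ × ℝ => |greenXi G (y z.1, z.1, y z.2, z.2)|) S
            (t, τ) := by
          have ht0 : 0 ≤ t := hτ.trans hτt
          refine ContinuousWithinAt.abs (ContinuousAt.comp_continuousWithinAt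
            (f := fun z : ℝ × ℝ => ((y z.1, z.1, y z.2, z.2) : ℝ × ℝ × ℝ × ℝ))
            ((hG.contDiffOn_greenXi hI).continuousOn.continuousAt ((isOpen_offPole hI).mem_nhds
              (mem_offPole_of_time_lt hyI (hyI t ht0) hτ hlt))) ?_)
          have e1 : ContinuousWithinAt (fun z : ℝ × ℝ => y z.1) S (t, τ) :=
            (hy.continuousOn t ht0).comp continuousWithinAt_fst fun z hz => hz.1.trans hz.2.1
          have e2 : ContinuousWithinAt (fun z : ℝ × ℝ => y z.2) S (t, τ) :=
            (hy.continuousOn τ hτ).comp continuousWithinAt_snd fun z hz => hz.1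
          exact e1.prodMk (continuousWithinAt_fst.prodMk (e2.prodMk continuousWithinAt_snd))
        set M := |greenXi G (y t, t, y τ, τ)| + 1 with hM
        have hM0 : 0 ≤ M := by positivity
        have hev := hcw.eventually (gt_mem_nhds (show _ < M by simp [hM]))
        refine ⟨_, inter_mem hev self_mem_nhdsWithin, M * √T, ?_⟩
        rintro z ⟨h1, h2⟩ hlt'
        have h3 : |greenXi G (y z.1, z.1, y z.2, z.2)| < M := h1
        refine h3.le.trans ?_
        rw [le_div_iff₀ (Real.sqrt_pos.2 (sub_pos.2 hlt'))]
        exact mul_le_mul_of_nonneg_left (Real.sqrt_le_sqrt (by linarith [h2.1, h2.2.2])) hM0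
  obtain ⟨C, hC⟩ := key
  exact ⟨C, fun t τ h1 h2 h3 => hC (t, τ) ⟨h1, h2.le, h3⟩ h2⟩

end BoundaryLimit

/-! ### Weakly singular Volterra equations of the second kind -/

section Volterra

/-- A Volterra kernel, continuous for `0 ≤ τ < t` and with at most a singularity of order
`(t - τ)^(-1/2)` on the diagonal, locally uniformly in time. -/
structure IsWeaklySingular (k : ℝ → ℝ → ℝ) : Prop where
  continuousOn : ContinuousOn (fun z : ℝ × ℝ => k z.1 z.2) {z | 0 ≤ z.2 ∧ z.2 < z.1}
  bound : ∀ T, ∃ C, ∀ t τ, 0 ≤ τ → τ < t → t ≤ T → |k t τ| ≤ C / √(t - τ)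

/-- The Volterra integral operator with kernel `k`. -/
noncomputable def volterraOp (k : ℝ → ℝ → ℝ) (Φ : ℝ → ℝ) (t : ℝ) : ℝ :=
  ∫ τ in (0 : ℝ)..t, k t τ * Φ τ

variable {k : ℝ → ℝ → ℝ} {Φ φ : ℝ → ℝ}

theorem IsWeaklySingular.exists_nonneg_bound (hk : IsWeaklySingular k) (T : ℝ) :
    ∃ C ≥ 0, ∀ t τ, 0 ≤ τ → τ < t → t ≤ T → |k t τ| ≤ C / √(t - τ) := by
  obtain ⟨C, hC⟩ := hk.bound T
  exact ⟨|C|, abs_nonneg C, fun t τ h1 h2 h3 => (hC t τ h1 h2 h3).trans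
    (div_le_div_of_nonneg_right (le_abs_self C) (Real.sqrt_nonneg _))⟩

theorem IsWeaklySingular.continuousOn_mul (hk : IsWeaklySingular k)
    (hΦ : ContinuousOn Φ (Ici 0)) (t : ℝ) : ContinuousOn (fun τ => k t τ * Φ τ) (Ico 0 t) :=
  (hk.continuousOn.comp (f := fun τ => (t, τ)) (by fun_prop) fun _ hτ => hτ).mul
    (hΦ.mono fun _ hτ => hτ.1)

theorem IsWeaklySingular.intervalIntegrable (hk : IsWeaklySingular k)
    (hΦ : ContinuousOn Φ (Ici 0)) {t : ℝ} (ht : 0 ≤ t) :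
    IntervalIntegrable (fun τ => k t τ * Φ τ) volume 0 t := by
  obtain ⟨C, hC0, hC⟩ := hk.exists_nonneg_bound t
  obtain ⟨M, hM⟩ := isCompact_Icc.exists_bound_of_continuousOn
    (hΦ.mono (Icc_subset_Ici_self : Icc 0 t ⊆ Ici 0))
  refine intervalIntegrable_of_abs_le_div_sqrt (C := C * M) ht (hk.continuousOn_mul hΦ t)
    fun τ hτ => ?_
  rw [abs_mul, mul_div_right_comm]
  have hs := Real.sqrt_nonneg (t - τ)
  exact mul_le_mul (hC t τ hτ.1 hτ.2 le_rfl) (hM τ (Ico_subset_Icc_self hτ)) (abs_nonneg _)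
    (by positivity)

/-- The operator maps continuous functions to continuous functions: after scaling the range of
integration to `[0,1]`, dominated convergence applies, at `t = 0` as well. -/
theorem IsWeaklySingular.continuousOn_volterraOp (hk : IsWeaklySingular k)
    (hΦ : ContinuousOn Φ (Ici 0)) : ContinuousOn (volterraOp k Φ) (Ici 0) := by
  have hscale : ∀ t, volterraOp k Φ t = ∫ u in (0 : ℝ)..1, t * (k t (t * u) * Φ (t * u)) := by
    intro t
    rw [intervalIntegral.integral_const_mul,
      intervalIntegral.mul_integral_comp_mul_left (f := fun τ => k t τ * Φ τ), mul_zero, mul_one,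
      volterraOp]
  intro t₀ ht₀
  obtain ⟨C, hC0, hC⟩ := hk.exists_nonneg_bound (t₀ + 1)
  obtain ⟨M, hM⟩ := isCompact_Icc.exists_bound_of_continuousOn
    (hΦ.mono (Icc_subset_Ici_self : Icc 0 (t₀ + 1) ⊆ Ici 0))
  have hM0 : 0 ≤ M := (norm_nonneg _).trans
    (hM 0 ⟨le_rfl, add_nonneg (mem_Ici.1 ht₀) zero_le_one⟩)
  have hmem : ∀ t, 0 < t → ∀ u ∈ Ico (0 : ℝ) 1, 0 ≤ t * u ∧ t * u < t := fun t ht u hu =>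
    ⟨mul_nonneg ht.le hu.1, by nlinarith [hu.2]⟩
  have hb : ∀ t ∈ Icc 0 (t₀ + 1), ∀ u ∈ Ico (0 : ℝ) 1,
      |t * (k t (t * u) * Φ (t * u))| ≤ √t * (C * M / √(1 - u)) := by
    intro t ht u hu
    rcases eq_or_lt_of_le ht.1 with h0 | h0
    · simp [← h0]
    · obtain ⟨h1, h2⟩ := hmem t h0 u hu
      have e1 := hC t (t * u) h1 h2 ht.2
      have e2 : |Φ (t * u)| ≤ M := hM (t * u) ⟨h1, h2.le.trans ht.2⟩
      have e3 : √(t - t * u) = √t * √(1 - u) := by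
        rw [← Real.sqrt_mul h0.le, mul_sub, mul_one]
      have hsu : 0 < √(1 - u) := Real.sqrt_pos.2 (by linarith [hu.2])
      have hst : 0 < √t := Real.sqrt_pos.2 h0
      rw [abs_mul, abs_mul, abs_of_pos h0]
      rw [e3] at e1
      calc t * (|k t (t * u)| * |Φ (t * u)|) ≤ t * (C / (√t * √(1 - u)) * M) := by gcongr
        _ = (√t * √t) * (C / (√t * √(1 - u)) * M) := by rw [Real.mul_self_sqrt h0.le]
        _ = _ := by field_simp
  have hnear : ∀ᶠ t in 𝓝[Ici 0] t₀, t ∈ Icc 0 (t₀ + 1) := by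
    filter_upwards [self_mem_nhdsWithin, nhdsWithin_le_nhds (Iio_mem_nhds (lt_add_one t₀))]
      with t h1 h2 using ⟨h1, le_of_lt h2⟩
  refine ContinuousWithinAt.congr (f := fun t => ∫ u in (0 : ℝ)..1,
    t * (k t (t * u) * Φ (t * u))) ?_ (fun t _ => hscale t) (hscale t₀)
  refine intervalIntegral.continuousWithinAt_of_dominated_interval
    (bound := fun u => √(t₀ + 1) * (C * M / √(1 - u))) ?_ ?_
    ((intervalIntegrable_div_sqrt _ zero_le_one).const_mul _) ?_
  · filter_upwards [hnear] with t ht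
    refine aestronglyMeasurable_of_continuousOn_Ico zero_le_one ?_
    rcases eq_or_lt_of_le ht.1 with h0 | h0
    · simp only [← h0, zero_mul]
      exact continuousOn_const
    · exact continuousOn_const.mul ((hk.continuousOn_mul hΦ t).comp
        (f := fun u => t * u) (by fun_prop) fun u hu => hmem t h0 u hu)
  · filter_upwards [hnear] with t ht
    filter_upwards [compl_mem_ae_iff.2 (measure_singleton (1 : ℝ))] with u hu1 hu
    rw [uIoc_of_le zero_le_one] at hu
    refine (hb t ht u ⟨hu.1.le, lt_of_le_of_ne hu.2 hu1⟩).trans ?_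
    gcongr
    exact ht.2
  · filter_upwards [compl_mem_ae_iff.2 (measure_singleton (1 : ℝ))] with u hu1 hu
    rw [uIoc_of_le zero_le_one] at hu
    have hu' : u ∈ Ico (0 : ℝ) 1 := ⟨hu.1.le, lt_of_le_of_ne hu.2 hu1⟩
    rcases eq_or_lt_of_le (mem_Ici.1 ht₀) with h0 | h0
    · subst h0
      rw [ContinuousWithinAt, zero_mul]
      refine squeeze_zero_norm' (hnear.mono fun t ht => hb t ht u hu') ?_
      have : ContinuousAt (fun t => √t * (C * M / √(1 - u))) 0 := by fun_prop
      have h := this.tendsto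
      rw [Real.sqrt_zero, zero_mul] at h
      exact h.mono_left nhdsWithin_le_nhds
    · have hpos : ∀ᶠ t in 𝓝 t₀, 0 < t := lt_mem_nhds h0
      have hopen : IsOpen {z : ℝ × ℝ | 0 < z.2 ∧ z.2 < z.1} :=
        (isOpen_lt continuous_const continuous_snd).inter
          (isOpen_lt continuous_snd continuous_fst)
      have hu0 : 0 < u := hu.1
      have hz : 0 < t₀ * u ∧ t₀ * u < t₀ := ⟨by positivity, (hmem t₀ h0 u hu').2⟩
      have c1 : ContinuousAt (fun t => k t (t * u)) t₀ :=
        ContinuousAt.comp (f := fun t : ℝ => (t, t * u)) (g := fun z : ℝ × ℝ => k z.1 z.2)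
          (hk.continuousOn.continuousAt (mem_of_superset (hopen.mem_nhds hz)
            fun z hz => ⟨hz.1.le, hz.2⟩)) (by fun_prop)
      have c2 : ContinuousAt (fun t => Φ (t * u)) t₀ :=
        ContinuousAt.comp (f := fun t : ℝ => t * u) (g := Φ)
          (hΦ.continuousAt (Ici_mem_nhds hz.1)) (by fun_prop)
      exact (continuousAt_id.mul (c1.mul c2)).continuousWithinAt

/-- In a norm with a large enough exponential weight the operator is a contraction on `[0,T]`. -/
theorem IsWeaklySingular.exists_weight (hk : IsWeaklySingular k) {T : ℝ} (hT : 0 ≤ T) :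
    ∃ l : ℝ, ∀ Φ : ℝ → ℝ, ContinuousOn Φ (Ici 0) → ∀ M,
      (∀ τ ∈ Icc 0 T, |Φ τ| ≤ M * Real.exp (l * τ)) →
      ∀ t ∈ Icc 0 T, |volterraOp k Φ t| ≤ M / 2 * Real.exp (l * t) := by
  obtain ⟨C, hC0, hC⟩ := hk.exists_nonneg_bound T
  have hint : ∀ t ≥ 0, IntervalIntegrable (fun s : ℝ => C / √s) volume 0 t := fun t ht => by
    have h := (intervalIntegrable_div_sqrt C ht).comp_sub_left t
    simpa using h.symm
  have hexp : ∀ l : ℝ, Continuous fun s => Real.exp (-(l * s)) := fun l => by fun_prop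
  have hlim : Tendsto (fun l : ℝ => ∫ s in (0 : ℝ)..T, C / √s * Real.exp (-(l * s))) atTop
      (𝓝 (∫ _s in (0 : ℝ)..T, (0 : ℝ))) := by
    refine intervalIntegral.tendsto_integral_filter_of_dominated_convergence
      (fun s => C / √s) ?_ ?_ (hint T hT) ?_
    · exact Eventually.of_forall fun l =>
        ((hint T hT).mul_continuousOn (hexp l).continuousOn).def'.aestronglyMeasurable
    · filter_upwards [eventually_ge_atTop 0] with l hl
      refine Eventually.of_forall fun s hs => ?_
      rw [uIoc_of_le hT] at hs
      have h1 : Real.exp (-(l * s)) ≤ 1 := Real.exp_le_one_iff.2 (by nlinarith [hs.1])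
      rw [Real.norm_eq_abs, abs_of_nonneg (by positivity)]
      exact mul_le_of_le_one_right (by positivity) h1
    · refine Eventually.of_forall fun s hs => ?_
      rw [uIoc_of_le hT] at hs
      have h := (Real.tendsto_exp_neg_atTop_nhds_zero.comp
        (tendsto_id.atTop_mul_const hs.1)).const_mul (C / √s)
      rw [mul_zero] at h
      exact h
  rw [intervalIntegral.integral_zero] at hlim
  obtain ⟨l, hl⟩ := (hlim.eventually (gt_mem_nhds (by norm_num : (0 : ℝ) < 1 / 2))).exists
  refine ⟨l, fun Φ hΦ M hM t ht => ?_⟩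
  have hM0 : 0 ≤ M := by
    have := (abs_nonneg _).trans (hM 0 ⟨le_rfl, hT⟩)
    simpa using this
  let f : ℝ → ℝ := fun s => C / √s * Real.exp (-(l * s))
  have hf : ∀ t ≥ 0, IntervalIntegrable f volume 0 t := fun t ht =>
    (hint t ht).mul_continuousOn (hexp l).continuousOn
  have hft : IntervalIntegrable (fun τ => f (t - τ)) volume 0 t := by
    have h := (hf t ht.1).comp_sub_left t
    simpa using h.symm
  have hmono : ∫ s in (0 : ℝ)..t, f s ≤ ∫ s in (0 : ℝ)..T, f s := by
    refine intervalIntegral.integral_mono_interval le_rfl ht.1 ht.2 ?_ (hf T hT)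
    exact Eventually.of_forall fun s => by positivity
  have hle : |volterraOp k Φ t| ≤
      ∫ τ in (0 : ℝ)..t, M * Real.exp (l * t) * f (t - τ) := by
    rw [volterraOp]
    refine (intervalIntegral.abs_integral_le_integral_abs ht.1).trans ?_
    refine intervalIntegral.integral_mono_on_of_le_Ioo ht.1
      (hk.intervalIntegrable hΦ ht.1).abs (hft.const_mul _) fun τ hτ => ?_
    have e1 := hC t τ hτ.1.le hτ.2 ht.2
    have e2 := hM τ ⟨hτ.1.le, hτ.2.le.trans ht.2⟩
    rw [abs_mul]
    calc |k t τ| * |Φ τ| ≤ C / √(t - τ) * (M * Real.exp (l * τ)) := by gcongr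
      _ = M * Real.exp (l * t) * (C / √(t - τ) * Real.exp (-(l * (t - τ)))) := by
          rw [show l * τ = l * t + -(l * (t - τ)) by ring, Real.exp_add]
          ring
  rw [intervalIntegral.integral_const_mul,
    intervalIntegral.integral_comp_sub_left (f := f), sub_self, sub_zero] at hle
  refine hle.trans ?_
  have h3 : ∫ s in (0 : ℝ)..t, f s ≤ 1 / 2 := hmono.trans hl.le
  calc M * Real.exp (l * t) * ∫ s in (0 : ℝ)..t, f s ≤ M * Real.exp (l * t) * (1 / 2) := by
        gcongr
    _ = _ := by ring

theorem IsWeaklySingular.volterraOp_sub (hk : IsWeaklySingular k) {Φ' : ℝ → ℝ}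
    (hΦ : ContinuousOn Φ (Ici 0)) (hΦ' : ContinuousOn Φ' (Ici 0)) {t : ℝ} (ht : 0 ≤ t) :
    volterraOp k (fun τ => Φ τ - Φ' τ) t = volterraOp k Φ t - volterraOp k Φ' t := by
  simp only [volterraOp, mul_sub]
  exact intervalIntegral.integral_sub (hk.intervalIntegrable hΦ ht) (hk.intervalIntegrable hΦ' ht)

theorem IsWeaklySingular.eqOn_of_solves (hk : IsWeaklySingular k) {Ψ Ψ' : ℝ → ℝ}
    (hΨ : ContinuousOn Ψ (Ici 0)) (hΨ' : ContinuousOn Ψ' (Ici 0))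
    (h : ∀ t ≥ 0, Ψ t = φ t + volterraOp k Ψ t)
    (h' : ∀ t ≥ 0, Ψ' t = φ t + volterraOp k Ψ' t) : EqOn Ψ' Ψ (Ici 0) := by
  intro T hT
  obtain ⟨l, hl⟩ := hk.exists_weight (mem_Ici.1 hT)
  let D : ℝ → ℝ := fun τ => Ψ' τ - Ψ τ
  have hD : ContinuousOn D (Ici 0) := hΨ'.sub hΨ
  have hDeq : ∀ t ≥ 0, D t = volterraOp k D t := fun t ht => by
    rw [hk.volterraOp_sub hΨ' hΨ ht]
    simp only [D]
    rw [h t ht, h' t ht]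
    ring
  have hw : ContinuousOn (fun t => |D t| * Real.exp (-(l * t))) (Icc 0 T) :=
    (hD.mono Icc_subset_Ici_self).abs.mul (by fun_prop)
  obtain ⟨s, hs, hmax⟩ := isCompact_Icc.exists_isMaxOn (nonempty_Icc.2 (mem_Ici.1 hT)) hw
  set M := |D s| * Real.exp (-(l * s)) with hM
  have hle : ∀ τ ∈ Icc 0 T, |D τ| ≤ M * Real.exp (l * τ) := fun τ hτ => by
    have h1 : |D τ| * Real.exp (-(l * τ)) ≤ M := hmax hτ
    rwa [Real.exp_neg, ← div_eq_mul_inv, div_le_iff₀ (Real.exp_pos _)] at h1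
  -- the weighted maximum of the difference is at most half of itself
  have hhalf : M ≤ M / 2 := by
    have h1 := hl D hD M hle s hs
    rw [← hDeq s hs.1, ← div_le_iff₀ (Real.exp_pos _), div_eq_mul_inv, ← Real.exp_neg] at h1
    exact h1
  have h2 := hle T ⟨hT, le_rfl⟩
  have h3 : M * Real.exp (l * T) ≤ 0 :=
    mul_nonpos_of_nonpos_of_nonneg (by linarith) (Real.exp_pos _).le
  exact sub_eq_zero.1 (abs_nonpos_iff.1 (h2.trans h3))

/-- The Neumann series solves the equation on the whole half-line at once. -/
theorem IsWeaklySingular.exists_solution (hk : IsWeaklySingular k)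
    (hφ : ContinuousOn φ (Ici 0)) :
    ∃ Ψ, ContinuousOn Ψ (Ici 0) ∧ ∀ t ≥ 0, Ψ t = φ t + volterraOp k Ψ t := by
  let u : ℕ → ℝ → ℝ := fun n => (volterraOp k)^[n] φ
  have hu_succ : ∀ n, u (n + 1) = volterraOp k (u n) := fun n =>
    Function.iterate_succ_apply' _ _ _
  have huc : ∀ n, ContinuousOn (u n) (Ici 0) := fun n => by
    induction n with
    | zero => exact hφ
    | succ n ih => rw [hu_succ]; exact hk.continuousOn_volterraOp ih
  have hub : ∀ T ≥ 0, ∃ l M : ℝ, (∀ Φ : ℝ → ℝ, ContinuousOn Φ (Ici 0) → ∀ M,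
      (∀ τ ∈ Icc 0 T, |Φ τ| ≤ M * Real.exp (l * τ)) →
      ∀ t ∈ Icc 0 T, |volterraOp k Φ t| ≤ M / 2 * Real.exp (l * t)) ∧
      ∀ n, ∀ t ∈ Icc 0 T, |u n t| ≤ M / 2 ^ n * Real.exp (l * t) := by
    intro T hT
    obtain ⟨l, hl⟩ := hk.exists_weight hT
    have hw : ContinuousOn (fun t => φ t * Real.exp (-(l * t))) (Icc 0 T) :=
      (hφ.mono Icc_subset_Ici_self).mul (by fun_prop)
    obtain ⟨M, hM⟩ := isCompact_Icc.exists_bound_of_continuousOn hw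
    refine ⟨l, M, hl, fun n => ?_⟩
    induction n with
    | zero =>
      intro t ht
      have h1 := hM t ht
      rw [Real.norm_eq_abs, abs_mul, abs_of_pos (Real.exp_pos _), Real.exp_neg,
        ← div_eq_mul_inv, div_le_iff₀ (Real.exp_pos _)] at h1
      simpa [u] using h1
    | succ n ih =>
      intro t ht
      rw [hu_succ, pow_succ, ← div_div]
      exact hl (u n) (huc n) _ ih t ht
  have hgeom : ∀ A : ℝ, HasSum (fun n : ℕ => A / 2 ^ n) (A * 2) := fun A => by
    have h := hasSum_geometric_two.mul_left A
    simpa [div_eq_mul_inv] using h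
  have hsum : ∀ t ≥ 0, Summable fun n => u n t := fun t ht => by
    obtain ⟨l, M, -, hM⟩ := hub t ht
    refine Summable.of_norm_bounded ((hgeom M).summable.mul_right (Real.exp (l * t)))
      fun n => hM n t ⟨ht, le_rfl⟩
  let S : ℕ → ℝ → ℝ := fun N t => ∑ n ∈ Finset.range N, u n t
  let Ψ : ℝ → ℝ := fun t => ∑' n, u n t
  have hSc : ∀ N, ContinuousOn (S N) (Ici 0) := fun N =>
    continuousOn_finsetSum _ fun n _ => huc n
  have hΨc : ContinuousOn Ψ (Ici 0) := by
    intro t ht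
    have ht0 : (0 : ℝ) ≤ t + 1 := add_nonneg (mem_Ici.1 ht) zero_le_one
    obtain ⟨l, M, -, hM⟩ := hub (t + 1) ht0
    obtain ⟨E, hE⟩ := isCompact_Icc.exists_bound_of_continuousOn
      (f := fun τ => |M| * Real.exp (l * τ)) (s := Icc 0 (t + 1)) (by fun_prop)
    have h1 : ContinuousOn Ψ (Icc 0 (t + 1)) := by
      refine continuousOn_tsum (u := fun n => E / 2 ^ n)
        (fun n => (huc n).mono Icc_subset_Ici_self) (hgeom E).summable fun n τ hτ => ?_
      refine (hM n τ hτ).trans ?_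
      rw [div_mul_eq_mul_div]
      refine div_le_div_of_nonneg_right ?_ (by positivity)
      exact ((mul_le_mul_of_nonneg_right (le_abs_self M) (Real.exp_pos _).le).trans
        (le_abs_self _)).trans (hE τ hτ)
    refine (h1 t ⟨ht, by linarith⟩).mono_of_mem_nhdsWithin ?_
    filter_upwards [self_mem_nhdsWithin, nhdsWithin_le_nhds (Iio_mem_nhds (lt_add_one t))]
      with s h1 h2 using ⟨h1, le_of_lt h2⟩
  have hVS : ∀ N, ∀ t ≥ 0, φ t + volterraOp k (S N) t = S (N + 1) t := by
    intro N t ht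
    have h1 : volterraOp k (S N) t = ∑ n ∈ Finset.range N, u (n + 1) t := by
      simp only [hu_succ, volterraOp, S, Finset.mul_sum]
      exact intervalIntegral.integral_finsetSum fun n _ => hk.intervalIntegrable (huc n) ht
    rw [h1, add_comm]
    exact (Finset.sum_range_succ' (fun n => u n t) N).symm
  refine ⟨Ψ, hΨc, fun t ht => ?_⟩
  have hS : Tendsto (fun N => S (N + 1) t) atTop (𝓝 (Ψ t)) :=
    ((hsum t ht).hasSum.tendsto_sum_nat).comp (tendsto_add_atTop_nat 1)
  refine tendsto_nhds_unique hS ?_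
  obtain ⟨l, M, hl, hM⟩ := hub t ht
  have htail : ∀ N, ∀ τ ∈ Icc 0 t, |Ψ τ - S N τ| ≤ M * 2 / 2 ^ N * Real.exp (l * τ) := by
    intro N τ hτ
    have h1 : Ψ τ - S N τ = ∑' n, u (n + N) τ := by
      rw [sub_eq_iff_eq_add', (hsum τ hτ.1).sum_add_tsum_nat_add N]
    rw [h1, ← Real.norm_eq_abs]
    have h2 := ((hgeom M).div_const (2 ^ N)).mul_right (Real.exp (l * τ))
    refine tsum_of_norm_bounded h2 fun n => ?_
    have h3 := hM (n + N) τ hτ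
    rwa [pow_add, ← div_div] at h3
  have hV : Tendsto (fun N => volterraOp k (S N) t) atTop (𝓝 (volterraOp k Ψ t)) := by
    refine tendsto_iff_norm_sub_tendsto_zero.2 ?_
    refine squeeze_zero (g := fun N : ℕ => M * 2 / 2 ^ N / 2 * Real.exp (l * t))
      (fun _ => norm_nonneg _) (fun N => ?_) ?_
    · rw [norm_sub_rev, ← hk.volterraOp_sub hΨc (hSc N) ht]
      exact hl _ (hΨc.sub (hSc N)) _ (htail N) t ⟨ht, le_rfl⟩
    · have h := (((hgeom (M * 2)).summable.tendsto_atTop_zero).div_const 2).mul_const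
        (Real.exp (l * t))
      simpa using h
  exact (hV.const_add (φ t)).congr fun N => hVS N t ht

end Volterra

/-! ### The Volterra equation for the density -/

section BoundaryEquation

variable {I : Set ℝ} {c : ℕ → ℝ → ℝ} {G : ℝ → ℝ → ℝ → ℝ → ℝ} {Z σ β γ q y Ψ φ : ℝ → ℝ}

/-- The kernel of the Volterra equation for the density, solved for the density. -/
noncomputable def boundaryKernel (c : ℕ → ℝ → ℝ) (G : ℝ → ℝ → ℝ → ℝ → ℝ) (y : ℝ → ℝ)
    (t τ : ℝ) : ℝ :=
  -(2 * c 2 (y t)) * greenXi G (y t, t, y τ, τ)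

theorem isWeaklySingular_boundaryKernel (hG : IsGreenFunction I 2 c G)
    (h : IsLiouvilleData I c Z σ β γ q) (hI : IsOpen I) (hc₀ : ContinuousOn (c 0) I)
    (hc₂ : ContinuousOn (c 2) I) (hy : LocallyLipschitzOn (Ici 0) y)
    (hyI : ∀ t ≥ 0, y t ∈ I) : IsWeaklySingular (boundaryKernel c G y) := by
  have ha : ContinuousOn (fun t => -(2 * c 2 (y t))) (Ici 0) :=
    (continuousOn_const.mul (hc₂.comp hy.continuousOn hyI)).neg
  constructor
  · have hyc := hy.continuousOn
    refine (ha.comp continuousOn_fst fun z hz => hz.1.trans hz.2.le).mul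
      ((hG.contDiffOn_greenXi hI).continuousOn.comp
        (f := fun z : ℝ × ℝ => ((y z.1, z.1, y z.2, z.2) : ℝ × ℝ × ℝ × ℝ)) ?_ ?_)
    · exact (hyc.comp continuousOn_fst fun z hz => hz.1.trans hz.2.le).prodMk
        (continuousOn_fst.prodMk
          ((hyc.comp continuousOn_snd fun z hz => hz.1).prodMk continuousOn_snd))
    · exact fun z hz => mem_offPole_of_time_lt hyI (hyI _ (hz.1.trans hz.2.le)) hz.1 hz.2
  · intro T
    obtain ⟨C, hC⟩ := exists_bound_greenXi_on_boundary hG h hI hc₀ hy hyI T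
    obtain ⟨A, hA⟩ := isCompact_Icc.exists_bound_of_continuousOn
      (ha.mono (Icc_subset_Ici_self : Icc 0 T ⊆ Ici 0))
    refine ⟨A * C, fun t τ hτ hτt htT => ?_⟩
    have h1 := hA t ⟨hτ.trans hτt.le, htT⟩
    rw [boundaryKernel, abs_mul, mul_div_assoc]
    exact mul_le_mul h1 (hC t τ hτ hτt htT) (abs_nonneg _) ((norm_nonneg _).trans h1)

theorem solvesVolterra_iff_forall_pos (hG : IsGreenFunction I 2 c G) (hI : IsOpen I)
    (hpos : ∀ x ∈ I, 0 < c 2 x) (hyI : ∀ t ≥ 0, y t ∈ I) :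
    SolvesVolterra (c 2) G y φ Ψ ↔
      ∀ t > 0, Ψ t = 2 * c 2 (y t) * φ t + volterraOp (boundaryKernel c G y) Ψ t := by
  refine forall₂_congr fun t ht => ?_
  have ha := hpos _ (hyI t (le_of_lt ht))
  have h1 : ∫ τ in (0 : ℝ)..t, Ψ τ * deriv (fun ξ => G (y t) t ξ τ) (y τ) =
      ∫ τ in (0 : ℝ)..t, Ψ τ * greenXi G (y t, t, y τ, τ) :=
    hG.potential_eq_integral hI hyI (hyI t (le_of_lt ht)) (le_of_lt ht)
  have h2 : volterraOp (boundaryKernel c G y) Ψ t =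
      -(2 * c 2 (y t)) * ∫ τ in (0 : ℝ)..t, Ψ τ * greenXi G (y t, t, y τ, τ) := by
    rw [volterraOp, ← intervalIntegral.integral_const_mul]
    refine intervalIntegral.integral_congr fun τ _ => ?_
    simp only [boundaryKernel]
    ring
  rw [h1, h2]
  constructor
  · intro h
    rw [h]
    field_simp
    ring
  · intro h
    rw [h]
    field_simp
    ring

/-- For a continuous density the Volterra equation extends to `t = 0`, where its integral
vanishes. -/
theorem solvesVolterra_iff (hG : IsGreenFunction I 2 c G)
    (h : IsLiouvilleData I c Z σ β γ q) (hI : IsOpen I) (hc₀ : ContinuousOn (c 0) I)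
    (hc₂ : ContinuousOn (c 2) I) (hpos : ∀ x ∈ I, 0 < c 2 x)
    (hy : LocallyLipschitzOn (Ici 0) y) (hyI : ∀ t ≥ 0, y t ∈ I)
    (hφ : ContinuousOn φ (Ici 0)) (hΨ : ContinuousOn Ψ (Ici 0)) :
    SolvesVolterra (c 2) G y φ Ψ ↔
      ∀ t ≥ 0, Ψ t = 2 * c 2 (y t) * φ t + volterraOp (boundaryKernel c G y) Ψ t := by
  rw [solvesVolterra_iff_forall_pos hG hI hpos hyI]
  refine ⟨fun H t ht => ?_, fun H t ht => H t (le_of_lt ht)⟩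
  have hk := isWeaklySingular_boundaryKernel hG h hI hc₀ hc₂ hy hyI
  have hR : ContinuousOn
      (fun t => 2 * c 2 (y t) * φ t + volterraOp (boundaryKernel c G y) Ψ t) (Ici 0) :=
    ((continuousOn_const.mul (hc₂.comp hy.continuousOn hyI)).mul hφ).add
      (hk.continuousOn_volterraOp hΨ)
  exact EqOn.of_subset_closure (s := Ioi 0) (fun s hs => H s hs) hΨ hR Ioi_subset_Ici_self
    (by rw [closure_Ioi]) ht

theorem hasBoundaryValue_iff_solvesVolterra (hG : IsGreenFunction I 2 c G)
    (h : IsLiouvilleData I c Z σ β γ q) (hI : IsOpen I) (hIup : IsUpperSet I)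
    (hc₀ : ContinuousOn (c 0) I) (hy : LocallyLipschitzOn (Ici 0) y)
    (hyI : ∀ t ≥ 0, y t ∈ I) (hΨ : ContinuousOn Ψ (Ici 0)) :
    HasBoundaryValue y φ (potential G y Ψ) ↔ SolvesVolterra (c 2) G y φ Ψ := by
  refine forall₂_congr fun t ht => ?_
  have hlim := (tendsto_potential_boundary hG h hI hIup hc₀ hy hyI hΨ ht).2
  exact ⟨fun H => tendsto_nhds_unique H hlim, fun H => by rw [H]; exact hlim⟩

end BoundaryEquation

theorem mainTheorem6 (I : Set ℝ) (hI : IsOpen I) (hIup : IsUpperSet I)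
    (m : ℕ) (c : ℕ → ℝ → ℝ) (G : ℝ → ℝ → ℝ → ℝ → ℝ) (hG : IsGreenFunction I m c G)
    (y : ℝ → ℝ) (hy : ContinuousOn y (Ici 0)) (hyI : ∀ t ≥ 0, y t ∈ I) :
    -- the potential solves the equation, with zero initial data, for every density
    (∀ Ψ : ℝ → ℝ, ContinuousOn Ψ (Ici 0) →
      (∀ t > 0, ∀ x > y t,
        IntervalIntegrable (potentialIntegrand G y Ψ x t) volume 0 t) ∧
      SolvesHomogeneousProblem m c y (potential G y Ψ)) ∧
    -- second-order parabolic operators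
    (IsSecondOrderParabolic I m c → LocallyLipschitzOn (Ici 0) y →
      -- the limiting value at the boundary
      (∀ Ψ : ℝ → ℝ, ContinuousOn Ψ (Ici 0) → ∀ t > 0,
        IntervalIntegrable (potentialIntegrand G y Ψ (y t) t) volume 0 t ∧
        Tendsto (fun x => potential G y Ψ x t) (𝓝[>] (y t))
          (𝓝 (1 / (2 * c 2 (y t)) * Ψ t + potential G y Ψ (y t) t))) ∧
      -- the boundary condition holds exactly when the density solves the Volterra equation
      (∀ φ Ψ : ℝ → ℝ, ContinuousOn Ψ (Ici 0) →
        (HasBoundaryValue y φ (potential G y Ψ) ↔ SolvesVolterra (c 2) G y φ Ψ)) ∧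
      -- the boundary condition determines the density
      (∀ φ : ℝ → ℝ, ContinuousOn φ (Ici 0) →
        ∃ Ψ : ℝ → ℝ, ContinuousOn Ψ (Ici 0) ∧ HasBoundaryValue y φ (potential G y Ψ) ∧
          ∀ Ψ' : ℝ → ℝ, ContinuousOn Ψ' (Ici 0) →
            HasBoundaryValue y φ (potential G y Ψ') → EqOn Ψ' Ψ (Ici 0))) := by
  refine ⟨fun Ψ hΨ => ⟨fun t ht x hx => ?_,
    hG.solvesHomogeneousProblem hI hIup hy hyI hΨ⟩, ?_⟩
  · refine ContinuousOn.intervalIntegrable ?_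
    rw [uIcc_of_le ht.le]
    exact hG.continuousOn_potentialIntegrand hI hIup hy hyI hΨ ht.le hx
  rintro ⟨rfl, hc, hpos⟩ hyL
  obtain ⟨Z, σ, β, γ, q, h⟩ := exists_isLiouvilleData hI hIup hc hpos
  have hc₀ : ContinuousOn (c 0) I := (hc 0 (by norm_num)).continuousOn
  have hc₂ : ContinuousOn (c 2) I := (hc 2 le_rfl).continuousOn
  refine ⟨fun Ψ hΨ t ht => tendsto_potential_boundary hG h hI hIup hc₀ hyL hyI hΨ ht,
    fun φ Ψ hΨ => hasBoundaryValue_iff_solvesVolterra hG h hI hIup hc₀ hyL hyI hΨ,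
    fun φ hφ => ?_⟩
  have hiff : ∀ Ψ : ℝ → ℝ, ContinuousOn Ψ (Ici 0) →
      (HasBoundaryValue y φ (potential G y Ψ) ↔
        ∀ t ≥ 0, Ψ t = 2 * c 2 (y t) * φ t + volterraOp (boundaryKernel c G y) Ψ t) :=
    fun Ψ hΨ => (hasBoundaryValue_iff_solvesVolterra hG h hI hIup hc₀ hyL hyI hΨ).trans
      (solvesVolterra_iff hG h hI hc₀ hc₂ hpos hyL hyI hφ hΨ)
  have hk := isWeaklySingular_boundaryKernel hG h hI hc₀ hc₂ hyL hyI
  obtain ⟨Ψ, hΨ, hsol⟩ := hk.exists_solution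
    ((continuousOn_const.mul (hc₂.comp hy hyI)).mul hφ : ContinuousOn
      (fun t => 2 * c 2 (y t) * φ t) (Ici 0))
  exact ⟨Ψ, hΨ, (hiff Ψ hΨ).2 hsol, fun Ψ' hΨ' hb =>
    hk.eqOn_of_solves hΨ hΨ' hsol ((hiff Ψ' hΨ').1 hb)⟩
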